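/- An \emph{imprecise terrain} is a finite simple undirected graph whose nodes are distinct points of $\mathbb{R}^2$, together with real bounds $\mathrm{low}(v)\le \mathrm{high}(v)$ on the elevation of each node $v$. A \emph{realization} $R$ assigns to each node $v$ an elevation $R(v)\in[\mathrm{low}(v),\mathrm{high}(v)]$. A \emph{local minimum} of $R$ is a nonempty connected set $P$ of nodes of equal elevation such that every node outside $P$ that is adjacent to a node of $P$ has strictly larger elevation. A neighbour $q$ of $p$ is a \emph{steepest descent neighbour} of $p$ in $R$ if the slope $(R(p)-R(q))/|pq|$ is non-negative and maximal among all neighbours of $p$, where $|pq|$ is the Euclidean distance in $\mathbb{R}^2$. Water in a node $p$ moves to each steepest descent neighbour of $p$, except that, if $p$ lies in a local minimum $P$, it moves to the neighbours of $p$ in $P$. The node $p$ \emph{flows to} $q$ in $R$ if $q=p$ or water reaches $q$ from $p$ by a finite sequence of such moves. The \emph{potential watershed} of a set $Q$ of nodes is the set of nodes $p$ for which there are a realization $R$ and a node $q\in Q$ such that $p$ flows to $q$ in $R$. An \emph{imprecise minimum} is a set $S$ of nodes that contains a local minimum in every realization while no proper subset of $S$ has this property. The terrain is \emph{regular} if every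 local minimum of the realization $R^-=\mathrm{low}$ is an imprecise minimum. The \emph{fuzzy ridge} is the union, over all pairs of distinct imprecise minima $S\ne S'$, of the intersection of the potential watersheds of $S$ and $S'$. \textbf{Theorem.} The fuzzy ridge of a regular imprecise terrain can be computed in $O(n\log n)$ time, where $n$ is the number of edges. That is, there is a single program for a real RAM (exact real arithmetic $+,-,\times,/,\sqrt{\cdot}$ and comparisons at unit cost; natural-number indices with addition, truncated subtraction, halving, comparison and array access at unit cost; no real constants other than $0$ and $1$; no rounding) and a function $t(n)=O(n\log n)$ such that, for every regular imprecise terrain with $n$ edges, given by the coordinates and the elevation bounds of its numbered nodes and by a list of its edges in any order and orientation, the program halts after at most $t(n)$ steps and outputs a list that contains each node of the fuzzy ridge exactly once and nothing else. -/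

import Mathlib

/-! Imprecise terrains in the network model. -/

/-- An imprecise terrain: a (possibly non-planar) geometric graph in the plane, each node of
which carries a closed interval of possible elevations. -/
structure ImpreciseTerrain (V : Type*) where
  /-- the position of a node in the plane, with the Euclidean distance -/
  pos : V → EuclideanSpace ℝ (Fin 2)
  /-- distinct nodes are distinct points of the plane -/
  pos_injective : Function.Injective pos
  /-- the (undirected) edges -/
  graph : SimpleGraph V
  /-- lower bound on the elevation -/
  low : V → ℝ
  /-- upper bound on the elevation -/
  high : V → ℝ
  low_le_high : ∀ v, low v ≤ high v

namespace ImpreciseTerrain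

variable {V : Type*}

/-- `R` assigns to every node an elevation within its bounds. -/
def IsRealization (T : ImpreciseTerrain V) (R : V → ℝ) : Prop :=
  ∀ v, T.low v ≤ R v ∧ R v ≤ T.high v

/-- The nodes outside `P` that have a neighbour in `P`. -/
def neighborhood (T : ImpreciseTerrain V) (P : Set V) : Set V :=
  {s | s ∉ P ∧ ∃ t ∈ P, T.graph.Adj s t}

/-- A local minimum: a (nonempty) connected set of nodes of one common elevation, which is
strictly lower than the elevation of every node of the neighbourhood. -/
def IsLocalMin (T : ImpreciseTerrain V) (R : V → ℝ) (P : Set V) : Prop :=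
  (T.graph.induce P).Connected ∧
    ∃ h : ℝ, (∀ p ∈ P, R p = h) ∧ ∀ s ∈ T.neighborhood P, h < R s

/-- Steepness of descent from `p` to `q`. -/
noncomputable def slope (T : ImpreciseTerrain V) (R : V → ℝ) (p q : V) : ℝ :=
  (R p - R q) / dist (T.pos p) (T.pos q)

/-- `q` is a steepest descent neighbour of `p`: the slope is non-negative and maximal over all
neighbours of `p`. -/
def IsSteepestDescent (T : ImpreciseTerrain V) (R : V → ℝ) (p q : V) : Prop :=
  T.graph.Adj p q ∧ 0 ≤ T.slope R p q ∧ ∀ r, T.graph.Adj p r → T.slope R p r ≤ T.slope R p q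

/-- Water in a node `p` of a local minimum `P` moves on to the neighbours of `p` in `P`; from any
other node it moves on to each steepest descent neighbour. -/
def FlowStep (T : ImpreciseTerrain V) (R : V → ℝ) (p q : V) : Prop :=
  (∃ P, T.IsLocalMin R P ∧ p ∈ P ∧ q ∈ P ∧ T.graph.Adj p q) ∨
    ((¬ ∃ P, T.IsLocalMin R P ∧ p ∈ P) ∧ T.IsSteepestDescent R p q)

/-- Water from `p` reaches `q` in `R`; in particular every node flows to itself. -/
def FlowsTo (T : ImpreciseTerrain V) (R : V → ℝ) : V → V → Prop :=
  Relation.ReflTransGen (T.FlowStep R)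

/-- The nodes that flow to `q` in the realization `R`. -/
def watershed (T : ImpreciseTerrain V) (R : V → ℝ) (q : V) : Set V :=
  {p | T.FlowsTo R p q}

/-- The potential watershed of a set `Q` of nodes: the union of the watersheds of the nodes of `Q`
over all realizations. -/
def potentialWatershed (T : ImpreciseTerrain V) (Q : Set V) : Set V :=
  {p | ∃ R, T.IsRealization R ∧ ∃ q ∈ Q, p ∈ T.watershed R q}

/-- `S` contains a local minimum in every realization. -/
def AlwaysContainsLocalMin (T : ImpreciseTerrain V) (S : Set V) : Prop :=
  ∀ R, T.IsRealization R → ∃ P, P ⊆ S ∧ T.IsLocalMin R P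

/-- An imprecise minimum: a set that contains a local minimum in every realization, while no
proper subset does. -/
def IsImpreciseMin (T : ImpreciseTerrain V) (S : Set V) : Prop :=
  T.AlwaysContainsLocalMin S ∧ ∀ S', S' ⊂ S → ¬ T.AlwaysContainsLocalMin S'

/-- A terrain is regular if every local minimum of its lowermost realization is an imprecise
minimum. -/
def IsRegular (T : ImpreciseTerrain V) : Prop :=
  ∀ S, T.IsLocalMin T.low S → T.IsImpreciseMin S

/-- The fuzzy ridge: the union of the intersections of the potential watersheds of two distinct
imprecise minima. -/
def fuzzyRidge (T : ImpreciseTerrain V) : Set V :=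
  {p | ∃ S S', T.IsImpreciseMin S ∧ T.IsImpreciseMin S' ∧ S ≠ S' ∧
    p ∈ T.potentialWatershed S ∩ T.potentialWatershed S'}

end ImpreciseTerrain

/-! A real random access machine, presented as a structured programming language with a step
count. The memory consists of natural-number cells (used as indices) and real cells; both kinds
come as single variables and as one-dimensional arrays of unbounded length. The program text is
finite and fixed, and contains no real constants other than 0 and 1. The operations on indices are
addition, truncated subtraction and halving; the operations on reals are the four arithmetic
operations and the square root. There is no rounding and no conversion between the two kinds. -/

namespace RealRAM

/-- The memory of the machine. -/
structure State where
  /-- natural-number variables -/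
  natVar : ℕ → ℕ
  /-- real variables -/
  realVar : ℕ → ℝ
  /-- natural-number arrays: `natArr a i` is cell `i` of array `a` -/
  natArr : ℕ → ℕ → ℕ
  /-- real arrays: `realArr a i` is cell `i` of array `a` -/
  realArr : ℕ → ℕ → ℝ

/-- Index expressions. -/
inductive NatExp : Type
  | const (k : ℕ)
  | var (x : ℕ)
  | get (a : ℕ) (i : NatExp)
  | add (e f : NatExp)
  | sub (e f : NatExp)
  | half (e : NatExp)

/-- Real expressions. -/
inductive RealExp : Type
  | zero
  | one
  | var (x : ℕ)
  | get (a : ℕ) (i : NatExp)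
  | add (e f : RealExp)
  | sub (e f : RealExp)
  | mul (e f : RealExp)
  | div (e f : RealExp)
  | sqrt (e : RealExp)

/-- Tests. -/
inductive Test : Type
  | natLe (e f : NatExp)
  | realLe (e f : RealExp)
  | neg (b : Test)
  | and (b c : Test)

/-- Programs. -/
inductive Prog : Type
  | skip
  | setNat (x : ℕ) (e : NatExp)
  | setReal (x : ℕ) (e : RealExp)
  | putNat (a : ℕ) (i e : NatExp)
  | putReal (a : ℕ) (i : NatExp) (e : RealExp)
  | seq (c d : Prog)
  | cond (b : Test) (c d : Prog)
  | loop (b : Test) (c : Prog)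

/-- Value of an index expression. -/
def NatExp.eval (s : State) : NatExp → ℕ
  | .const k => k
  | .var x => s.natVar x
  | .get a i => s.natArr a (i.eval s)
  | .add e f => e.eval s + f.eval s
  | .sub e f => e.eval s - f.eval s
  | .half e => e.eval s / 2

/-- Number of operations and memory accesses in an index expression. -/
def NatExp.cost : NatExp → ℕ
  | .const _ => 1
  | .var _ => 1
  | .get _ i => i.cost + 1
  | .add e f => e.cost + f.cost + 1
  | .sub e f => e.cost + f.cost + 1
  | .half e => e.cost + 1

/-- Value of a real expression. -/
noncomputable def RealExp.eval (s : State) : RealExp → ℝ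
  | .zero => 0
  | .one => 1
  | .var x => s.realVar x
  | .get a i => s.realArr a (i.eval s)
  | .add e f => e.eval s + f.eval s
  | .sub e f => e.eval s - f.eval s
  | .mul e f => e.eval s * f.eval s
  | .div e f => e.eval s / f.eval s
  | .sqrt e => Real.sqrt (e.eval s)

/-- Number of operations and memory accesses in a real expression. -/
def RealExp.cost : RealExp → ℕ
  | .zero => 1
  | .one => 1
  | .var _ => 1
  | .get _ i => i.cost + 1
  | .add e f => e.cost + f.cost + 1
  | .sub e f => e.cost + f.cost + 1
  | .mul e f => e.cost + f.cost + 1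
  | .div e f => e.cost + f.cost + 1
  | .sqrt e => e.cost + 1

/-- Outcome of a test. -/
def Test.Holds (s : State) : Test → Prop
  | .natLe e f => e.eval s ≤ f.eval s
  | .realLe e f => e.eval s ≤ f.eval s
  | .neg b => ¬ b.Holds s
  | .and b c => b.Holds s ∧ c.Holds s

/-- Number of operations and memory accesses in a test. -/
def Test.cost : Test → ℕ
  | .natLe e f => e.cost + f.cost + 1
  | .realLe e f => e.cost + f.cost + 1
  | .neg b => b.cost + 1
  | .and b c => b.cost + c.cost + 1

/-- `Runs c s s' t`: the program `c`, started in the memory state `s`, halts in the memory state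
`s'` after `t` elementary steps. -/
inductive Runs : Prog → State → State → ℕ → Prop
  | skip (s : State) : Runs .skip s s 1
  | setNat (x : ℕ) (e : NatExp) (s : State) :
      Runs (.setNat x e) s { s with natVar := Function.update s.natVar x (e.eval s) } (e.cost + 1)
  | setReal (x : ℕ) (e : RealExp) (s : State) :
      Runs (.setReal x e) s { s with realVar := Function.update s.realVar x (e.eval s) }
        (e.cost + 1)
  | putNat (a : ℕ) (i e : NatExp) (s : State) :
      Runs (.putNat a i e) s
        { s with natArr := Function.update s.natArr a
                  (Function.update (s.natArr a) (i.eval s) (e.eval s)) }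
        (i.cost + e.cost + 1)
  | putReal (a : ℕ) (i : NatExp) (e : RealExp) (s : State) :
      Runs (.putReal a i e) s
        { s with realArr := Function.update s.realArr a
                  (Function.update (s.realArr a) (i.eval s) (e.eval s)) }
        (i.cost + e.cost + 1)
  | seq {c d : Prog} {s s' s'' : State} {t t' : ℕ} :
      Runs c s s' t → Runs d s' s'' t' → Runs (.seq c d) s s'' (t + t')
  | condTrue {b : Test} {c d : Prog} {s s' : State} {t : ℕ} :
      b.Holds s → Runs c s s' t → Runs (.cond b c d) s s' (b.cost + 1 + t)
  | condFalse {b : Test} {c d : Prog} {s s' : State} {t : ℕ} :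
      ¬ b.Holds s → Runs d s s' t → Runs (.cond b c d) s s' (b.cost + 1 + t)
  | loopTrue {b : Test} {c : Prog} {s s' s'' : State} {t t' : ℕ} :
      b.Holds s → Runs c s s' t → Runs (.loop b c) s' s'' t' →
        Runs (.loop b c) s s'' (b.cost + 1 + t + t')
  | loopFalse {b : Test} {c : Prog} {s : State} :
      ¬ b.Holds s → Runs (.loop b c) s s (b.cost + 1)

end RealRAM

/-! Input and output conventions for terrains. -/

/-- `ends` lists every edge of the terrain exactly once, as a pair of end nodes; order and
orientation are arbitrary. In particular the terrain has exactly `n` edges. -/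
def ImpreciseTerrain.IsEdgeList {m n : ℕ} (T : ImpreciseTerrain (Fin m))
    (ends : Fin n → Fin m × Fin m) : Prop :=
  (∀ k, T.graph.Adj (ends k).1 (ends k).2) ∧
    ∀ e ∈ T.graph.edgeSet, ∃! k, s((ends k).1, (ends k).2) = e

/-- The initial memory: index variables 0 and 1 hold the number of nodes and of edges, the real
arrays 0, 1, 2, 3 hold the two coordinates and the lower and upper elevation bounds of the nodes,
the index arrays 0 and 1 hold the end nodes of the edges, and everything else is 0. -/
noncomputable def ImpreciseTerrain.inputState {m n : ℕ} (T : ImpreciseTerrain (Fin m))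
    (ends : Fin n → Fin m × Fin m) : RealRAM.State where
  natVar x := if x = 0 then m else if x = 1 then n else 0
  realVar _ := 0
  natArr a k :=
    if hk : k < n then
      if a = 0 then ((ends ⟨k, hk⟩).1 : ℕ) else if a = 1 then ((ends ⟨k, hk⟩).2 : ℕ) else 0
    else 0
  realArr a i :=
    if hi : i < m then
      if a = 0 then T.pos ⟨i, hi⟩ 0
      else if a = 1 then T.pos ⟨i, hi⟩ 1
      else if a = 2 then T.low ⟨i, hi⟩
      else if a = 3 then T.high ⟨i, hi⟩
      else 0
    else 0

/-- The final memory presents the node set `A`: index variable 2 holds the number of nodes of `A`,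
and the first cells of index array 2 list these nodes, each exactly once. -/
def RealRAM.State.Outputs {m : ℕ} (s : RealRAM.State) (A : Set (Fin m)) : Prop :=
  ((List.range (s.natVar 2)).map (s.natArr 2)).Nodup ∧
    ∀ v : ℕ, v ∈ (List.range (s.natVar 2)).map (s.natArr 2) ↔ ∃ p ∈ A, (p : ℕ) = v

/-! Flow. The special rule for local minima is redundant: inside a local minimum the steepest
descent neighbours are exactly the neighbours in it (`flowStep_iff`). To send water from `p` towards
a set, it is best to place the nodes of a route at chosen elevations and all others as high as
possible. Adding the nodes of a route in order of increasing elevation never spoils what has been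
placed, since a later node is not lower. Hence potential watersheds are described by the elevations
at which a node can pass water to one neighbour (`mem_potentialWatershed_iff`).

Two minima instead of all. By regularity the imprecise minima are the local minima of the lowermost
realization. Every node flows there to a chosen root, so it already belongs to the potential
watershed of one minimum; it lies on the fuzzy ridge iff it can also reach a different one. Consider
a first step from `p` to `q`. If the roots differ, `q` at its lowest elevation supplies another
minimum. If they agree, `q` must itself be able to reach a minimum other than its own. This
recursion, `ReachOther`, no longer mentions the target (`IsRegular.fuzzyRidge_eq`). Lowering the
receiving elevation never hurts (`CanFlow.anti`), and a sending node is never below its receiver, so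
a single search in Dijkstra's manner by least elevation decides it for all nodes.

Relaxing an edge. For an edge from `p` to `q` one needs the least `z`, at least the lower bound of
`p`, where the line of slopes towards `q` is above zero and above the lines of slopes towards all
neighbours at their upper bounds. The competitors have an upper envelope that depends on `p` only,
and the first contact with it is found by binary search (`crossing_zero`, `crossing_succ`,
`ok_cross`). Lines are inserted by increasing reciprocal edge length; an insertion is one such
search followed by truncation (`Envelope.push`), so its cost is logarithmic without amortization.

Roots. They are found by a second search on the lowermost realization, which gives a label to the
head of a steepest descent edge as soon as its tail has one. Only when no such edge is left does a
lowest unlabelled node become a new root (`bottom_of_closed`). Sorting and both searches use one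
tournament tree with a slot per directed edge. Each edge is handled a bounded number of times in
each phase, at logarithmic cost. Isolated nodes are never visited, so the time depends on the number
of edges alone. -/

namespace RealRAM

/-! ### Elementary updates of the memory -/

namespace State

/-- Assign an index variable. -/
def setN (s : State) (x v : ℕ) : State := { s with natVar := Function.update s.natVar x v }

/-- Assign a real variable. -/
def setR (s : State) (x : ℕ) (v : ℝ) : State := { s with realVar := Function.update s.realVar x v }

/-- Assign a cell of an index array. -/
def putN (s : State) (a i v : ℕ) : State :=
  { s with natArr := Function.update s.natArr a (Function.update (s.natArr a) i v) }

/-- Assign a cell of a real array. -/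
def putR (s : State) (a i : ℕ) (v : ℝ) : State :=
  { s with realArr := Function.update s.realArr a (Function.update (s.realArr a) i v) }

variable (s : State) (x i v y j : ℕ) (r : ℝ)

@[simp] lemma setN_natVar : (s.setN x v).natVar y = if y = x then v else s.natVar y := by
  simp [setN, Function.update_apply]
@[simp] lemma setN_realVar : (s.setN x v).realVar = s.realVar := rfl
@[simp] lemma setN_natArr : (s.setN x v).natArr = s.natArr := rfl
@[simp] lemma setN_realArr : (s.setN x v).realArr = s.realArr := rfl
@[simp] lemma setR_realVar : (s.setR x r).realVar y = if y = x then r else s.realVar y := by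
  simp [setR, Function.update_apply]
@[simp] lemma setR_natVar : (s.setR x r).natVar = s.natVar := rfl
@[simp] lemma setR_natArr : (s.setR x r).natArr = s.natArr := rfl
@[simp] lemma setR_realArr : (s.setR x r).realArr = s.realArr := rfl
@[simp] lemma putN_natArr :
    (s.putN x i v).natArr y = if y = x then Function.update (s.natArr x) i v else s.natArr y := by
  simp [putN, Function.update_apply]
@[simp] lemma putN_natVar : (s.putN x i v).natVar = s.natVar := rfl
@[simp] lemma putN_realVar : (s.putN x i v).realVar = s.realVar := rfl
@[simp] lemma putN_realArr : (s.putN x i v).realArr = s.realArr := rfl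
@[simp] lemma putR_realArr :
    (s.putR x i r).realArr y =
      if y = x then Function.update (s.realArr x) i r else s.realArr y := by
  simp [putR, Function.update_apply]
@[simp] lemma putR_natVar : (s.putR x i r).natVar = s.natVar := rfl
@[simp] lemma putR_realVar : (s.putR x i r).realVar = s.realVar := rfl
@[simp] lemma putR_natArr : (s.putR x i r).natArr = s.natArr := rfl

end State

/-! ### Loop-free programs -/

/-- A sequence of programs. -/
def block : List Prog → Prog
  | [] => .skip
  | c :: cs => .seq c (block cs)

/-- Programs without loops. -/
def Prog.loopFree : Prog → Bool
  | .seq c d => c.loopFree && d.loopFree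
  | .cond _ c d => c.loopFree && d.loopFree
  | .loop _ _ => false
  | _ => true

open Classical in
/-- The effect of a loop-free program. -/
noncomputable def Prog.exec : Prog → State → State
  | .skip, s => s
  | .setNat x e, s => s.setN x (e.eval s)
  | .setReal x e, s => s.setR x (e.eval s)
  | .putNat a i e, s => s.putN a (i.eval s) (e.eval s)
  | .putReal a i e, s => s.putR a (i.eval s) (e.eval s)
  | .seq c d, s => d.exec (c.exec s)
  | .cond b c d, s => if b.Holds s then c.exec s else d.exec s
  | .loop _ _, s => s

/-- A bound for the running time of a loop-free program. -/
def Prog.bound : Prog → ℕ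
  | .skip => 1
  | .setNat _ e => e.cost + 1
  | .setReal _ e => e.cost + 1
  | .putNat _ i e => i.cost + e.cost + 1
  | .putReal _ i e => i.cost + e.cost + 1
  | .seq c d => c.bound + d.bound
  | .cond b c d => b.cost + 1 + (c.bound + d.bound)
  | .loop _ _ => 0

lemma runs_exec : ∀ (c : Prog) (s : State), c.loopFree = true →
    ∃ t, Runs c s (c.exec s) t ∧ t ≤ c.bound
  | .skip, s, _ => ⟨_, .skip s, le_rfl⟩
  | .setNat x e, s, _ => ⟨_, .setNat x e s, le_rfl⟩
  | .setReal x e, s, _ => ⟨_, .setReal x e s, le_rfl⟩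
  | .putNat a i e, s, _ => ⟨_, .putNat a i e s, le_rfl⟩
  | .putReal a i e, s, _ => ⟨_, .putReal a i e s, le_rfl⟩
  | .seq c d, s, h => by
    simp only [Prog.loopFree, Bool.and_eq_true] at h
    obtain ⟨t, ht, hb⟩ := runs_exec c s h.1
    obtain ⟨t', ht', hb'⟩ := runs_exec d (c.exec s) h.2
    exact ⟨_, .seq ht ht', by simp only [Prog.bound]; omega⟩
  | .cond b c d, s, h => by
    simp only [Prog.loopFree, Bool.and_eq_true] at h
    by_cases hs : b.Holds s
    · obtain ⟨t, ht, hb⟩ := runs_exec c s h.1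
      refine ⟨_, by simpa only [Prog.exec, if_pos hs] using Runs.condTrue hs ht, ?_⟩
      simp only [Prog.bound]; omega
    · obtain ⟨t, ht, hb⟩ := runs_exec d s h.2
      refine ⟨_, by simpa only [Prog.exec, if_neg hs] using Runs.condFalse hs ht, ?_⟩
      simp only [Prog.bound]; omega

/-! ### What a program does not write -/

/-- The index variables that a program may write. -/
def Prog.wN : Prog → List ℕ
  | .setNat x _ => [x]
  | .seq c d => c.wN ++ d.wN
  | .cond _ c d => c.wN ++ d.wN
  | .loop _ c => c.wN
  | _ => []

/-- The real variables that a program may write. -/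
def Prog.wR : Prog → List ℕ
  | .setReal x _ => [x]
  | .seq c d => c.wR ++ d.wR
  | .cond _ c d => c.wR ++ d.wR
  | .loop _ c => c.wR
  | _ => []

/-- The index arrays that a program may write. -/
def Prog.wNA : Prog → List ℕ
  | .putNat a _ _ => [a]
  | .seq c d => c.wNA ++ d.wNA
  | .cond _ c d => c.wNA ++ d.wNA
  | .loop _ c => c.wNA
  | _ => []

/-- The real arrays that a program may write. -/
def Prog.wRA : Prog → List ℕ
  | .putReal a _ _ => [a]
  | .seq c d => c.wRA ++ d.wRA
  | .cond _ c d => c.wRA ++ d.wRA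
  | .loop _ c => c.wRA
  | _ => []

/-- The two memory states agree on everything that `c` does not write. -/
structure Frame (c : Prog) (s s' : State) : Prop where
  n : ∀ x, x ∉ c.wN → s'.natVar x = s.natVar x
  r : ∀ x, x ∉ c.wR → s'.realVar x = s.realVar x
  na : ∀ x, x ∉ c.wNA → s'.natArr x = s.natArr x
  ra : ∀ x, x ∉ c.wRA → s'.realArr x = s.realArr x

lemma Frame.refl (c : Prog) (s : State) : Frame c s s :=
  ⟨fun _ _ => rfl, fun _ _ => rfl, fun _ _ => rfl, fun _ _ => rfl⟩

lemma Frame.trans {c : Prog} {s s' s'' : State} (h : Frame c s s') (h' : Frame c s' s'') :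
    Frame c s s'' :=
  ⟨fun x hx => (h'.n x hx).trans (h.n x hx), fun x hx => (h'.r x hx).trans (h.r x hx),
    fun x hx => (h'.na x hx).trans (h.na x hx), fun x hx => (h'.ra x hx).trans (h.ra x hx)⟩

lemma Frame.mono {c d : Prog} {s s' : State} (h : Frame c s s') (hn : c.wN ⊆ d.wN)
    (hr : c.wR ⊆ d.wR) (hna : c.wNA ⊆ d.wNA) (hra : c.wRA ⊆ d.wRA) : Frame d s s' :=
  ⟨fun x hx => h.n x fun h => hx (hn h), fun x hx => h.r x fun h => hx (hr h),
    fun x hx => h.na x fun h => hx (hna h), fun x hx => h.ra x fun h => hx (hra h)⟩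

/-- Write sets are read off the program text. Later proofs can therefore settle the preservation of
untouched cells mostly by `decide`, without unfolding the subprogram. -/
lemma Runs.frame {c : Prog} {s s' : State} {t : ℕ} (h : Runs c s s' t) : Frame c s s' := by
  induction h with
  | skip s => exact Frame.refl _ _
  | setNat x e s =>
    exact ⟨fun y hy => Function.update_of_ne (by simpa [Prog.wN] using hy) _ _,
      fun _ _ => rfl, fun _ _ => rfl, fun _ _ => rfl⟩
  | setReal x e s =>
    exact ⟨fun _ _ => rfl, fun y hy => Function.update_of_ne (by simpa [Prog.wR] using hy) _ _,
      fun _ _ => rfl, fun _ _ => rfl⟩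
  | putNat a i e s =>
    exact ⟨fun _ _ => rfl, fun _ _ => rfl,
      fun y hy => Function.update_of_ne (by simpa [Prog.wNA] using hy) _ _, fun _ _ => rfl⟩
  | putReal a i e s =>
    exact ⟨fun _ _ => rfl, fun _ _ => rfl, fun _ _ => rfl,
      fun y hy => Function.update_of_ne (by simpa [Prog.wRA] using hy) _ _⟩
  | seq _ _ h1 h2 =>
    exact (h1.mono (by simp [Prog.wN]) (by simp [Prog.wR]) (by simp [Prog.wNA])
      (by simp [Prog.wRA])).trans (h2.mono (by simp [Prog.wN]) (by simp [Prog.wR])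
      (by simp [Prog.wNA]) (by simp [Prog.wRA]))
  | condTrue _ _ h =>
    exact h.mono (by simp [Prog.wN]) (by simp [Prog.wR]) (by simp [Prog.wNA]) (by simp [Prog.wRA])
  | condFalse _ _ h =>
    exact h.mono (by simp [Prog.wN]) (by simp [Prog.wR]) (by simp [Prog.wNA]) (by simp [Prog.wRA])
  | loopTrue _ _ _ h1 h2 =>
    exact (h1.mono (by simp [Prog.wN]) (by simp [Prog.wR]) (by simp [Prog.wNA])
      (by simp [Prog.wRA])).trans h2
  | loopFalse _ => exact Frame.refl _ _

/-! ### Total correctness with time bounds -/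

/-- Started in `s`, the program `c` halts within `T` steps in a state that satisfies `Q`. -/
def Ok (c : Prog) (s : State) (T : ℕ) (Q : State → Prop) : Prop :=
  ∃ s' t, Runs c s s' t ∧ t ≤ T ∧ Q s'

namespace Ok

variable {c d : Prog} {b : Test} {s : State} {T T' : ℕ} {Q Q' : State → Prop}

lemma mono (h : Ok c s T Q) (hT : T ≤ T') (hQ : ∀ s', Q s' → Q' s') : Ok c s T' Q' := by
  obtain ⟨s', t, hr, ht, hq⟩ := h
  exact ⟨s', t, hr, ht.trans hT, hQ _ hq⟩

lemma framed (h : Ok c s T Q) : Ok c s T fun s' => Q s' ∧ Frame c s s' := by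
  obtain ⟨s', t, hr, ht, hq⟩ := h
  exact ⟨s', t, hr, ht, hq, hr.frame⟩

lemma post (h : Ok c s T Q) (hT : T ≤ T') (hQ : ∀ s', Q s' → Frame c s s' → Q' s') :
    Ok c s T' Q' :=
  h.framed.mono hT fun s' h => hQ s' h.1 h.2

lemma straight (hc : c.loopFree = true) (hT : c.bound ≤ T) (hQ : Q (c.exec s)) : Ok c s T Q := by
  obtain ⟨t, ht, hb⟩ := runs_exec c s hc
  exact ⟨_, t, ht, hb.trans hT, hQ⟩

lemma seq {T₁ T₂ : ℕ} {R : State → Prop} (h₁ : Ok c s T₁ R)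
    (h₂ : ∀ s', R s' → Frame c s s' → Ok d s' T₂ Q) (hT : T₁ + T₂ ≤ T) : Ok (.seq c d) s T Q := by
  obtain ⟨s', t, hr, ht, hq⟩ := h₁
  obtain ⟨s'', t', hr', ht', hq'⟩ := h₂ s' hq hr.frame
  exact ⟨s'', t + t', .seq hr hr', by omega, hq'⟩

lemma nil (hT : 1 ≤ T) (hQ : Q s) : Ok (block []) s T Q :=
  ⟨s, 1, .skip s, hT, hQ⟩

lemma cons {cs : List Prog} {T₁ T₂ : ℕ} {R : State → Prop} (h₁ : Ok c s T₁ R)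
    (h₂ : ∀ s', R s' → Frame c s s' → Ok (block cs) s' T₂ Q) (hT : T₁ + T₂ ≤ T) :
    Ok (block (c :: cs)) s T Q :=
  seq h₁ h₂ hT

lemma cond {T₁ : ℕ} (h₁ : b.Holds s → Ok c s T₁ Q) (h₂ : ¬ b.Holds s → Ok d s T₁ Q)
    (hT : b.cost + 1 + T₁ ≤ T) : Ok (.cond b c d) s T Q := by
  by_cases hb : b.Holds s
  · obtain ⟨s', t, hr, ht, hq⟩ := h₁ hb
    exact ⟨s', _, .condTrue hb hr, by omega, hq⟩
  · obtain ⟨s', t, hr, ht, hq⟩ := h₂ hb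
    exact ⟨s', _, .condFalse hb hr, by omega, hq⟩

/-- Loops: `I` is an invariant and every iteration decreases `μ`. -/
lemma loop {T₁ : ℕ} (I : State → ℕ → Prop)
    (hbody : ∀ s μ, I s μ → b.Holds s → Ok c s T₁ fun s' => ∃ μ' < μ, I s' μ')
    {N : ℕ} (hI : I s N) (hQ : ∀ s μ, I s μ → ¬ b.Holds s → Q s)
    (hT : (b.cost + 1 + T₁) * N + (b.cost + 1) ≤ T) : Ok (.loop b c) s T Q := by
  suffices h : ∀ N s, I s N → Ok (.loop b c) s ((b.cost + 1 + T₁) * N + (b.cost + 1)) Q from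
    (h N s hI).mono hT fun _ h => h
  intro N
  induction N using Nat.strong_induction_on with
  | _ N ih =>
    intro s hs
    by_cases hb : b.Holds s
    · obtain ⟨s', t, hr, ht, μ', hμ, hI'⟩ := hbody s N hs hb
      obtain ⟨s'', t', hr', ht', hq⟩ := ih μ' hμ s' hI'
      refine ⟨s'', _, .loopTrue hb hr hr', ?_, hq⟩
      have : (b.cost + 1 + T₁) * (μ' + 1) ≤ (b.cost + 1 + T₁) * N := Nat.mul_le_mul_left _ hμ
      rw [Nat.mul_add] at this
      omega
    · exact ⟨s, _, .loopFalse hb, by omega, hQ s N hs hb⟩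

end Ok

/-! ### A tournament tree

The slots `1, …, M - 1` are the leaves `M + 1, …, 2 M - 1` of the tree that is stored in index array
`5` (the winning slot of every node, `0` if there is none) and real array `5` (its key). -/

open Classical in
/-- The winner of two tree nodes, each given by a slot and a key. -/
noncomputable def winner (l r : ℕ × ℝ) : ℕ × ℝ :=
  if 1 ≤ l.1 ∧ ¬ (1 ≤ r.1 ∧ ¬ l.2 ≤ r.2) then l else r

lemma winner_left {l r : ℕ × ℝ} (h : 1 ≤ l.1 ∧ ¬ (1 ≤ r.1 ∧ ¬ l.2 ≤ r.2)) : winner l r = l := by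
  simp only [winner, if_pos h]

lemma winner_right {l r : ℕ × ℝ} (h : ¬ (1 ≤ l.1 ∧ ¬ (1 ≤ r.1 ∧ ¬ l.2 ≤ r.2))) :
    winner l r = r := by
  simp only [winner, if_neg h]

/-- The state of a tree node. -/
def State.node (s : State) (i : ℕ) : ℕ × ℝ := (s.natArr 5 i, s.realArr 5 i)

/-- The tree is consistent. -/
structure TreeOk (M : ℕ) (s : State) : Prop where
  inner : ∀ i, 1 ≤ i → i < M → s.node i = winner (s.node (2 * i)) (s.node (2 * i + 1))
  leaf : ∀ e < M, s.natArr 5 (M + e) = 0 ∨ s.natArr 5 (M + e) = e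

open Classical in
/-- The key of a slot, if the slot is occupied. -/
noncomputable def State.pend (s : State) (M e : ℕ) : Option ℝ :=
  if 1 ≤ e ∧ e < M ∧ s.natArr 5 (M + e) = e then some (s.realArr 5 (M + e)) else none

lemma State.pend_congr {s s' : State} (M : ℕ) (h1 : s'.natArr 5 = s.natArr 5)
    (h2 : s'.realArr 5 = s.realArr 5) : s'.pend M = s.pend M := by
  funext e
  simp only [State.pend, h1, h2]

lemma TreeOk.congr {s s' : State} {M : ℕ} (h : TreeOk M s) (h1 : s'.natArr 5 = s.natArr 5)
    (h2 : s'.realArr 5 = s.realArr 5) : TreeOk M s' :=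
  ⟨by simpa only [State.node, h1, h2] using h.inner, by simpa only [h1] using h.leaf⟩

lemma State.pend_slot {s : State} {M e : ℕ} {k : ℝ} (h : s.pend M e = some k) :
    1 ≤ e ∧ e < M := by
  unfold State.pend at h
  split_ifs at h with hc
  exact ⟨hc.1, hc.2.1⟩

lemma node_eq_iff {s : State} {i j : ℕ} :
    s.node i = s.node j ↔ s.natArr 5 i = s.natArr 5 j ∧ s.realArr 5 i = s.realArr 5 j := by
  simp [State.node]

/-- The left child of node `i` wins. -/
def State.LeftWins (s : State) (i : ℕ) : Prop :=
  1 ≤ s.natArr 5 (2 * i) ∧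
    ¬ (1 ≤ s.natArr 5 (2 * i + 1) ∧ ¬ s.realArr 5 (2 * i) ≤ s.realArr 5 (2 * i + 1))

lemma TreeOk.inner_cases {M : ℕ} {s : State} (h : TreeOk M s) {i : ℕ} (h1 : 1 ≤ i) (h2 : i < M) :
    (s.LeftWins i ∧ s.natArr 5 i = s.natArr 5 (2 * i) ∧ s.realArr 5 i = s.realArr 5 (2 * i)) ∨
    (¬ s.LeftWins i ∧ s.natArr 5 i = s.natArr 5 (2 * i + 1) ∧
      s.realArr 5 i = s.realArr 5 (2 * i + 1)) := by
  have hi := h.inner i h1 h2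
  by_cases hc : s.LeftWins i
  · rw [winner_left (l := s.node (2 * i)) (r := s.node (2 * i + 1)) hc, node_eq_iff] at hi
    exact .inl ⟨hc, hi⟩
  · rw [winner_right (l := s.node (2 * i)) (r := s.node (2 * i + 1)) hc, node_eq_iff] at hi
    exact .inr ⟨hc, hi⟩

/-- Climb from `j` to `j / 2`: the winner of the parent is at least as good as either child. Hence
the root carries a minimum key. The number of leaves need not be a power of two. -/
lemma TreeOk.le_root {M : ℕ} {s : State} (h : TreeOk M s) (j : ℕ) (h1 : 1 ≤ j) (h2 : j < 2 * M)
    (hj : 1 ≤ s.natArr 5 j) : 1 ≤ s.natArr 5 1 ∧ s.realArr 5 1 ≤ s.realArr 5 j := by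
  induction j using Nat.strong_induction_on with
  | _ j ih =>
    rcases Nat.eq_or_lt_of_le h1 with rfl | h1'
    · exact ⟨hj, le_rfl⟩
    have key : 1 ≤ s.natArr 5 (j / 2) ∧ s.realArr 5 (j / 2) ≤ s.realArr 5 j := by
      obtain ⟨i, rfl | rfl⟩ := Nat.even_or_odd' j
      · rw [show 2 * i / 2 = i by omega]
        rcases h.inner_cases (i := i) (by omega) (by omega) with ⟨hc, h3, h4⟩ | ⟨hc, h3, h4⟩
        · rw [h3, h4]; exact ⟨hj, le_rfl⟩
        · rw [h3, h4]
          have hc' : 1 ≤ s.natArr 5 (2 * i + 1) ∧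
              ¬ s.realArr 5 (2 * i) ≤ s.realArr 5 (2 * i + 1) := by
            by_contra hcon; exact hc ⟨hj, hcon⟩
          exact ⟨hc'.1, (not_le.1 hc'.2).le⟩
      · rw [show (2 * i + 1) / 2 = i by omega]
        rcases h.inner_cases (i := i) (by omega) (by omega) with ⟨hc, h3, h4⟩ | ⟨hc, h3, h4⟩
        · rw [h3, h4]
          refine ⟨hc.1, ?_⟩
          by_contra hcon
          exact hc.2 ⟨hj, hcon⟩
        · rw [h3, h4]; exact ⟨hj, le_rfl⟩
    obtain ⟨h3, h4⟩ := ih (j / 2) (by omega) (by omega) (by omega) key.1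
    exact ⟨h3, h4.trans key.2⟩

/-- Follow the winning child down to a leaf. A nonempty leaf `M + e` stores its own slot number `e`;
slot `0` can only store `0`, which doubles as the mark for an empty slot. -/
lemma TreeOk.pend_of_ne_zero {M : ℕ} {s : State} (h : TreeOk M s) (i : ℕ) (h1 : 1 ≤ i)
    (h2 : i < 2 * M) (hi : 1 ≤ s.natArr 5 i) :
    s.pend M (s.natArr 5 i) = some (s.realArr 5 i) := by
  induction hd : 2 * M - i using Nat.strong_induction_on generalizing i with
  | _ d ih =>
    by_cases hM : i < M
    · rcases h.inner_cases h1 hM with ⟨hc, h3, h4⟩ | ⟨hc, h3, h4⟩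
      · rw [h3, h4]
        exact ih _ (by omega) (2 * i) (by omega) (by omega) hc.1 rfl
      · rw [h3, h4]
        exact ih _ (by omega) (2 * i + 1) (by omega) (by omega) (by omega) rfl
    · obtain ⟨e, rfl⟩ := Nat.exists_eq_add_of_le (not_lt.1 hM)
      have he := h.leaf e (by omega)
      have he' : s.natArr 5 (M + e) = e := by omega
      rw [he'] at hi ⊢
      simp only [State.pend]
      rw [if_pos ⟨hi, by omega, he'⟩]

lemma TreeOk.root_zero {M : ℕ} {s : State} (h : TreeOk M s) (hr : ¬ 1 ≤ s.natArr 5 1) (e : ℕ) :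
    s.pend M e = none := by
  unfold State.pend
  split_ifs with hc
  · exact absurd (h.le_root (M + e) (by omega) (by omega) (by omega)).1 hr
  · rfl

lemma TreeOk.root_pend {M : ℕ} {s : State} (h : TreeOk M s) (hM : 1 ≤ M)
    (hr : 1 ≤ s.natArr 5 1) : s.pend M (s.natArr 5 1) = some (s.realArr 5 1) :=
  h.pend_of_ne_zero 1 le_rfl (by omega) hr

lemma TreeOk.root_le {M : ℕ} {s : State} (h : TreeOk M s) {e : ℕ} {k : ℝ}
    (he : s.pend M e = some k) : s.realArr 5 1 ≤ k := by
  unfold State.pend at he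
  split_ifs at he with hc
  cases he
  exact (h.le_root (M + e) (by omega) (by omega) (by omega)).2

/-- Copy tree node `j` to tree node `v8`. -/
def copyNode (j : NatExp) : Prog :=
  block [.putNat 5 (.var 8) (.get 5 j), .putReal 5 (.var 8) (.get 5 j)]

/-- The left child of tree node `v8`. -/
def leftChild : NatExp := .add (.var 8) (.var 8)

/-- The right child of tree node `v8`. -/
def rightChild : NatExp := .add (.add (.var 8) (.var 8)) (.const 1)

/-- The left child of tree node `v8` wins. -/
def leftWins : Test :=
  .and (.natLe (.const 1) (.get 5 leftChild))
    (.neg (.and (.natLe (.const 1) (.get 5 rightChild))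
      (.neg (.realLe (.get 5 leftChild) (.get 5 rightChild)))))

/-- One step of the upward pass. -/
def treeStep : Prog :=
  block [.cond leftWins (copyNode leftChild) (copyNode rightChild), .setNat 8 (.half (.var 8))]

/-- Give slot `v6` the key in real variable `0` if `v7 = v6`, and empty it if `v7 = 0`. -/
def treeUp : Prog :=
  block [block [.putNat 5 (.add (.var 4) (.var 6)) (.var 7),
      .putReal 5 (.add (.var 4) (.var 6)) (.var 0),
      .setNat 8 (.half (.add (.var 4) (.var 6)))],
    .loop (.natLe (.const 1) (.var 8)) treeStep]

lemma treeStep_exec (s : State) :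
    (treeStep.exec s).natVar 8 = s.natVar 8 / 2 ∧
    (∀ j, j ≠ s.natVar 8 → (treeStep.exec s).node j = s.node j) ∧
    (treeStep.exec s).node (s.natVar 8) =
      winner (s.node (2 * s.natVar 8)) (s.node (2 * s.natVar 8 + 1)) := by
  have e1 : s.natVar 8 + s.natVar 8 = 2 * s.natVar 8 := by omega
  by_cases h : leftWins.Holds s
  · have h' := h
    simp only [leftWins, Test.Holds, NatExp.eval, RealExp.eval, leftChild, rightChild, e1] at h'
    refine ⟨?_, fun j hj => ?_, ?_⟩
    · simp [treeStep, block, Prog.exec, if_pos h, copyNode, NatExp.eval]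
    · simp [treeStep, block, Prog.exec, if_pos h, copyNode, NatExp.eval, State.node, hj]
    · rw [winner_left h']
      simp [State.node, treeStep, block, Prog.exec, if_pos h, copyNode, NatExp.eval, RealExp.eval,
        leftChild, e1]
  · have h' := h
    simp only [leftWins, Test.Holds, NatExp.eval, RealExp.eval, leftChild, rightChild, e1] at h'
    refine ⟨?_, fun j hj => ?_, ?_⟩
    · simp [treeStep, block, Prog.exec, if_neg h, copyNode, NatExp.eval]
    · simp [treeStep, block, Prog.exec, if_neg h, copyNode, NatExp.eval, State.node, hj]
    · rw [winner_right h']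
      simp [State.node, treeStep, block, Prog.exec, if_neg h, copyNode, NatExp.eval, RealExp.eval,
        rightChild, e1]

/-- A changed leaf affects only its ancestors. The invariant exempts just the current node from
consistency, and each round repairs it and moves the exemption to its parent. -/
lemma ok_treeUp {s : State} {M L e : ℕ} (hM : s.natVar 4 = M) (hL : M ≤ 2 ^ L) (ht : TreeOk M s)
    (he : s.natVar 6 = e) (h1 : 1 ≤ e) (h2 : e < M) (hv : s.natVar 7 = 0 ∨ s.natVar 7 = e) :
    Ok treeUp s (200 * (L + 1)) fun s' => TreeOk M s' ∧
      s'.pend M = Function.update (s.pend M) e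
        (if s.natVar 7 = 0 then none else some (s.realVar 0)) := by
  refine Ok.cons (T₁ := 20) (T₂ := 150 * L + 30)
    (R := fun s' => s'.natVar 8 = (M + e) / 2 ∧ (∀ j, j ≠ M + e → s'.node j = s.node j) ∧
      s'.node (M + e) = (s.natVar 7, s.realVar 0))
    (Ok.straight rfl (by decide) ?_) ?_ (by omega)
  · refine ⟨by simp [block, Prog.exec, NatExp.eval, hM, he], fun j hj => ?_, ?_⟩
    · simp [block, Prog.exec, NatExp.eval, RealExp.eval, hM, he, State.node, hj]
    · simp [block, Prog.exec, NatExp.eval, RealExp.eval, hM, he, State.node]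
  intro s₁ ⟨hc, hne, heq⟩ _
  refine Ok.cons (T₁ := 150 * L + 20) (T₂ := 1)
    (R := fun s' => TreeOk M s' ∧ s'.pend M = Function.update (s.pend M) e
        (if s.natVar 7 = 0 then none else some (s.realVar 0)))
    ?_ (fun s' h _ => Ok.nil le_rfl h) (by omega)
  -- The walk starts at `(M + e) / 2 < M ≤ 2 ^ L` and stops at `0`, which is not a tree node, so `L`
  -- halvings suffice.
  refine Ok.loop (T₁ := 140) (N := L) (fun s' μ => s'.natVar 8 < 2 ^ μ ∧ s'.natVar 8 < M ∧
      (∀ i, 1 ≤ i → i < M → i ≠ s'.natVar 8 →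
        s'.node i = winner (s'.node (2 * i)) (s'.node (2 * i + 1))) ∧
      ∀ j, M ≤ j → s'.node j = s₁.node j) ?_ ?_ ?_ ?_
  · intro s' μ ⟨hμ, hcM, hin, hout⟩ hb
    simp only [Test.Holds, NatExp.eval] at hb
    refine Ok.straight rfl (by decide) ?_
    obtain ⟨e1, e2, e3⟩ := treeStep_exec s'
    obtain _ | μ := μ
    · simp at hμ; omega
    refine ⟨μ, by omega, by rw [e1]; rw [pow_succ] at hμ; omega, by rw [e1]; omega, ?_, ?_⟩
    · intro i hi1 hi2 hi3
      rw [e1] at hi3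
      rw [e2 (2 * i) (by omega), e2 (2 * i + 1) (by omega)]
      by_cases hic : i = s'.natVar 8
      · rw [hic, e3]
      · rw [e2 i hic]; exact hin i hi1 hi2 hic
    · intro j hj
      rw [e2 j (by omega), hout j hj]
  · rw [hc]
    refine ⟨by omega, by omega, fun i hi1 hi2 hi3 => ?_, fun _ _ => rfl⟩
    rw [hne i (by omega), hne (2 * i) (by omega), hne (2 * i + 1) (by omega)]
    exact ht.inner i hi1 hi2
  · intro s' μ ⟨_, hcM, hin, hout⟩ hb
    simp only [Test.Holds, NatExp.eval] at hb
    have hleaf : ∀ j, j < M → s'.node (M + j) =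
        if j = e then (s.natVar 7, s.realVar 0) else s.node (M + j) := by
      intro j hj
      rw [hout _ (by omega)]
      split_ifs with hje
      · rw [hje, heq]
      · rw [hne _ (by omega)]
    refine ⟨⟨fun i hi1 hi2 => hin i hi1 hi2 (by omega), fun j hj => ?_⟩, ?_⟩
    · have := hleaf j hj
      split_ifs at this with hje
      · simp only [State.node, Prod.mk.injEq] at this
        rw [this.1, hje]; exact hv
      · simp only [State.node, Prod.mk.injEq] at this
        rw [this.1]; exact ht.leaf j hj
    · funext j
      by_cases hje : j = e
      · subst hje
        have := hleaf j h2
        simp only [if_true, State.node, Prod.mk.injEq] at this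
        simp only [Function.update_self, State.pend, this.1, this.2]
        rcases hv with hv | hv
        · rw [if_neg (by omega), if_pos hv]
        · rw [if_pos ⟨h1, h2, hv⟩, if_neg (by omega)]
      · rw [Function.update_of_ne hje]
        by_cases hjM : j < M
        · have := hleaf j hjM
          simp only [if_neg hje, State.node, Prod.mk.injEq] at this
          simp only [State.pend, this.1, this.2]
        · simp only [State.pend]
          rw [if_neg (by omega), if_neg (by omega)]
  · simp only [Test.cost, NatExp.cost]; omega

end RealRAM

/-! ### Upper envelopes of lines -/

/-- The lines `z ↦ A j * z - B j`, `j < k`, form their own upper envelope on the half line from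
`S 0`, and line `j` enters it at `S j`. -/
structure Envelope (k : ℕ) (A B S : ℕ → ℝ) : Prop where
  pos : 1 ≤ k
  slope : ∀ j, j + 1 < k → A j < A (j + 1)
  start : ∀ j, j + 1 < k → S j ≤ S (j + 1)
  meet : ∀ j, j + 1 < k → A j * S (j + 1) - B j = A (j + 1) * S (j + 1) - B (j + 1)

/-- The line with slope `α` and offset `β` is not below any of the lines at `z`. -/
def AboveAt (k : ℕ) (A B : ℕ → ℝ) (α β z : ℝ) : Prop := ∀ j < k, A j * z - B j ≤ α * z - β

/-- The outcome of the search for the first point where a line reaches an envelope: whether there is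
one, the point, and the number of lines of the envelope that are relevant before that point. -/
structure Crossing (k : ℕ) (A B S : ℕ → ℝ) (α β : ℝ) (found : Prop) (x : ℝ) (pos : ℕ) : Prop where
  pos_le : pos ≤ k
  above : found → AboveAt k A B α β x
  start_le : found → S 0 ≤ x
  first : found → ∀ z, S 0 ≤ z → AboveAt k A B α β z → x ≤ z
  at_zero : found → pos = 0 → x = S 0
  before : found → 0 < pos → S (pos - 1) ≤ x ∧ A (pos - 1) < α ∧
    A (pos - 1) * x - B (pos - 1) = α * x - β
  after : found → pos < k → x ≤ S pos
  none : ¬ found → ∀ z, S 0 ≤ z → ¬ AboveAt k A B α β z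

lemma Crossing.congr {k : ℕ} {A B S : ℕ → ℝ} {α β : ℝ} {f f' : Prop} {x x' : ℝ} {pos pos' : ℕ}
    (h : Crossing k A B S α β f x pos) (hf : f' ↔ f) (hx : x' = x) (hp : pos' = pos) :
    Crossing k A B S α β f' x' pos' := by
  rw [hx, hp, propext hf]
  exact h

namespace Envelope

variable {k : ℕ} {A B S : ℕ → ℝ} {α β : ℝ}

lemma start_le (h : Envelope k A B S) {i j : ℕ} (hij : i ≤ j) (hj : j < k) : S i ≤ S j := by
  induction j, hij using Nat.le_induction with
  | base => exact le_rfl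
  | succ j hij ih => exact (ih (by omega)).trans (h.start j hj)

/-- Consecutive lines agree where the second one enters, and the second is steeper; beyond that
point it stays ahead. Chain these comparisons. -/
lemma le_of_start_le (h : Envelope k A B S) {i j : ℕ} (hij : i ≤ j) (hj : j < k) {z : ℝ}
    (hz : S j ≤ z) : A i * z - B i ≤ A j * z - B j := by
  induction j, hij using Nat.le_induction with
  | base => exact le_rfl
  | succ j hij ih =>
    have h1 := ih (by omega) ((h.start j hj).trans hz)
    nlinarith [h.meet j hj, mul_nonneg (sub_nonneg.2 (h.slope j hj).le) (sub_nonneg.2 hz)]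

/-- The mirror image to the left of the meeting points. Together with `le_of_start_le`, line `i` is
the highest one from its own start to the next start. -/
lemma le_of_le_start (h : Envelope k A B S) {i j : ℕ} (hij : i ≤ j) (hj : j < k) {z : ℝ}
    (hz : i + 1 < k → z ≤ S (i + 1)) : A j * z - B j ≤ A i * z - B i := by
  induction j, hij using Nat.le_induction with
  | base => exact le_rfl
  | succ j hij ih =>
    have h1 := ih (by omega)
    have h2 : z ≤ S (j + 1) := (hz (by omega)).trans (h.start_le (by omega) hj)
    nlinarith [h.meet j hj, mul_nonneg (sub_nonneg.2 (h.slope j hj).le) (sub_nonneg.2 h2)]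

/-- The line with slope `α` and offset `β` is below line `j` where that line enters, and steeper. -/
def Gains (A B S : ℕ → ℝ) (α β : ℝ) (j : ℕ) : Prop :=
  α * S j - β < A j * S j - B j ∧ A j < α

/-- Where line `j + 1` enters it meets line `j`, so the query line is below both there. Being
steeper, it is also below line `j` further to the left. The gaining lines thus form a prefix, which
is what makes binary search possible. -/
lemma gains_of_le (h : Envelope k A B S) {i j : ℕ} (hij : i ≤ j) (hj : j < k)
    (hg : Gains A B S α β j) : Gains A B S α β i := by
  induction j, hij using Nat.le_induction with
  | base => exact hg
  | succ j hij ih =>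
    refine ih (by omega) ⟨?_, (h.slope j hj).trans hg.2⟩
    have h1 := hg.1
    have h2 := h.meet j hj
    nlinarith [mul_nonneg (sub_nonneg.2 ((h.slope j hj).trans hg.2).le)
      (sub_nonneg.2 (h.start j hj))]

/-- Either the query line is already above the envelope at its left end, or it is below line `0`
there and not steeper, and then it never catches up with that line. -/
lemma crossing_zero (h : Envelope k A B S) (h0 : ¬ Gains A B S α β 0) :
    Crossing k A B S α β (A 0 * S 0 - B 0 ≤ α * S 0 - β) (S 0) 0 := by
  refine ⟨Nat.zero_le _, fun hf j hj => ?_, fun _ => le_rfl, fun _ z hz _ => hz, fun _ _ => rfl,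
    fun _ h => absurd h (lt_irrefl _), fun _ _ => le_rfl, fun hf z hz ha => ?_⟩
  · exact (h.le_of_le_start (Nat.zero_le j) hj fun h1 => h.start 0 h1).trans hf
  · have h1 := ha 0 h.pos
    have h2 : α ≤ A 0 := by
      by_contra hc
      exact h0 ⟨not_le.1 hf, not_le.1 hc⟩
    nlinarith [mul_nonneg (sub_nonneg.2 h2) (sub_nonneg.2 hz)]

/-- With `i` the last gaining line, the only candidate is the intersection with line `i`. It counts
exactly if it comes no later than the start of line `i + 1`. -/
lemma crossing_succ (h : Envelope k A B S) {i : ℕ} (hi : i < k) (hg : Gains A B S α β i)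
    (hn : i + 1 < k → ¬ Gains A B S α β (i + 1)) :
    Crossing k A B S α β (i + 1 < k → (β - B i) / (α - A i) ≤ S (i + 1))
      ((β - B i) / (α - A i)) (i + 1) := by
  have hd : 0 < α - A i := sub_pos.2 hg.2
  set x := (β - B i) / (α - A i) with hx
  have hxe : A i * x - B i = α * x - β := by
    have : (α - A i) * x = β - B i := by rw [hx]; field_simp
    linarith
  have hSx : S i < x := by
    rw [hx, lt_div_iff₀ hd]
    have := hg.1
    linarith
  have hlt : ∀ z, z < x → α * z - β < A i * z - B i := fun z hz => by
    nlinarith [mul_pos hd (sub_pos.2 hz)]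
  refine ⟨hi, fun hf j hj => ?_, fun _ => (h.start_le (Nat.zero_le _) hi).trans hSx.le,
    fun _ z _ ha => ?_, fun _ h => absurd h (by omega), fun _ _ => ⟨hSx.le, hg.2, hxe⟩,
    fun hf h1 => hf h1, fun hf z hz ha => ?_⟩
  · rw [← hxe]
    rcases le_total j i with hji | hji
    · exact h.le_of_start_le hji hi hSx.le
    · exact h.le_of_le_start hji hj hf
  · by_contra hc
    exact absurd (ha i hi) (not_le.2 (hlt z (not_le.1 hc)))
  -- The candidate comes too late. Before it the query line is below line `i`. At `S (i + 1)` it is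
  -- below line `i + 1` too and, as that line is not gaining, not steeper, so it stays below from
  -- there on.
  · push Not at hf
    obtain ⟨h1, h2⟩ := hf
    have h3 : α * S (i + 1) - β < A (i + 1) * S (i + 1) - B (i + 1) := by
      rw [← h.meet i h1]; exact hlt _ h2
    have h4 : α ≤ A (i + 1) := by
      by_contra hc
      exact hn h1 ⟨h3, not_le.1 hc⟩
    rcases lt_or_ge z x with h5 | h5
    · exact absurd (ha i hi) (not_le.2 (hlt z h5))
    · have h6 := ha (i + 1) h1
      nlinarith [mul_nonneg (sub_nonneg.2 h4) (sub_nonneg.2 (h2.le.trans h5))]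

variable {found : Prop} {x : ℝ} {pos : ℕ}

/-- Adding a line that is at least as steep as all others. -/
lemma push (h : Envelope k A B S) (hα : ∀ j < k, A j ≤ α)
    (hc : Crossing k A B S α β found x pos) (hf : found) :
    Envelope (pos + 1) (Function.update A pos α) (Function.update B pos β)
        (Function.update S pos x) ∧ Function.update S pos x 0 = S 0 ∧
      ∀ z, S 0 ≤ z → ∀ v, ((∃ j < k, v ≤ A j * z - B j) ∨ v ≤ α * z - β) →
        ∃ j < pos + 1, v ≤ Function.update A pos α j * z - Function.update B pos β j := by
  have hp := hc.pos_le
  refine ⟨⟨by omega, fun j hj => ?_, fun j hj => ?_, fun j hj => ?_⟩, ?_, fun z hz v hv => ?_⟩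
  · rw [Function.update_of_ne (by omega : j ≠ pos)]
    by_cases hj' : j + 1 = pos
    · subst hj'
      rw [Function.update_self]
      exact (hc.before hf (by omega)).2.1
    · rw [Function.update_of_ne hj']
      exact h.slope j (by omega)
  · rw [Function.update_of_ne (by omega : j ≠ pos)]
    by_cases hj' : j + 1 = pos
    · subst hj'
      rw [Function.update_self]
      exact (hc.before hf (by omega)).1
    · rw [Function.update_of_ne hj']
      exact h.start j (by omega)
  · rw [Function.update_of_ne (by omega : j ≠ pos), Function.update_of_ne (by omega : j ≠ pos)]
    by_cases hj' : j + 1 = pos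
    · subst hj'
      simp only [Function.update_self]
      exact (hc.before hf (by omega)).2.2
    · simp only [Function.update_of_ne hj']
      exact h.meet j (by omega)
  · by_cases h0 : pos = 0
    · subst h0
      rw [Function.update_self]
      exact hc.at_zero hf rfl
    · rw [Function.update_of_ne (Ne.symm h0)]
  -- From `x` on the new line is the highest, being above all others at `x` and at least as steep.
  -- Before `x` the last kept line dominates the new one and everything discarded.
  · rcases le_or_gt x z with hxz | hxz
    · refine ⟨pos, by omega, ?_⟩
      rw [Function.update_self, Function.update_self]
      rcases hv with ⟨j, hj, hv⟩ | hv
      · have h1 := hc.above hf j hj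
        nlinarith [mul_nonneg (sub_nonneg.2 (hα j hj)) (sub_nonneg.2 hxz)]
      · exact hv
    · have h0 : 0 < pos := by
        rcases Nat.eq_zero_or_pos pos with h0 | h0
        · exact absurd hxz (not_lt.2 ((hc.at_zero hf h0).trans_le hz))
        · exact h0
      obtain ⟨b1, b2, b3⟩ := hc.before hf h0
      have key : ∀ j, j < k → pos - 1 ≤ j →
          A j * z - B j ≤ A (pos - 1) * z - B (pos - 1) := fun j hj hpj =>
        h.le_of_le_start hpj hj fun h1 => by
          rw [Nat.sub_add_cancel h0] at h1 ⊢
          exact hxz.le.trans (hc.after hf h1)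
      rcases hv with ⟨j, hj, hv⟩ | hv
      · rcases lt_or_ge j pos with hjp | hjp
        · refine ⟨j, by omega, ?_⟩
          rw [Function.update_of_ne hjp.ne, Function.update_of_ne hjp.ne]
          exact hv
        · refine ⟨pos - 1, by omega, ?_⟩
          rw [Function.update_of_ne (by omega), Function.update_of_ne (by omega)]
          exact hv.trans (key j hj (by omega))
      · refine ⟨pos - 1, by omega, ?_⟩
        rw [Function.update_of_ne (by omega), Function.update_of_ne (by omega)]
        nlinarith [mul_pos (sub_pos.2 b2) (sub_pos.2 hxz)]

end Envelope

namespace RealRAM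

/-! ### Searching an envelope

An envelope of `v16` lines occupies the cells from `v15` on of the real arrays `6`, `7`, `8`. -/

/-- Cell `v15 + i` of real array `a`. -/
def hullGet (a : ℕ) (i : NatExp) : RealExp := .get a (.add (.var 15) i)

/-- The value of the query line at the start of line `i`. -/
def queryAt (i : NatExp) : RealExp := .sub (.mul (.var 1) (hullGet 8 i)) (.var 2)

/-- The value of line `i` at its start. -/
def lineAt (i : NatExp) : RealExp := .sub (.mul (hullGet 6 i) (hullGet 8 i)) (hullGet 7 i)

/-- One step of the binary search. -/
def searchStep : Prog :=
  block [.setNat 13 (.half (.add (.var 11) (.var 12))),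
    .cond (.and (.neg (.realLe (lineAt (.var 13)) (queryAt (.var 13))))
        (.neg (.realLe (.var 1) (hullGet 6 (.var 13)))))
      (.setNat 11 (.add (.var 13) (.const 1))) (.setNat 12 (.var 13))]

/-- The computation of the crossing once its position is known. -/
def searchEnd : Prog :=
  .cond (.natLe (.const 1) (.var 11))
    (block [.setReal 3 (.div (.sub (.var 2) (hullGet 7 (.sub (.var 11) (.const 1))))
        (.sub (.var 1) (hullGet 6 (.sub (.var 11) (.const 1))))),
      .cond (.and (.natLe (.add (.var 11) (.const 1)) (.var 16))
          (.neg (.realLe (.var 3) (hullGet 8 (.var 11)))))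
        (.setNat 14 (.const 0)) (.setNat 14 (.const 1))])
    (block [.setReal 3 (hullGet 8 (.const 0)),
      .cond (.realLe (lineAt (.const 0)) (queryAt (.const 0)))
        (.setNat 14 (.const 1)) (.setNat 14 (.const 0))])

/-- The first point where the line with slope and offset in real variables `1` and `2` reaches the
envelope: `v14` tells whether it exists, real variable `3` is the point, `v11` its position. -/
def cross : Prog :=
  block [block [.setNat 11 (.const 0), .setNat 12 (.var 16)],
    .loop (.natLe (.add (.var 11) (.const 1)) (.var 12)) searchStep, searchEnd]

/-- The cells from `b` on of a real array. -/
def State.hull (s : State) (a b : ℕ) : ℕ → ℝ := fun j => s.realArr a (b + j)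

lemma State.hull_eq (s : State) (a b : ℕ) : s.hull a b = fun j => s.realArr a (b + j) := rfl

/-- By `gains_of_le` the search may bisect for the number of gaining lines. That number decides
between `crossing_zero` and `crossing_succ`. -/
lemma ok_cross {s : State} {b k L : ℕ} {α β : ℝ} (hb : s.natVar 15 = b) (hk : s.natVar 16 = k)
    (hα : s.realVar 1 = α) (hβ : s.realVar 2 = β)
    (h : Envelope k (s.hull 6 b) (s.hull 7 b) (s.hull 8 b)) (hL : k < 2 ^ L) :
    Ok cross s (200 * (L + 1)) fun s' => Crossing k (s.hull 6 b) (s.hull 7 b) (s.hull 8 b) α β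
      (1 ≤ s'.natVar 14) (s'.realVar 3) (s'.natVar 11) := by
  refine Ok.cons (T₁ := 10) (T₂ := 150 * L + 170)
    (R := fun s' => s'.natVar 11 = 0 ∧ s'.natVar 12 = k)
    (Ok.straight rfl (by decide) ?_) ?_ (by omega)
  · simp [block, Prog.exec, NatExp.eval, hk]
  intro s₁ ⟨h11, h12⟩ f₁
  have fr : ∀ {s' : State}, Frame (.seq (block [.setNat 11 (.const 0), .setNat 12 (.var 16)])
      (.loop (.natLe (.add (.var 11) (.const 1)) (.var 12)) searchStep)) s s' →
      s'.natVar 15 = b ∧ s'.natVar 16 = k ∧ s'.realVar 1 = α ∧ s'.realVar 2 = β ∧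
        s'.realArr = s.realArr := fun f =>
    ⟨(f.n 15 (by decide)).trans hb, (f.n 16 (by decide)).trans hk, (f.r 1 (by decide)).trans hα,
      (f.r 2 (by decide)).trans hβ, funext fun a => f.ra a (by simp [Prog.wRA, block, searchStep])⟩
  have f₁' : Frame (.seq (block [.setNat 11 (.const 0), .setNat 12 (.var 16)])
      (.loop (.natLe (.add (.var 11) (.const 1)) (.var 12)) searchStep)) s s₁ :=
    f₁.mono (by simp [Prog.wN]) (by simp [Prog.wR]) (by simp [Prog.wNA]) (by simp [Prog.wRA])
  set Gn := Envelope.Gains (s.hull 6 b) (s.hull 7 b) (s.hull 8 b) α β with hGn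
  refine Ok.cons (T₁ := 150 * L + 50) (T₂ := 120)
    (R := fun s' => s'.natVar 11 ≤ k ∧ (∀ j < s'.natVar 11, Gn j) ∧
      (s'.natVar 11 < k → ¬ Gn (s'.natVar 11))) ?_ ?_ (by omega)
  -- All lines before cell `11` gain, and line number cell `12`, if it exists, does not; the gap
  -- between the two cells halves.
  · refine Ok.loop (T₁ := 100) (N := L) (fun s' μ => s'.natVar 12 - s'.natVar 11 < 2 ^ μ ∧
      s'.natVar 11 ≤ s'.natVar 12 ∧ s'.natVar 12 ≤ k ∧ (∀ j < s'.natVar 11, Gn j) ∧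
      (s'.natVar 12 < k → ¬ Gn (s'.natVar 12)) ∧
      Frame (.seq (block [.setNat 11 (.const 0), .setNat 12 (.var 16)])
      (.loop (.natLe (.add (.var 11) (.const 1)) (.var 12)) searchStep)) s s') ?_ ?_ ?_ ?_
    · intro s' μ ⟨i1, i2, i3, i4, i5, i6⟩ hh
      simp only [Test.Holds, NatExp.eval] at hh
      obtain ⟨e1, e2, e3, e4, e5⟩ := fr i6
      obtain _ | μ := μ
      · simp at i1; omega
      rw [pow_succ] at i1
      have hst : Ok searchStep s' 100 fun s'' => ∃ mid, mid = (s'.natVar 11 + s'.natVar 12) / 2 ∧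
          ((Gn mid ∧ s''.natVar 11 = mid + 1 ∧ s''.natVar 12 = s'.natVar 12) ∨
            (¬ Gn mid ∧ s''.natVar 11 = s'.natVar 11 ∧ s''.natVar 12 = mid)) := by
        refine Ok.straight rfl (by decide) ⟨_, rfl, ?_⟩
        simp only [searchStep, block, Prog.exec, NatExp.eval, Test.Holds, RealExp.eval, lineAt,
          queryAt, hullGet, State.setN_natVar, State.setN_realArr, State.setN_realVar, e1, e3,
          e4, e5, hGn, Envelope.Gains, State.hull, not_le]
        split_ifs <;> simp_all
      refine hst.post le_rfl ?_
      rintro s'' ⟨mid, hm, hcase⟩ f''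
      refine ⟨μ, by omega, ?_⟩
      have i6' := i6.trans (f''.mono (by simp [Prog.wN]) (by simp [Prog.wR])
        (by simp [Prog.wNA]) (by simp [Prog.wRA]))
      rcases hcase with ⟨hg, g1, g2⟩ | ⟨hg, g1, g2⟩
      · rw [g1, g2]
        exact ⟨by omega, by omega, i3, fun j hj => h.gains_of_le (by omega) (by omega) hg, i5, i6'⟩
      · rw [g1, g2]
        exact ⟨by omega, by omega, by omega, i4, fun _ => hg, i6'⟩
    · rw [h11, h12]
      exact ⟨hL, by omega, le_rfl, fun j hj => absurd hj (by omega),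
        fun hh => absurd hh (lt_irrefl _), f₁'⟩
    · intro s' μ ⟨i1, i2, i3, i4, i5, i6⟩ hh
      simp only [Test.Holds, NatExp.eval] at hh
      have : s'.natVar 11 = s'.natVar 12 := by omega
      rw [this]
      exact ⟨i3, this ▸ i4, i5⟩
    · simp only [Test.cost, NatExp.cost]; omega
  · intro s₂ ⟨j1, j2, j3⟩ f₂
    have f₂' : Frame (.seq (block [.setNat 11 (.const 0), .setNat 12 (.var 16)])
      (.loop (.natLe (.add (.var 11) (.const 1)) (.var 12)) searchStep)) s s₂ :=
      f₁'.trans (f₂.mono (by simp [Prog.wN]) (by simp [Prog.wR])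
        (by simp [Prog.wNA]) (by simp [Prog.wRA]))
    obtain ⟨e1, e2, e3, e4, e5⟩ := fr f₂'
    refine Ok.cons (T₁ := 110) (T₂ := 1) (R := fun s' => Crossing k (s.hull 6 b) (s.hull 7 b)
      (s.hull 8 b) α β (1 ≤ s'.natVar 14) (s'.realVar 3) (s'.natVar 11)) ?_
      (fun s' h _ => Ok.nil le_rfl h) (by omega)
    refine Ok.straight rfl (by decide) ?_
    rcases Nat.eq_zero_or_pos (s₂.natVar 11) with h0 | h0
    · have hz : ¬ Gn 0 := by rw [← h0]; exact j3 (by rw [h0]; exact h.pos)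
      have hc := h.crossing_zero hz
      simp only [searchEnd, block, Prog.exec, NatExp.eval, Test.Holds, RealExp.eval, lineAt,
        queryAt, hullGet, State.setR_realVar, State.setR_natVar, State.setR_realArr, e1, e2, e3,
        e4, e5, h0, reduceIte, Nat.reduceEqDiff, Nat.reduceLeDiff]
      split_ifs with q2
      · refine hc.congr ?_ (by simp [State.hull]) (by simp [h0])
        simpa [State.hull] using q2
      · refine hc.congr ?_ (by simp [State.hull]) (by simp [h0])
        simpa [State.hull] using q2
    · obtain ⟨i, hi⟩ : ∃ i, s₂.natVar 11 = i + 1 := ⟨_, (Nat.sub_add_cancel h0).symm⟩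
      rw [hi] at j1 j2 j3
      have hc := h.crossing_succ (i := i) (by omega) (j2 i (by omega)) j3
      have hi' : 1 ≤ i + 1 := by omega
      simp only [searchEnd, block, Prog.exec, NatExp.eval, Test.Holds, RealExp.eval, lineAt,
        queryAt, hullGet, State.setR_realVar, State.setR_natVar, State.setR_realArr, e1, e2, e3,
        e4, e5, hi, hi', if_true, Nat.add_sub_cancel, reduceIte, Nat.reduceEqDiff]
      split_ifs with q1
      · refine hc.congr ?_ (by simp [State.hull]) (by simp [hi])
        simp only [State.hull, State.setN_natVar, if_true]
        refine ⟨fun h => absurd h (by norm_num), fun hcon => ?_⟩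
        exact absurd (by simpa using hcon q1.1) q1.2
      · refine hc.congr ?_ (by simp [State.hull]) (by simp [hi])
        simp only [State.hull, State.setN_natVar, if_true, le_refl, true_iff]
        intro hcon
        by_contra hcon'
        exact q1 ⟨hcon, by simpa using hcon'⟩

end RealRAM

/-! ### The combinatorics: from flow to a recursion over single edges. -/

namespace ImpreciseTerrain

variable {V : Type*} (T : ImpreciseTerrain V) {R : V → ℝ} {S : Set V} {p q : V}

/-! ### Flow -/

lemma dist_pos_of_adj (h : T.graph.Adj p q) : 0 < dist (T.pos p) (T.pos q) :=
  dist_pos.2 fun he => h.ne (T.pos_injective he)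

lemma slope_nonneg_iff (h : T.graph.Adj p q) : 0 ≤ T.slope R p q ↔ R q ≤ R p := by
  rw [slope, le_div_iff₀ (T.dist_pos_of_adj h), zero_mul, sub_nonneg]

/-- Leaving a local minimum means climbing, so the maximal slope at one of its nodes that has a
neighbour inside is `0`, attained exactly at the neighbours inside. -/
lemma flowStep_iff : T.FlowStep R p q ↔ T.IsSteepestDescent R p q := by
  constructor
  · rintro (⟨P, ⟨_, h, hP, hN⟩, hp, hq, hadj⟩ | ⟨_, h⟩)
    · have e : T.slope R p q = 0 := by simp [slope, hP p hp, hP q hq]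
      refine ⟨hadj, e.ge, fun r hr => ?_⟩
      rw [e]
      refine div_nonpos_of_nonpos_of_nonneg ?_ dist_nonneg
      by_cases hrP : r ∈ P
      · simp [hP p hp, hP r hrP]
      · have := hN r ⟨hrP, p, hp, hr.symm⟩
        rw [hP p hp]; linarith
    · exact h
  · intro h
    by_cases hP : ∃ P, T.IsLocalMin R P ∧ p ∈ P
    · obtain ⟨P, hloc, hp⟩ := hP
      refine .inl ⟨P, hloc, hp, ?_, h.1⟩
      obtain ⟨_, c, hc, hN⟩ := hloc
      by_contra hq
      have h1 := hN q ⟨hq, p, hp, h.1.symm⟩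
      have h2 := (T.slope_nonneg_iff h.1).1 h.2.1
      rw [hc p hp] at h2
      linarith
    · exact .inr ⟨hP, h⟩

lemma flowsTo_eq : T.FlowsTo R = Relation.ReflTransGen (T.IsSteepestDescent R) := by
  unfold FlowsTo
  congr 1
  funext p q
  exact propext T.flowStep_iff

/-! ### Potential watersheds -/

/-- Water in `p` at elevation `z` can move on to `q` at elevation `z'` when all other neighbours are
as high as possible. -/
def CanFlow (p q : V) (z' z : ℝ) : Prop :=
  T.low p ≤ z ∧ z ≤ T.high p ∧ z' ≤ z ∧ ∀ r, T.graph.Adj p r →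
    (z - T.high r) / dist (T.pos p) (T.pos r) ≤ (z - z') / dist (T.pos p) (T.pos q)

variable {T}

/-- A lower receiver only makes the chosen edge steeper. For every node it is therefore enough to
know the least elevation from which it works. -/
lemma CanFlow.anti {z'' z' z : ℝ} (h : T.CanFlow p q z' z) (hz : z'' ≤ z') :
    T.CanFlow p q z'' z :=
  ⟨h.1, h.2.1, hz.trans h.2.2.1, fun r hr => (h.2.2.2 r hr).trans
    (div_le_div_of_nonneg_right (by linarith) dist_nonneg)⟩

variable (T)

/-- Water in `p` at elevation `z` can reach `S`. -/
inductive Reach (S : Set V) : V → ℝ → Prop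
  | base {p : V} {z : ℝ} : p ∈ S → T.low p ≤ z → z ≤ T.high p → Reach S p z
  | step {p q : V} {z' z : ℝ} : T.graph.Adj p q → Reach S q z' → T.CanFlow p q z' z → Reach S p z

variable {T}

lemma Reach.low_le {z : ℝ} (h : T.Reach S p z) : T.low p ≤ z := by
  cases h with
  | base _ h _ => exact h
  | step _ _ h => exact h.1

/-- Replacing the actual elevations of competing neighbours by their upper bounds only lowers the
competing slopes. -/
lemma reach_of_flowsTo (hR : T.IsRealization R) (h : T.FlowsTo R p q) (hq : q ∈ S) :
    T.Reach S p (R p) := by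
  rw [flowsTo_eq] at h
  induction h using Relation.ReflTransGen.head_induction_on with
  | refl => exact .base hq (hR q).1 (hR q).2
  | @head a b hab _ ih =>
    refine .step hab.1 ih ⟨(hR a).1, (hR a).2, (T.slope_nonneg_iff hab.1).1 hab.2.1,
      fun r hr => le_trans ?_ (hab.2.2 r hr)⟩
    exact div_le_div_of_nonneg_right (sub_le_sub_left (hR r).2 _) dist_nonneg

-- The realization is built along the derivation. `W` collects the nodes placed so far, none above
-- the current elevation, and all other nodes sit at their upper bounds. Every node of `W`, not
-- merely the last one, is kept flowing to `S` inside `W`; this allows a new node to enter `W`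
-- anywhere.
open Classical in
lemma exists_realization_of_reach [Finite V] {z : ℝ} (h : T.Reach S p z) :
    ∃ (R : V → ℝ) (W : Set V), T.IsRealization R ∧ p ∈ W ∧ (∀ w ∈ W, R w ≤ z) ∧
      (∀ w ∉ W, R w = T.high w) ∧ ∀ w ∈ W, ∃ q ∈ S,
        Relation.ReflTransGen (fun a b => a ∈ W ∧ b ∈ W ∧ T.IsSteepestDescent R a b) w q := by
  induction h with
  | @base p z hp h1 h2 =>
    refine ⟨Function.update T.high p z, {p}, fun v => ?_, rfl, ?_, fun w hw => ?_, ?_⟩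
    · by_cases hv : v = p
      · subst hv; simpa using ⟨h1, h2⟩
      · rw [Function.update_of_ne hv]; exact ⟨T.low_le_high v, le_rfl⟩
    · rintro w rfl; simp
    · exact Function.update_of_ne hw _ _
    · rintro w rfl; exact ⟨w, hp, .refl⟩
  | @step p q z' z hadj _ hc ih =>
    obtain ⟨R, W, hR, hqW, hle, hout, hflow⟩ := ih
    -- A derivation may visit a node twice. The earlier placement is lower and already flows to `S`,
    -- so nothing is to be done.
    by_cases hpW : p ∈ W
    · exact ⟨R, W, hR, hpW, fun w hw => (hle w hw).trans hc.2.2.1, hout, hflow⟩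
    set R' := Function.update R p z with hR'
    have hne : ∀ w, w ≠ p → R' w = R w := fun w hw => Function.update_of_ne hw _ _
    have hself : R' p = z := Function.update_self _ _ _
    have hWne : ∀ w ∈ W, w ≠ p := fun w hw he => hpW (he ▸ hw)
    -- The new node is not below any node of `W`, so it offers no positive slope to them.
    have hkeep : ∀ a ∈ W, ∀ b ∈ W, T.IsSteepestDescent R a b → T.IsSteepestDescent R' a b := by
      intro a ha b hb hab
      have e : T.slope R' a b = T.slope R a b := by
        simp only [slope, hne a (hWne a ha), hne b (hWne b hb)]
      refine ⟨hab.1, e ▸ hab.2.1, fun r hr => ?_⟩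
      rw [e]
      by_cases hrp : r = p
      · refine le_trans ?_ hab.2.1
        refine div_nonpos_of_nonpos_of_nonneg ?_ dist_nonneg
        rw [hrp, hself, hne a (hWne a ha)]
        linarith [hle a ha, hc.2.2.1]
      · refine le_trans (le_of_eq ?_) (hab.2.2 r hr)
        simp only [slope, hne a (hWne a ha), hne r hrp]
    -- Among the neighbours of `p`, a steepest one in `W` is welcome even if it is not `q`. One
    -- outside `W` is at its upper bound, and `q` is at least as steep.
    have hstep : ∃ b ∈ W, T.IsSteepestDescent R' p b := by
      obtain ⟨r, hr, hmax⟩ := Set.exists_max_image {r | T.graph.Adj p r} (T.slope R' p)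
        (Set.toFinite _) ⟨q, hadj⟩
      have hq0 : 0 ≤ T.slope R' p q := by
        rw [T.slope_nonneg_iff hadj, hself, hne q (hWne q hqW)]
        exact (hle q hqW).trans hc.2.2.1
      by_cases hrW : r ∈ W
      · exact ⟨r, hrW, hr, hq0.trans (hmax q hadj), hmax⟩
      · refine ⟨q, hqW, hadj, hq0, fun x hx => (hmax x hx).trans ?_⟩
        have hrp : r ≠ p := fun he => T.graph.ne_of_adj hr he.symm
        simp only [slope, hself, hne r hrp, hne q (hWne q hqW), hout r hrW]
        refine (hc.2.2.2 r hr).trans (div_le_div_of_nonneg_right ?_ dist_nonneg)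
        linarith [hle q hqW]
    have hold : ∀ w ∈ W, ∃ q ∈ S, Relation.ReflTransGen
        (fun a b => a ∈ insert p W ∧ b ∈ insert p W ∧ T.IsSteepestDescent R' a b) w q := by
      intro w hw
      obtain ⟨q, hq, hwq⟩ := hflow w hw
      exact ⟨q, hq, hwq.lift id fun a b ⟨ha, hb, hab⟩ =>
        ⟨.inr ha, .inr hb, hkeep a ha b hb hab⟩⟩
    refine ⟨R', insert p W, fun v => ?_, .inl rfl, ?_, fun w hw => ?_, ?_⟩
    · by_cases hv : v = p
      · rw [hv, hself]; exact ⟨hc.1, hc.2.1⟩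
      · rw [hne v hv]; exact hR v
    · rintro w (rfl | hw)
      · exact hself.le
      · rw [hne w (hWne w hw)]; exact (hle w hw).trans hc.2.2.1
    · rw [hne w fun he => hw (.inl he)]
      exact hout w fun h => hw (.inr h)
    · rintro w (rfl | hw)
      · obtain ⟨b, hb, hsd⟩ := hstep
        obtain ⟨q', hq', hbq⟩ := hold b hb
        exact ⟨q', hq', .head ⟨.inl rfl, .inr hb, hsd⟩ hbq⟩
      · exact hold w hw

theorem mem_potentialWatershed_iff [Finite V] :
    p ∈ T.potentialWatershed S ↔ ∃ z, T.Reach S p z := by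
  constructor
  · rintro ⟨R, hR, q, hq, hpq⟩
    exact ⟨_, reach_of_flowsTo hR hpq hq⟩
  · rintro ⟨z, h⟩
    obtain ⟨R, W, hR, hp, -, -, hflow⟩ := exists_realization_of_reach h
    obtain ⟨q, hq, hpq⟩ := hflow p hp
    refine ⟨R, hR, q, hq, ?_⟩
    show T.FlowsTo R p q
    rw [flowsTo_eq]
    exact hpq.lift id fun a b h => h.2.2

/-! ### Local minima of the lowermost realization -/

lemma isRealization_low : T.IsRealization T.low := fun v => ⟨le_rfl, T.low_le_high v⟩

lemma IsLocalMin.flowsTo_mem {P : Set V} (hP : T.IsLocalMin R P) (hp : p ∈ P)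
    (h : T.FlowsTo R p q) : q ∈ P := by
  induction h with
  | refl => exact hp
  | @tail b c _ hbc ih =>
    obtain ⟨_, c', hc, hN⟩ := hP
    have hsd := T.flowStep_iff.1 hbc
    by_contra hcP
    have h1 := hN c ⟨hcP, b, ih, hsd.1.symm⟩
    have h2 := (T.slope_nonneg_iff hsd.1).1 hsd.2.1
    rw [hc b ih] at h2
    linarith

lemma IsLocalMin.flowsTo {P : Set V} (hP : T.IsLocalMin R P) (hp : p ∈ P) (hq : q ∈ P) :
    T.FlowsTo R p q := by
  have h := (SimpleGraph.reachable_iff_reflTransGen _ _).1 (hP.1.preconnected ⟨p, hp⟩ ⟨q, hq⟩)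
  exact h.lift (fun x : P => (x : V)) fun a b hab => .inl ⟨P, hP, a.2, b.2, hab⟩

/-- In a regular terrain the imprecise minima are the local minima of the lowermost realization. -/
lemma IsRegular.isImpreciseMin_iff (hT : T.IsRegular) :
    T.IsImpreciseMin S ↔ T.IsLocalMin T.low S := by
  refine ⟨fun h => ?_, hT S⟩
  obtain ⟨P, hPS, hP⟩ := h.1 T.low isRealization_low
  rcases hPS.eq_or_ssubset with rfl | hss
  · exact hP
  -- Regularity makes `P` itself contain a local minimum in every realization, against the
  -- minimality of `S`.
  · exact absurd (hT P hP).1 (h.2 P hss)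

variable (T) in
/-- A choice, for every node, of a node of a local minimum of the lowermost realization to which it
flows, the same node for each minimum. -/
structure Rooting (rt : V → V) : Prop where
  flows : ∀ p, T.FlowsTo T.low p (rt p)
  bottom : ∀ p w, T.FlowsTo T.low (rt p) w → ∀ x, T.graph.Adj w x → T.low w ≤ T.low x
  inj : ∀ p q, T.FlowsTo T.low (rt p) (rt q) → rt p = rt q

variable (T) in
/-- The nodes that water from the root of `p` reaches. -/
def basin (rt : V → V) (p : V) : Set V := {w | T.FlowsTo T.low (rt p) w}

variable {rt : V → V}

namespace Rooting

lemma low_eq (h : T.Rooting rt) {w : V} (hw : w ∈ T.basin rt p) : T.low w = T.low (rt p) := by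
  induction hw with
  | refl => rfl
  | @tail b c hab hbc ih =>
    have hsd := T.flowStep_iff.1 hbc
    exact (le_antisymm ((T.slope_nonneg_iff hsd.1).1 hsd.2.1) (h.bottom p b hab c hsd.1)).trans ih

/-- No neighbour of a basin node is lower, so slope `0` is maximal and every level neighbour
receives water. -/
lemma basin_step (h : T.Rooting rt) {w x : V} (hw : w ∈ T.basin rt p) (hx : T.graph.Adj w x)
    (he : T.low x = T.low w) : x ∈ T.basin rt p := by
  refine Relation.ReflTransGen.tail hw (T.flowStep_iff.2 ⟨hx, ?_, fun r hr => ?_⟩)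
  · exact (T.slope_nonneg_iff hx).2 he.le
  · have : T.slope T.low w x = 0 := by simp [slope, he]
    rw [this]
    exact div_nonpos_of_nonpos_of_nonneg (by linarith [h.bottom p w hw r hr]) dist_nonneg

lemma isLocalMin (h : T.Rooting rt) (p : V) : T.IsLocalMin T.low (T.basin rt p) := by
  refine ⟨?_, T.low (rt p), fun w hw => h.low_eq hw, ?_⟩
  · rw [SimpleGraph.connected_iff_exists_forall_reachable]
    refine ⟨⟨rt p, Relation.ReflTransGen.refl⟩, ?_⟩
    rintro ⟨w, hw⟩
    have key : ∀ w (hw : T.FlowsTo T.low (rt p) w), (T.graph.induce (T.basin rt p)).Reachable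
        ⟨rt p, Relation.ReflTransGen.refl⟩ ⟨w, hw⟩ := by
      intro w hw
      induction hw with
      | refl => exact SimpleGraph.Reachable.refl _
      | tail hab hbc ih =>
        refine ih.trans (SimpleGraph.Adj.reachable ?_)
        exact (T.flowStep_iff.1 hbc).1
    exact key w hw
  · rintro s ⟨hs, t, ht, hadj⟩
    have h1 := h.bottom p t ht s hadj.symm
    rw [h.low_eq ht] at h1
    refine lt_of_le_of_ne h1 fun he => hs (h.basin_step ht hadj.symm ?_)
    rw [h.low_eq ht, he]

/-- Water cannot leave a local minimum and spreads over all of it; the minimum is therefore what is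
reached from its root. -/
lemma basin_eq (h : T.Rooting rt) (hS : T.IsLocalMin T.low S) (hp : p ∈ S) : S = T.basin rt p := by
  have hr : rt p ∈ S := hS.flowsTo_mem hp (h.flows p)
  ext w
  exact ⟨fun hw => hS.flowsTo hr hw, fun hw => hS.flowsTo_mem hr hw⟩

lemma basin_eq_basin_iff (h : T.Rooting rt) : T.basin rt p = T.basin rt q ↔ rt p = rt q := by
  constructor
  · intro he
    have : rt q ∈ T.basin rt p := he ▸ Relation.ReflTransGen.refl
    exact h.inj p q this
  · intro he
    simp only [basin, he]

lemma reach_basin (h : T.Rooting rt) (p : V) : T.Reach (T.basin rt p) p (T.low p) :=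
  reach_of_flowsTo isRealization_low (h.flows p) Relation.ReflTransGen.refl

end Rooting

variable (T) in
/-- Water in `p` at elevation `z` can reach another minimum than that of the root of `p`. -/
inductive ReachOther (rt : V → V) : V → ℝ → Prop
  | cross {p q : V} {z : ℝ} : T.graph.Adj p q → rt p ≠ rt q → T.CanFlow p q (T.low q) z →
      ReachOther rt p z
  | step {p q : V} {z' z : ℝ} : T.graph.Adj p q → rt p = rt q → ReachOther rt q z' →
      T.CanFlow p q z' z → ReachOther rt p z

/-- At the first edge where the root changes, the rest of the route can be forgotten: the receiver
may be lowered to its least elevation, from which it flows to a minimum of its own. If the root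
never changed, the route would end in the minimum of the starting node. -/
lemma Rooting.reachOther_of_reach (h : T.Rooting rt) (hS : T.IsLocalMin T.low S) {z : ℝ}
    (hr : T.Reach S p z) (hne : S ≠ T.basin rt p) : T.ReachOther rt p z := by
  induction hr with
  | base hp _ _ => exact absurd (h.basin_eq hS hp) hne
  | @step p q z' z hadj hq hc ih =>
    by_cases he : rt p = rt q
    · refine .step hadj he (ih ?_) hc
      rw [← h.basin_eq_basin_iff.2 he]; exact hne
    · exact .cross hadj he (hc.anti hq.low_le)

/-- The minimum that is found is the basin behind the edge where the root changes; it differs from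
the basin shared by all nodes before that edge. -/
lemma Rooting.exists_reach (h : T.Rooting rt) {z : ℝ} (hr : T.ReachOther rt p z) :
    ∃ S, T.IsLocalMin T.low S ∧ S ≠ T.basin rt p ∧ T.Reach S p z := by
  induction hr with
  | @cross p q z hadj hne hc =>
    exact ⟨_, h.isLocalMin q, fun he => hne (h.basin_eq_basin_iff.1 he).symm,
      .step hadj (h.reach_basin q) hc⟩
  | @step p q z' z hadj he _ hc ih =>
    obtain ⟨S, hS, hne, hr⟩ := ih
    exact ⟨S, hS, h.basin_eq_basin_iff.2 he ▸ hne, .step hadj hr hc⟩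

/-- Of two distinct minima at least one differs from the basin of `p`. Conversely, that basin is
always available as the second minimum, by flow in the lowermost realization. -/
theorem IsRegular.fuzzyRidge_eq [Finite V] (hT : T.IsRegular) (h : T.Rooting rt) :
    T.fuzzyRidge = {p | ∃ z, T.ReachOther rt p z} := by
  ext p
  constructor
  · rintro ⟨S, S', hS, hS', hne, hp, hp'⟩
    rw [hT.isImpreciseMin_iff] at hS hS'
    obtain ⟨z, hz⟩ := mem_potentialWatershed_iff.1 hp
    obtain ⟨z', hz'⟩ := mem_potentialWatershed_iff.1 hp'
    by_cases he : S = T.basin rt p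
    · exact ⟨z', h.reachOther_of_reach hS' hz' fun h => hne (he.trans h.symm)⟩
    · exact ⟨z, h.reachOther_of_reach hS hz he⟩
  · rintro ⟨z, hz⟩
    obtain ⟨S, hS, hne, hr⟩ := h.exists_reach hz
    refine ⟨S, T.basin rt p, hT S hS, hT _ (h.isLocalMin p), hne, ?_, ?_⟩
    · exact mem_potentialWatershed_iff.2 ⟨z, hr⟩
    · exact mem_potentialWatershed_iff.2 ⟨_, h.reach_basin p⟩

end ImpreciseTerrain

/-! ### The algorithm on an abstract network of directed edges. -/

namespace RealRAM

/-! ### Occupied slots -/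

open Classical in
/-- The number of occupied slots. -/
noncomputable def occupied (P : ℕ → Option ℝ) (M : ℕ) : ℕ :=
  ((Finset.range M).filter fun e => P e ≠ none).card

lemma occupied_le (P : ℕ → Option ℝ) (M : ℕ) : occupied P M ≤ M :=
  (Finset.card_filter_le _ _).trans (Finset.card_range M).le

lemma occupied_lt {P : ℕ → Option ℝ} {M : ℕ} (hM : 1 ≤ M) (h : P 0 = none) : occupied P M < M := by
  classical
  unfold occupied
  conv_rhs => rw [← Finset.card_range M]
  refine Finset.card_lt_card ⟨Finset.filter_subset _ _, fun hs => ?_⟩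
  exact (Finset.mem_filter.1 (hs (Finset.mem_range.2 hM : (0 : ℕ) ∈ _))).2 h

lemma occupied_clear {P : ℕ → Option ℝ} {M e : ℕ} (he : e < M) (h : P e ≠ none) :
    occupied (Function.update P e none) M < occupied P M := by
  classical
  refine Finset.card_lt_card ⟨fun x hx => ?_, fun hs => ?_⟩
  · rw [Finset.mem_filter] at hx ⊢
    refine ⟨hx.1, fun hn => hx.2 ?_⟩
    by_cases hxe : x = e
    · simp [hxe]
    · rw [Function.update_of_ne hxe, hn]
  · have := hs (Finset.mem_filter.2 ⟨Finset.mem_range.2 he, h⟩)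
    simp at this

lemma occupied_update_le (P : ℕ → Option ℝ) (M e : ℕ) (o : Option ℝ) :
    occupied (Function.update P e o) M ≤ occupied P M + 1 := by
  classical
  refine (Finset.card_le_card fun x hx => ?_).trans
    (Finset.card_insert_le e ((Finset.range M).filter fun e => P e ≠ none))
  rw [Finset.mem_insert, Finset.mem_filter]
  rw [Finset.mem_filter] at hx
  by_cases hxe : x = e
  · exact .inl hxe
  · refine .inr ⟨hx.1, ?_⟩
    rw [Function.update_of_ne hxe] at hx
    exact hx.2

/-! ### The network as stored in memory -/

/-- The tables that describe a network with the directed edges `1, …, N`: their head and tail,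
the next edge with the same tail and the first edge with a given tail, the place reserved for the
envelope of a node, the reciprocal edge lengths, the elevation bounds of the nodes, and the maximum
slope of descent from a node in the lowermost realization. -/
structure Net where
  N : ℕ
  hd : ℕ → ℕ
  tl : ℕ → ℕ
  nxt : ℕ → ℕ
  fst : ℕ → ℕ
  base : ℕ → ℕ
  a : ℕ → ℝ
  low : ℕ → ℝ
  high : ℕ → ℝ
  msl : ℕ → ℝ

namespace Net

variable (G : Net)

/-- The numbers of the directed edges. -/
def E (e : ℕ) : Prop := 1 ≤ e ∧ e ≤ G.N

/-- The slope of an edge in the lowermost realization. -/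
def lowSlope (e : ℕ) : ℝ := G.a e * (G.low (G.hd e) - G.low (G.tl e))

/-- Consistency of the tables. -/
structure Good : Prop where
  symm : ∀ e, G.E e → ∃ f, G.E f ∧ G.hd f = G.tl e ∧ G.tl f = G.hd e
  a_pos : ∀ e, G.E e → 0 < G.a e
  fst_edge : ∀ u, 1 ≤ G.fst u → G.E (G.fst u) ∧ G.tl (G.fst u) = u
  le_fst : ∀ e, G.E e → e ≤ G.fst (G.tl e)
  nxt_lt : ∀ e, G.E e → G.nxt e < e
  nxt_tl : ∀ e, G.E e → 1 ≤ G.nxt e → G.tl (G.nxt e) = G.tl e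
  le_nxt : ∀ e, G.E e → ∀ f, G.E f → G.tl f = G.tl e → f < e → f ≤ G.nxt e
  base_disj : ∀ e f, G.E e → G.E f → G.hd e ≠ G.hd f →
    G.base (G.hd e) + (G.N + 1) ≤ G.base (G.hd f) ∨ G.base (G.hd f) + (G.N + 1) ≤ G.base (G.hd e)
  msl_nonneg : ∀ p, 0 ≤ G.msl p
  le_msl : ∀ e, G.E e → G.lowSlope e ≤ G.msl (G.hd e)
  msl_attained : ∀ p, 0 < G.msl p → ∃ e, G.E e ∧ G.hd e = p ∧ G.lowSlope e = G.msl p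

/-- The memory holds the tables of `G`. -/
structure Stored (s : State) : Prop where
  N : s.natVar 3 = G.N
  M : s.natVar 4 = G.N + 1
  hd : s.natArr 3 = G.hd
  tl : s.natArr 4 = G.tl
  nxt : s.natArr 6 = G.nxt
  fst : s.natArr 7 = G.fst
  base : s.natArr 8 = G.base
  low : s.realArr 2 = G.low
  high : s.realArr 3 = G.high
  a : s.realArr 4 = G.a
  msl : s.realArr 9 = G.msl

variable {G}

/-- The program does not write to the tables. -/
def Safe (c : Prog) : Prop :=
  (∀ x ∈ [3, 4], x ∉ c.wN) ∧ (∀ x ∈ [3, 4, 6, 7, 8], x ∉ c.wNA) ∧ ∀ x ∈ [2, 3, 4, 9], x ∉ c.wRA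

instance (c : Prog) : Decidable (Safe c) := inferInstanceAs (Decidable (_ ∧ _ ∧ _))

lemma Stored.frame {c : Prog} {s s' : State} (h : G.Stored s) (f : Frame c s s') (hc : Safe c) :
    G.Stored s' :=
  ⟨(f.n 3 (hc.1 3 (by simp))).trans h.N, (f.n 4 (hc.1 4 (by simp))).trans h.M,
    (f.na 3 (hc.2.1 3 (by simp))).trans h.hd, (f.na 4 (hc.2.1 4 (by simp))).trans h.tl,
    (f.na 6 (hc.2.1 6 (by simp))).trans h.nxt, (f.na 7 (hc.2.1 7 (by simp))).trans h.fst,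
    (f.na 8 (hc.2.1 8 (by simp))).trans h.base, (f.ra 2 (hc.2.2 2 (by simp))).trans h.low,
    (f.ra 3 (hc.2.2 3 (by simp))).trans h.high, (f.ra 4 (hc.2.2 4 (by simp))).trans h.a,
    (f.ra 9 (hc.2.2 9 (by simp))).trans h.msl⟩

variable (G)

/-- The given lines are the upper envelope, from the lowest elevation of `p` on, of the zero line
and of the slope of descent from `p` to the neighbours along the edges in `D`. -/
structure NodeHull (D : ℕ → Prop) (p k : ℕ) (A B S : ℕ → ℝ) : Prop where
  env : Envelope k A B S
  start : S 0 = G.low p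
  zero : ∀ z, G.low p ≤ z → ∃ j < k, 0 ≤ A j * z - B j
  edge : ∀ z, G.low p ≤ z → ∀ r, D r → G.hd r = p → ∃ j < k,
    G.a r * z - G.a r * G.high (G.tl r) ≤ A j * z - B j
  mem : ∀ j < k, (A j = 0 ∧ B j = 0) ∨
    ∃ r, D r ∧ G.hd r = p ∧ A j = G.a r ∧ B j = G.a r * G.high (G.tl r)

variable {G}

/-- Only the first `k` cells and the edges with head `p` matter, so work on other nodes leaves this
envelope valid. -/
lemma NodeHull.congr {D D' : ℕ → Prop} {p k : ℕ} {A B S A' B' S' : ℕ → ℝ}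
    (h : G.NodeHull D p k A B S) (hD : ∀ r, G.hd r = p → (D' r ↔ D r))
    (hA : ∀ j < k, A' j = A j) (hB : ∀ j < k, B' j = B j) (hS : ∀ j < k, S' j = S j) :
    G.NodeHull D' p k A' B' S' := by
  refine ⟨⟨h.env.pos, fun j hj => ?_, fun j hj => ?_, fun j hj => ?_⟩, ?_, fun z hz => ?_,
    fun z hz r hr hp => ?_, fun j hj => ?_⟩
  · rw [hA j (by omega), hA (j + 1) hj]; exact h.env.slope j hj
  · rw [hS j (by omega), hS (j + 1) hj]; exact h.env.start j hj
  · rw [hA j (by omega), hA (j + 1) hj, hS (j + 1) hj, hB j (by omega), hB (j + 1) hj]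
    exact h.env.meet j hj
  · rw [hS 0 h.env.pos]; exact h.start
  · obtain ⟨j, hj, h1⟩ := h.zero z hz
    exact ⟨j, hj, by rw [hA j hj, hB j hj]; exact h1⟩
  · obtain ⟨j, hj, h1⟩ := h.edge z hz r ((hD r hp).1 hr) hp
    exact ⟨j, hj, by rw [hA j hj, hB j hj]; exact h1⟩
  · rw [hA j hj, hB j hj]
    rcases h.mem j hj with h1 | ⟨r, hr, hp, h1⟩
    · exact .inl h1
    · exact .inr ⟨r, (hD r hp).2 hr, hp, h1⟩

lemma NodeHull.aboveAt_iff {D : ℕ → Prop} {p k : ℕ} {A B S : ℕ → ℝ}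
    (h : G.NodeHull D p k A B S) {α β z : ℝ} (hz : G.low p ≤ z) :
    AboveAt k A B α β z ↔ 0 ≤ α * z - β ∧ ∀ r, D r → G.hd r = p →
      G.a r * z - G.a r * G.high (G.tl r) ≤ α * z - β := by
  constructor
  · intro ha
    refine ⟨?_, fun r hr hp => ?_⟩
    · obtain ⟨j, hj, h1⟩ := h.zero z hz
      exact h1.trans (ha j hj)
    · obtain ⟨j, hj, h1⟩ := h.edge z hz r hr hp
      exact h1.trans (ha j hj)
  · rintro ⟨h0, h1⟩ j hj
    rcases h.mem j hj with ⟨e1, e2⟩ | ⟨r, hr, hp, e1, e2⟩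
    · rw [e1, e2]; simpa using h0
    · rw [e1, e2]; exact h1 r hr hp

/-- Adding the line of an edge that is at most as long as the previous ones. -/
lemma NodeHull.insert {D D' : ℕ → Prop} {p k e : ℕ} {A B S : ℕ → ℝ} {found : Prop} {x : ℝ}
    {pos : ℕ} (h : G.NodeHull D p k A B S) (hp : G.hd e = p) (ha : 0 < G.a e)
    (hle : ∀ r, D r → G.hd r = p → G.a r ≤ G.a e) (hD : ∀ r, D' r ↔ D r ∨ r = e)
    (hc : Crossing k A B S (G.a e) (G.a e * G.high (G.tl e)) found x pos) :
    (found → G.NodeHull D' p (pos + 1) (Function.update A pos (G.a e))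
        (Function.update B pos (G.a e * G.high (G.tl e))) (Function.update S pos x)) ∧
      (¬ found → G.NodeHull D' p k A B S) := by
  constructor
  · intro hf
    have hα : ∀ j < k, A j ≤ G.a e := fun j hj => by
      rcases h.mem j hj with ⟨e1, -⟩ | ⟨r, hr, hr', e1, -⟩
      · rw [e1]; exact ha.le
      · rw [e1]; exact hle r hr hr'
    obtain ⟨henv, hS, hup⟩ := h.env.push hα hc hf
    rw [h.start] at hup
    refine ⟨henv, hS.trans h.start, fun z hz => hup z hz 0 (.inl (h.zero z hz)),
      fun z hz r hr hrp => hup z hz _ ?_, fun j hj => ?_⟩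
    · rcases (hD r).1 hr with hr | rfl
      · exact .inl (h.edge z hz r hr hrp)
      · exact .inr le_rfl
    · by_cases hj' : j = pos
      · subst hj'
        exact .inr ⟨e, (hD e).2 (.inr rfl), hp, by simp, by simp⟩
      · rw [Function.update_of_ne hj', Function.update_of_ne hj']
        rcases h.mem j (by have := hc.pos_le; omega) with h1 | ⟨r, hr, h1⟩
        · exact .inl h1
        · exact .inr ⟨r, (hD r).2 (.inl hr), h1⟩
  · intro hf
    refine ⟨h.env, h.start, h.zero, fun z hz r hr hrp => ?_, fun j hj => ?_⟩
    · rcases (hD r).1 hr with hr | rfl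
      · exact h.edge z hz r hr hrp
      -- A line that never gets above the envelope is at every point strictly below one of its
      -- lines, so it may be dropped.
      · have := hc.none hf z (h.start.trans_le hz)
        simp only [AboveAt, not_forall, not_le] at this
        obtain ⟨j, hj, h1⟩ := this
        exact ⟨j, hj, h1.le⟩
    · rcases h.mem j hj with h1 | ⟨r, hr, h1⟩
      · exact .inl h1
      · exact .inr ⟨r, (hD r).2 (.inl hr), h1⟩

variable (G) in
/-- The memory holds the envelopes with respect to the edges in `D`. -/
def Hulls (D : ℕ → Prop) (s : State) : Prop :=
  ∀ e, G.E e → G.NodeHull D (G.hd e) (s.natArr 9 (G.hd e)) (s.hull 6 (G.base (G.hd e)))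
    (s.hull 7 (G.base (G.hd e))) (s.hull 8 (G.base (G.hd e)))

end Net

/-! ### Computing the envelopes -/

/-- Take the winning slot out of the tree and put it into `v6`. -/
def takeRoot : Prog :=
  block [block [.setNat 6 (.get 5 (.const 1)), .setNat 7 (.const 0)], treeUp]

lemma ok_takeRoot {s : State} {M L : ℕ} (hM : s.natVar 4 = M) (hL : M < 2 ^ L) (ht : TreeOk M s)
    (hr : 1 ≤ s.natArr 5 1) (h1 : 1 ≤ M) :
    Ok takeRoot s (200 * (L + 1) + 20) fun s' => TreeOk M s' ∧ s'.natVar 6 = s.natArr 5 1 ∧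
      s'.pend M = Function.update (s.pend M) (s.natArr 5 1) none := by
  have hp := State.pend_slot (ht.root_pend h1 hr)
  refine Ok.cons (T₁ := 10) (T₂ := 200 * (L + 1) + 10)
    (R := fun s' => s'.natVar 6 = s.natArr 5 1 ∧ s'.natVar 7 = 0)
    (Ok.straight rfl (by decide) ?_) ?_ (by omega)
  · simp [block, Prog.exec, NatExp.eval]
  intro s₁ ⟨h6, h7⟩ f₁
  have e1 := f₁.na 5 (by decide)
  have e2 := f₁.ra 5 (by decide)
  have hok := ok_treeUp (s := s₁) (M := M) (L := L) (e := s.natArr 5 1)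
    ((f₁.n 4 (by decide)).trans hM) hL.le (ht.congr e1 e2) h6 hp.1 hp.2 (.inl h7)
  refine Ok.cons hok (fun s' h f => Ok.nil (T := 1) le_rfl ?_) (by omega)
  rw [if_pos h7, State.pend_congr M e1 e2] at h
  exact ⟨h.1, (f.n 6 (by decide)).trans h6, h.2⟩

/-- The address in the envelope of the current node at which the new line is stored. -/
def hullTop : NatExp := .add (.var 15) (.var 11)

/-- Store the line in real variables `1` and `2` in the envelope of node `v10`. -/
def hullPush : Prog :=
  .cond (.natLe (.const 1) (.var 14))
    (block [.putReal 6 hullTop (.var 1), .putReal 7 hullTop (.var 2), .putReal 8 hullTop (.var 3),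
      .putNat 9 (.var 10) (.add (.var 11) (.const 1))]) .skip

/-- Prepare the search in the envelope of the head of edge `v6`. -/
def hullLoad : Prog :=
  block [.setNat 10 (.get 3 (.var 6)), .setNat 15 (.get 8 (.var 10)), .setNat 16 (.get 9 (.var 10)),
    .setReal 1 (.get 4 (.var 6))]

/-- Move the longest remaining edge from the tree to the envelope of its head. -/
def sortStep : Prog :=
  block [takeRoot, hullLoad, .setReal 2 (.mul (.var 1) (.get 3 (.get 4 (.var 6)))), cross, hullPush]

/-- Compute the envelopes of all nodes. -/
def sortLoop : Prog := .loop (.natLe (.const 1) (.get 5 (.const 1))) sortStep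

/-- The invariant of `sortLoop`. -/
structure SortInv (G : Net) (s : State) (μ : ℕ) : Prop where
  stored : G.Stored s
  tree : TreeOk (G.N + 1) s
  count : occupied (s.pend (G.N + 1)) (G.N + 1) ≤ μ
  key : ∀ e k, s.pend (G.N + 1) e = some k → k = G.a e
  order : ∀ e k r, s.pend (G.N + 1) e = some k → G.E r → s.pend (G.N + 1) r = none → G.a r ≤ k
  height : ∀ e, G.E e → s.natArr 9 (G.hd e) + μ ≤ G.N + 1
  hulls : G.Hulls (fun r => G.E r ∧ s.pend (G.N + 1) r = none) s

/-- The tree yields the edges by increasing reciprocal length, so each new line is at least as steep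
as the earlier ones for the same node, as insertion requires. -/
lemma ok_sortStep {G : Net} {s : State} {μ L : ℕ} (hG : G.Good) (h : SortInv G s μ)
    (hL : G.N + 1 < 2 ^ L) (hr : 1 ≤ s.natArr 5 1) :
    Ok sortStep s (400 * (L + 1) + 200) fun s' => ∃ μ' < μ, SortInv G s' μ' := by
  set e := s.natArr 5 1 with he
  have hpe := h.tree.root_pend (by omega) hr
  rw [← he] at hpe
  obtain ⟨he1, he2⟩ := State.pend_slot hpe
  have hE : G.E e := ⟨he1, by omega⟩
  have hcnt := occupied_clear (P := s.pend (G.N + 1)) he2 (by rw [hpe]; exact Option.some_ne_none _)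
  have hμ : occupied (Function.update (s.pend (G.N + 1)) e none) (G.N + 1) < μ :=
    hcnt.trans_le h.count
  have hkeye : s.realArr 5 1 = G.a e := h.key e _ hpe
  refine Ok.cons (ok_takeRoot h.stored.M hL h.tree hr (by omega))
    (T₂ := 200 * (L + 1) + 180) ?_ (by omega)
  intro s₁ ⟨t₁, v₁, p₁⟩ f₁
  rw [← he] at v₁ p₁
  have st₁ := h.stored.frame f₁ (by decide)
  refine Ok.cons (T₁ := 30) (T₂ := 200 * (L + 1) + 150)
    (R := fun s' => s'.natVar 10 = G.hd e ∧ s'.natVar 15 = G.base (G.hd e) ∧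
      s'.natVar 16 = s.natArr 9 (G.hd e) ∧ s'.realVar 1 = G.a e)
    (Ok.straight rfl (by decide) ?_) ?_ (by omega)
  · simp [hullLoad, block, Prog.exec, NatExp.eval, RealExp.eval, v₁, st₁.hd, st₁.base, st₁.a,
      f₁.na 9 (by decide)]
  intro s₂ ⟨v10, v15, v16, r1⟩ f₂
  have st₂ := st₁.frame f₂ (by decide)
  have v₂ : s₂.natVar 6 = e := (f₂.n 6 (by decide)).trans v₁
  refine Ok.cons (T₁ := 20) (T₂ := 200 * (L + 1) + 130)
    (R := fun s' => s'.realVar 2 = G.a e * G.high (G.tl e))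
    (Ok.straight rfl (by decide) ?_) ?_ (by omega)
  · simp [Prog.exec, NatExp.eval, RealExp.eval, v₂, st₂.tl, st₂.high, r1]
  intro s₃ r2 f₃
  have st₃ := st₂.frame f₃ (by decide)
  have ra : ∀ x, x = 6 ∨ x = 7 ∨ x = 8 → s₃.realArr x = s.realArr x := by
    rintro x (rfl | rfl | rfl) <;>
      exact (f₃.ra _ (by decide)).trans ((f₂.ra _ (by decide)).trans (f₁.ra _ (by decide)))
  have hull₃ : ∀ x, x = 6 ∨ x = 7 ∨ x = 8 → ∀ b, s₃.hull x b = s.hull x b := fun x hx b => by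
    simp only [State.hull_eq, ra x hx]
  have hh := h.hulls e hE
  have hht := h.height e hE
  have hokc := ok_cross (s := s₃) (b := G.base (G.hd e)) (k := s.natArr 9 (G.hd e)) (L := L)
    (α := G.a e) (β := G.a e * G.high (G.tl e)) ((f₃.n 15 (by decide)).trans v15)
    ((f₃.n 16 (by decide)).trans v16) ((f₃.r 1 (by decide)).trans r1) r2
    (by rw [hull₃ 6 (by simp), hull₃ 7 (by simp), hull₃ 8 (by simp)]; exact hh.env) (by omega)
  rw [hull₃ 6 (by simp), hull₃ 7 (by simp), hull₃ 8 (by simp)] at hokc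
  refine Ok.cons hokc (T₂ := 130) ?_ (by omega)
  intro s₄ hc f₄
  have st₄ := st₃.frame f₄ (by decide)
  set D' : ℕ → Prop := fun r => G.E r ∧ Function.update (s.pend (G.N + 1)) e none r = none with hD'
  have hDD : ∀ r, D' r ↔ (G.E r ∧ s.pend (G.N + 1) r = none) ∨ r = e := fun r => by
    by_cases hre : r = e
    · subst hre; simp [hD', hE]
    · simp [hD', hre]
  have hle : ∀ r, (G.E r ∧ s.pend (G.N + 1) r = none) → G.hd r = G.hd e → G.a r ≤ G.a e :=
      fun r hr _ => by
    rw [← hkeye]; exact h.order e _ r hpe hr.1 hr.2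
  obtain ⟨hins, hnins⟩ := hh.insert rfl (hG.a_pos e hE) hle hDD hc
  have g5 : s₄.natArr 5 = s₁.natArr 5 := (f₄.na 5 (by decide)).trans
    ((f₃.na 5 (by decide)).trans (f₂.na 5 (by decide)))
  have gr5 : s₄.realArr 5 = s₁.realArr 5 := (f₄.ra 5 (by decide)).trans
    ((f₃.ra 5 (by decide)).trans (f₂.ra 5 (by decide)))
  have g9 : s₄.natArr 9 = s.natArr 9 := (f₄.na 9 (by decide)).trans
    ((f₃.na 9 (by decide)).trans ((f₂.na 9 (by decide)).trans (f₁.na 9 (by decide))))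
  have gra : ∀ x, x = 6 ∨ x = 7 ∨ x = 8 → s₄.realArr x = s.realArr x := by
    rintro x hx
    rw [← ra x hx]
    rcases hx with rfl | rfl | rfl <;> exact f₄.ra _ (by decide)
  have w10 : s₄.natVar 10 = G.hd e := (f₄.n 10 (by decide)).trans ((f₃.n 10 (by decide)).trans v10)
  have w15 : s₄.natVar 15 = G.base (G.hd e) :=
    (f₄.n 15 (by decide)).trans ((f₃.n 15 (by decide)).trans v15)
  have w1 : s₄.realVar 1 = G.a e := (f₄.r 1 (by decide)).trans ((f₃.r 1 (by decide)).trans r1)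
  have w2 : s₄.realVar 2 = G.a e * G.high (G.tl e) := (f₄.r 2 (by decide)).trans r2
  have hfin : Ok hullPush s₄ 120 fun s' =>
      s'.natArr 9 (G.hd e) ≤ s.natArr 9 (G.hd e) + 1 ∧
      (∀ q, q ≠ G.hd e → s'.natArr 9 q = s.natArr 9 q) ∧
      (∀ x, x = 6 ∨ x = 7 ∨ x = 8 → ∀ i, (i < G.base (G.hd e) ∨ G.base (G.hd e) + (G.N + 1) ≤ i) →
        s'.realArr x i = s.realArr x i) ∧
      G.NodeHull D' (G.hd e) (s'.natArr 9 (G.hd e)) (s'.hull 6 (G.base (G.hd e)))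
        (s'.hull 7 (G.base (G.hd e))) (s'.hull 8 (G.base (G.hd e))) := by
    refine Ok.straight rfl (by decide) ?_
    have hpos := hc.pos_le
    by_cases hf : 1 ≤ s₄.natVar 14
    -- Writing at address `b + i` of the array is updating line `i` of the envelope stored from `b`
    -- on.
    · have hhull : ∀ (A : ℕ → ℝ) (b i : ℕ) (v : ℝ),
          (fun j => Function.update A (b + i) v (b + j)) =
            Function.update (fun j => A (b + j)) i v := fun A b i v => by
        funext j
        by_cases hj : j = i
        · simp [hj]
        · rw [Function.update_of_ne hj, Function.update_of_ne (by omega)]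
      simp [hullPush, hullTop, block, Prog.exec, NatExp.eval, RealExp.eval, Test.Holds, hf,
        w10, w15, w1, w2, g9, gra, State.hull_eq, hhull]
      refine ⟨hpos, fun q hq => Function.update_of_ne hq _ _, ?_, hins hf⟩
      have hupd : ∀ (A : ℕ → ℝ) (v : ℝ) (i : ℕ),
          i < G.base (G.hd e) ∨ G.base (G.hd e) + (G.N + 1) ≤ i →
          Function.update A (G.base (G.hd e) + s₄.natVar 11) v i = A i := fun A v i hi =>
        Function.update_of_ne (by omega) _ _
      exact ⟨hupd _ _, hupd _ _, hupd _ _⟩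
    · simp [hullPush, hullTop, block, Prog.exec, NatExp.eval, Test.Holds, hf,
        g9, gra, State.hull_eq]
      exact hnins hf
  refine Ok.cons (hfin.framed) (T₂ := 1) ?_ (by omega)
  intro s₅ ⟨⟨q1, q2, q3, q4⟩, f₅⟩ _
  have k5 : s₅.natArr 5 = s₁.natArr 5 := (f₅.na 5 (by decide)).trans g5
  have kr5 : s₅.realArr 5 = s₁.realArr 5 := (f₅.ra 5 (by decide)).trans gr5
  have hp5 : s₅.pend (G.N + 1) = Function.update (s.pend (G.N + 1)) e none :=
    (State.pend_congr (G.N + 1) k5 kr5).trans p₁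
  refine Ok.nil le_rfl ⟨μ - 1, by omega, st₄.frame f₅ (by decide), t₁.congr k5 kr5, ?_, ?_,
    ?_, ?_, ?_⟩
  · rw [hp5]; omega
  · intro f k hk
    rw [hp5] at hk
    by_cases hfe : f = e
    · simp [hfe] at hk
    · rw [Function.update_of_ne hfe] at hk
      exact h.key f k hk
  · intro f k r hk hr hn
    rw [hp5] at hk hn
    by_cases hfe : f = e
    · simp [hfe] at hk
    rw [Function.update_of_ne hfe] at hk
    by_cases hre : r = e
    · rw [hre, ← hkeye]; exact h.tree.root_le hk
    · rw [Function.update_of_ne hre] at hn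
      exact h.order f k r hk hr hn
  · intro f hf
    have := h.height f hf
    by_cases hfe : G.hd f = G.hd e
    · rw [hfe]; omega
    · rw [q2 _ hfe]; omega
  · intro f hf
    rw [hp5]
    by_cases hfe : G.hd f = G.hd e
    · rw [hfe]; exact q4
    · rw [q2 _ hfe]
      have hd := hG.base_disj f e hf hE hfe
      have hhf := h.height f hf
      have hq : ∀ x, x = 6 ∨ x = 7 ∨ x = 8 → ∀ j < s.natArr 9 (G.hd f),
          s₅.hull x (G.base (G.hd f)) j = s.hull x (G.base (G.hd f)) j := fun x hx j hj =>
        q3 x hx _ (by omega)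
      refine (h.hulls f hf).congr (fun r hr => ?_) (hq 6 (by simp)) (hq 7 (by simp))
        (hq 8 (by simp))
      have hre : r ≠ e := fun h => hfe (by rw [← hr, h])
      simp [Function.update_of_ne hre]

lemma ok_sortLoop {G : Net} {s : State} {L : ℕ} (hG : G.Good) (h : SortInv G s G.N)
    (hL : G.N + 1 < 2 ^ L) :
    Ok sortLoop s ((400 * (L + 1) + 210) * (G.N + 1)) fun s' => G.Stored s' ∧ TreeOk (G.N + 1) s' ∧
      (∀ e, s'.pend (G.N + 1) e = none) ∧ G.Hulls G.E s' ∧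
      ∀ e, G.E e → s'.natArr 9 (G.hd e) ≤ G.N + 1 := by
  refine Ok.loop (SortInv G) (fun s' μ hI hb => ok_sortStep hG hI hL hb) h
    (fun s' μ hI hb => ?_) ?_
  · have hn : ∀ e, s'.pend (G.N + 1) e = none := hI.tree.root_zero hb
    refine ⟨hI.stored, hI.tree, hn, fun e he => ?_, fun e he => by have := hI.height e he; omega⟩
    exact (hI.hulls e he).congr (fun r _ => by simp [hn]) (fun _ _ => rfl) (fun _ _ => rfl)
      fun _ _ => rfl
  · simp only [Test.cost, NatExp.cost]
    ring_nf
    omega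

/-! ### Searching the lowest elevation from which water flows along an edge -/

/-- Water in the head of edge `e` at elevation `z` can move on to the tail at elevation `z'` when
all other neighbours are as high as possible. -/
def Net.CanMove (G : Net) (e : ℕ) (z' z : ℝ) : Prop :=
  G.low (G.hd e) ≤ z ∧ z ≤ G.high (G.hd e) ∧ z' ≤ z ∧ ∀ r, G.E r → G.hd r = G.hd e →
    G.a r * (z - G.high (G.tl r)) ≤ G.a e * (z - z')

lemma Net.CanMove.anti {G : Net} (hG : G.Good) {e : ℕ} (he : G.E e) {z'' z' z : ℝ}
    (h : G.CanMove e z' z) (hz : z'' ≤ z') : G.CanMove e z'' z :=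
  ⟨h.1, h.2.1, hz.trans h.2.2.1, fun r hr hre => (h.2.2.2 r hr hre).trans
    (mul_le_mul_of_nonneg_left (by linarith) (hG.a_pos e he).le)⟩

/-- The lowest elevation from which water flows along edge `v6` to elevation `r5`. -/
def query : Prog := block [hullLoad, .setReal 2 (.mul (.var 1) (.var 5)), cross]

/-- The set of suitable elevations need not be closed upwards, because steeper competitors may
overtake later. Only its first point is computed; the upper bound of the head is left to the caller,
since a first point above it rules out all others. -/
lemma ok_query {G : Net} {s : State} {L e : ℕ} {z' : ℝ} (hG : G.Good) (hst : G.Stored s)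
    (hh : G.Hulls G.E s) (hk : ∀ e, G.E e → s.natArr 9 (G.hd e) ≤ G.N + 1)
    (hL : G.N + 1 < 2 ^ L) (h6 : s.natVar 6 = e) (he : G.E e) (h5 : s.realVar 5 = z') :
    Ok query s (200 * (L + 1) + 70) fun s' =>
      (1 ≤ s'.natVar 14 → s'.realVar 3 ≤ G.high (G.hd e) → G.CanMove e z' (s'.realVar 3)) ∧
      ∀ z, G.CanMove e z' z → 1 ≤ s'.natVar 14 ∧ s'.realVar 3 ≤ z := by
  refine Ok.cons (T₁ := 30) (T₂ := 200 * (L + 1) + 40)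
    (R := fun s' => s'.natVar 15 = G.base (G.hd e) ∧
      s'.natVar 16 = s.natArr 9 (G.hd e) ∧ s'.realVar 1 = G.a e)
    (Ok.straight rfl (by decide) ?_) ?_ (by omega)
  · simp [hullLoad, block, Prog.exec, NatExp.eval, RealExp.eval, h6, hst.hd, hst.base, hst.a]
  intro s₂ ⟨v15, v16, r1⟩ f₂
  refine Ok.cons (T₁ := 10) (T₂ := 200 * (L + 1) + 30) (R := fun s' => s'.realVar 2 = G.a e * z')
    (Ok.straight rfl (by decide) ?_) ?_ (by omega)
  · simp [Prog.exec, RealExp.eval, r1, (f₂.r 5 (by decide)).trans h5]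
  intro s₃ r2 f₃
  have hull₃ : ∀ x b, s₃.hull x b = s.hull x b := fun x b => by
    simp only [State.hull_eq]
    rw [(f₃.ra x (by simp [Prog.wRA])).trans (f₂.ra x (by simp [Prog.wRA, hullLoad, block]))]
  have hhe := hh e he
  have hokc := ok_cross (s := s₃) (b := G.base (G.hd e)) (k := s.natArr 9 (G.hd e)) (L := L)
    (α := G.a e) (β := G.a e * z') ((f₃.n 15 (by decide)).trans v15)
    ((f₃.n 16 (by decide)).trans v16) ((f₃.r 1 (by decide)).trans r1) r2
    (by rw [hull₃, hull₃, hull₃]; exact hhe.env) (by have := hk e he; omega)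
  rw [hull₃, hull₃, hull₃] at hokc
  refine Ok.cons hokc (fun s' hc f => Ok.nil (T := 1) le_rfl ?_) (by omega)
  -- The zero line of the envelope accounts for the requirement `z' ≤ z`.
  have hiff : ∀ z, G.low (G.hd e) ≤ z → (AboveAt (s.natArr 9 (G.hd e)) (s.hull 6 (G.base (G.hd e)))
      (s.hull 7 (G.base (G.hd e))) (G.a e) (G.a e * z') z ↔ z' ≤ z ∧ ∀ r, G.E r → G.hd r = G.hd e →
        G.a r * (z - G.high (G.tl r)) ≤ G.a e * (z - z')) := fun z hz => by
    rw [hhe.aboveAt_iff hz]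
    simp only [mul_sub]
    refine and_congr_left fun _ => ?_
    rw [← mul_sub, mul_nonneg_iff_of_pos_left (hG.a_pos e he), sub_nonneg]
  constructor
  · intro hf hx
    have hlow : G.low (G.hd e) ≤ s'.realVar 3 := hhe.start ▸ hc.start_le hf
    exact ⟨hlow, hx, (hiff _ hlow).1 (hc.above hf)⟩
  · intro z hz
    have ha := (hiff z hz.1).2 hz.2.2
    have hf : 1 ≤ s'.natVar 14 := by
      by_contra hf
      exact hc.none hf z (hhe.start.trans_le hz.1) ha
    exact ⟨hf, hc.first hf z (hhe.start.trans_le hz.1) ha⟩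

namespace Net

variable {G : Net}

/-! ### Flow in the lowermost realization -/

variable (G) in
/-- The edge is a steepest descent edge in the lowermost realization. -/
def Steep (f : ℕ) : Prop := G.E f ∧ G.msl (G.hd f) ≤ G.lowSlope f

variable (G) in
/-- Water moves from `p` to `q` in the lowermost realization. -/
def LowStep (p q : ℕ) : Prop := ∃ f, G.Steep f ∧ G.hd f = p ∧ G.tl f = q

variable (G) in
/-- Water moves from `p` to `q` in the lowermost realization in finitely many steps. -/
def LowFlow : ℕ → ℕ → Prop := Relation.ReflTransGen G.LowStep

variable (G) in
/-- No node that water from `v` reaches has a lower neighbour. -/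
def Bottom (v : ℕ) : Prop := ∀ w, G.LowFlow v w → ∀ f, G.E f → G.hd f = w → G.low w ≤ G.low (G.tl f)

lemma lowSlope_pos_iff (hG : G.Good) {f : ℕ} (hf : G.E f) :
    0 < G.lowSlope f ↔ G.low (G.tl f) < G.low (G.hd f) := by
  rw [lowSlope, mul_pos_iff_of_pos_left (hG.a_pos f hf), sub_pos]

lemma lowSlope_nonneg_iff (hG : G.Good) {f : ℕ} (hf : G.E f) :
    0 ≤ G.lowSlope f ↔ G.low (G.tl f) ≤ G.low (G.hd f) := by
  rw [lowSlope, mul_nonneg_iff_of_pos_left (hG.a_pos f hf), sub_nonneg]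

lemma LowStep.low_le (hG : G.Good) {p q : ℕ} (h : G.LowStep p q) : G.low q ≤ G.low p := by
  obtain ⟨f, hf, rfl, rfl⟩ := h
  exact (lowSlope_nonneg_iff hG hf.1).1 ((hG.msl_nonneg _).trans hf.2)

/-- Below a bottom node all flow is level and no visited node has a lower neighbour. The maximum
slope stored for such a node is then `0`, so the opposite of each used edge is steepest too. -/
lemma Bottom.symm (hG : G.Good) {v w : ℕ} (h : G.Bottom v) (hw : G.LowFlow v w) :
    G.LowFlow w v := by
  induction hw with
  | refl => exact .refl
  | @tail b c hb hbc ih =>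
    have h1 := hbc.low_le hG
    obtain ⟨f, hf, rfl, rfl⟩ := hbc
    obtain ⟨g, hg, hgh, hgt⟩ := hG.symm f hf.1
    refine .head ⟨g, ⟨hg, ?_⟩, hgh, hgt⟩ ih
    have h3 : 0 ≤ G.lowSlope g := by
      rw [lowSlope_nonneg_iff hG hg, hgh, hgt]
      exact h _ hb f hf.1 rfl
    refine le_trans ?_ h3
    by_contra hc
    obtain ⟨e, he, heh, hes⟩ := hG.msl_attained _ (not_le.1 hc)
    rw [← hes, not_le, lowSlope_pos_iff hG he, heh, hgh] at hc
    have h2 := h (G.tl f) (hb.tail ⟨f, hf, rfl, rfl⟩) e he (heh.trans hgh)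
    linarith

/-- An unlabelled node of least elevation is in a local minimum if the labelled nodes are closed
under flow. -/
lemma bottom_of_closed (hG : G.Good) {L : ℕ → Prop} {u : ℕ}
    (hc : ∀ f, G.Steep f → L (G.tl f) → L (G.hd f))
    (hl : ∀ g, G.E g → G.low (G.hd g) < G.low u → L (G.hd g)) (hu : ¬ L u) :
    G.Bottom u ∧ ∀ w, G.LowFlow u w → ¬ L w := by
  -- If an unlabelled node at the level of `u` had a lower neighbour, its steepest edge would end
  -- strictly below `u`, at a labelled node, and closure would label it.
  have hA : ∀ w, ¬ L w → G.low w = G.low u → ∀ f, G.E f → G.hd f = w →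
      G.low w ≤ G.low (G.tl f) := by
    intro w hw hwu f hf hfw
    by_contra hlt
    have h1 : 0 < G.lowSlope f := by
      rw [lowSlope_pos_iff hG hf, hfw]; exact not_le.1 hlt
    obtain ⟨e, he, heh, hes⟩ := hG.msl_attained w (hfw ▸ h1.trans_le (hG.le_msl f hf))
    have h2 : 0 < G.lowSlope e := by
      rw [hes]; exact hfw ▸ h1.trans_le (hG.le_msl f hf)
    rw [lowSlope_pos_iff hG he, heh, hwu] at h2
    obtain ⟨g, hg, hgh, -⟩ := hG.symm e he
    have h3 := hl g hg (by rw [hgh]; exact h2)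
    rw [hgh] at h3
    exact hw (heh ▸ hc e ⟨he, by rw [heh, hes]⟩ h3)
  -- Hence water from `u` stays level, and by closure it never enters a labelled node.
  have hB : ∀ w, G.LowFlow u w → ¬ L w ∧ G.low w = G.low u := by
    intro w hw
    induction hw with
    | refl => exact ⟨hu, rfl⟩
    | @tail b c _ hbc ih =>
      have h1 := hbc.low_le hG
      obtain ⟨f, hf, rfl, rfl⟩ := hbc
      refine ⟨fun h => ih.1 (hc f hf h), ?_⟩
      rw [← ih.2]
      exact le_antisymm h1 (hA _ ih.1 ih.2 f hf.1 rfl)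
  exact ⟨fun w hw => hA w (hB w hw).1 (hB w hw).2, fun w hw => (hB w hw).1⟩

/-! ### Scanning the edges with a given tail -/

variable (G) in
/-- The edge `f` has been scanned when the nodes with `mark` have been opened and `c` is the next
edge to be scanned. -/
def Scanned (mark : ℕ → Prop) (c f : ℕ) : Prop :=
  mark (G.tl f) ∧ ¬ (1 ≤ c ∧ G.tl f = G.tl c ∧ f ≤ c)

open Classical in
/-- The number of edges that have not been scanned. -/
noncomputable def unscanned (G : Net) (mark : ℕ → Prop) (c : ℕ) : ℕ :=
  ((Finset.range (G.N + 1)).filter fun f => 1 ≤ f ∧ ¬ G.Scanned mark c f).card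

lemma unscanned_le (mark : ℕ → Prop) (c : ℕ) : G.unscanned mark c ≤ G.N + 1 := by
  classical
  exact (Finset.card_filter_le _ _).trans (Finset.card_range _).le

/-- The edges with a common tail are linked in decreasing order of their numbers without gaps, so
moving on from `c` adds exactly the edge `c`. -/
lemma scanned_nxt (hG : G.Good) {mark : ℕ → Prop} {c f : ℕ} (hc : G.E c) (hm : mark (G.tl c))
    (hf : G.E f) : G.Scanned mark (G.nxt c) f ↔ G.Scanned mark c f ∨ f = c := by
  have h1 := hG.nxt_lt c hc
  have h2 := hG.nxt_tl c hc
  unfold Scanned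
  constructor
  · rintro ⟨hmf, hn⟩
    by_cases hfc : f = c
    · exact .inr hfc
    · refine .inl ⟨hmf, fun ⟨_, ht, hle⟩ => hn ?_⟩
      have h3 := hG.le_nxt c hc f hf ht (by omega)
      have h4 : 1 ≤ G.nxt c := hf.1.trans h3
      exact ⟨h4, ht.trans (h2 h4).symm, h3⟩
  · rintro (⟨hmf, hn⟩ | rfl)
    · refine ⟨hmf, fun ⟨h4, ht, hle⟩ => hn ⟨hc.1, ht.trans (h2 h4), by omega⟩⟩
    · exact ⟨hm, fun ⟨_, _, hle⟩ => by omega⟩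

lemma unscanned_nxt (hG : G.Good) {mark : ℕ → Prop} {c : ℕ} (hc : G.E c) (hm : mark (G.tl c)) :
    G.unscanned mark (G.nxt c) < G.unscanned mark c := by
  classical
  refine Finset.card_lt_card ⟨fun f hf => ?_, fun hs => ?_⟩
  · rw [Finset.mem_filter] at hf ⊢
    have hE : G.E f := ⟨hf.2.1, by have := Finset.mem_range.1 hf.1; omega⟩
    rw [scanned_nxt hG hc hm hE, not_or] at hf
    exact ⟨hf.1, hf.2.1, hf.2.2.1⟩
  · have hE := hc
    have := hs (Finset.mem_filter.2 ⟨Finset.mem_range.2 (by have := hc.2; omega), hc.1,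
      fun h => h.2 ⟨hc.1, rfl, le_rfl⟩⟩)
    rw [Finset.mem_filter, scanned_nxt hG hc hm hE] at this
    exact this.2.2 (.inr rfl)

/-- Opening a node does not change the set of scanned edges. -/
lemma scanned_open (hG : G.Good) {mark mark' : ℕ → Prop} {u f : ℕ} (hu : ¬ mark u)
    (hm : ∀ v, mark' v ↔ mark v ∨ v = u) (hfst : 1 ≤ G.fst u) (hf : G.E f) :
    G.Scanned mark' (G.fst u) f ↔ G.Scanned mark 0 f := by
  unfold Scanned
  rw [hm, (hG.fst_edge u hfst).2]
  have := hG.le_fst f hf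
  constructor
  · rintro ⟨h1 | h1, h2⟩
    · exact ⟨h1, by omega⟩
    · exact absurd ⟨hfst, h1, h1 ▸ this⟩ h2
  · rintro ⟨h1, -⟩
    exact ⟨.inl h1, fun h => hu (h.2.1 ▸ h1)⟩

lemma unscanned_congr {mark mark' : ℕ → Prop} {c c' : ℕ}
    (h : ∀ f, G.E f → (G.Scanned mark c f ↔ G.Scanned mark' c' f)) :
    G.unscanned mark c = G.unscanned mark' c' := by
  classical
  unfold unscanned
  congr 1
  refine Finset.filter_congr fun f hf => and_congr_right fun h1 => not_congr (h f ⟨h1, ?_⟩)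
  have := Finset.mem_range.1 hf
  omega

lemma fst_pos (hG : G.Good) {e : ℕ} (he : G.E e) : 1 ≤ G.fst (G.hd e) := by
  obtain ⟨g, hg, _, hgt⟩ := hG.symm e he
  have := hG.le_fst g hg
  rw [hgt] at this
  exact hg.1.trans this

/-! ### Labels -/

variable (G) in
/-- The labels of the nodes: if `lab p = v + 1`, then `v` is the root of `p`. -/
structure Labelling (lab : ℕ → ℕ) : Prop where
  flow : ∀ p v, lab p = v + 1 → G.LowFlow p v
  bottom : ∀ p v, lab p = v + 1 → G.Bottom v
  root : ∀ p v, lab p = v + 1 → lab v = v + 1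
  inj : ∀ v v', lab v = v + 1 → lab v' = v' + 1 → G.LowFlow v v' → v = v'

/-- A single steep edge in front of the flow of the tail; no root is created, so the separation of
roots is inherited. -/
lemma Labelling.extend {lab : ℕ → ℕ} (h : G.Labelling lab) {f : ℕ} (hf : G.Steep f)
    (h0 : lab (G.hd f) = 0) (h1 : lab (G.tl f) ≠ 0) :
    G.Labelling (Function.update lab (G.hd f) (lab (G.tl f))) := by
  obtain ⟨v, hv⟩ := Nat.exists_eq_succ_of_ne_zero h1
  rw [hv]
  -- Roots carry their own label, while the head is still unlabelled.
  have hvne : v ≠ G.hd f := fun he => by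
    have := h.root _ v hv
    rw [he, h0] at this
    omega
  have key : ∀ p w, Function.update lab (G.hd f) (v + 1) p = w + 1 →
      (p = G.hd f ∧ w = v) ∨ (p ≠ G.hd f ∧ lab p = w + 1) := fun p w hw => by
    by_cases hp : p = G.hd f
    · rw [hp, Function.update_self] at hw
      exact .inl ⟨hp, by omega⟩
    · rw [Function.update_of_ne hp] at hw
      exact .inr ⟨hp, hw⟩
  have hroot : ∀ w, Function.update lab (G.hd f) (v + 1) w = w + 1 → lab w = w + 1 := fun w hw => by
    rcases key w w hw with ⟨hp, hwv⟩ | ⟨_, h2⟩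
    · exact absurd (hwv.symm.trans hp) hvne
    · exact h2
  refine ⟨fun p w hw => ?_, fun p w hw => ?_, fun p w hw => ?_, fun w w' hw hw' => ?_⟩
  · rcases key p w hw with ⟨rfl, rfl⟩ | ⟨_, h2⟩
    · exact .head ⟨f, hf, rfl, rfl⟩ (h.flow _ _ hv)
    · exact h.flow p w h2
  · rcases key p w hw with ⟨rfl, rfl⟩ | ⟨_, h2⟩
    · exact h.bottom _ _ hv
    · exact h.bottom p w h2
  · rcases key p w hw with ⟨rfl, rfl⟩ | ⟨_, h2⟩
    · rw [Function.update_of_ne hvne]; exact h.root _ _ hv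
    · have h3 := h.root p w h2
      rw [Function.update_of_ne fun he => ?_]
      · exact h3
      · rw [he, h0] at h3; omega
  · exact h.inj w w' (hroot w hw) (hroot w' hw')

/-- By `bottom_of_closed` water from `u` meets only unlabelled nodes, hence no old root. Flow from
an old root to `u` would be reversible by `Bottom.symm`. -/
lemma Labelling.new_root (hG : G.Good) {lab : ℕ → ℕ} (h : G.Labelling lab) {u : ℕ} (h0 : lab u = 0)
    (hc : ∀ f, G.Steep f → lab (G.tl f) ≠ 0 → lab (G.hd f) ≠ 0)
    (hl : ∀ g, G.E g → G.low (G.hd g) < G.low u → lab (G.hd g) ≠ 0) :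
    G.Labelling (Function.update lab u (u + 1)) := by
  obtain ⟨hb, hn⟩ := bottom_of_closed hG (L := fun v => lab v ≠ 0) hc hl (not_not.2 h0)
  have key : ∀ p w, Function.update lab u (u + 1) p = w + 1 →
      (p = u ∧ w = u) ∨ (p ≠ u ∧ lab p = w + 1) := fun p w hw => by
    by_cases hp : p = u
    · rw [hp, Function.update_self] at hw
      exact .inl ⟨hp, by omega⟩
    · rw [Function.update_of_ne hp] at hw
      exact .inr ⟨hp, hw⟩
  refine ⟨fun p w hw => ?_, fun p w hw => ?_, fun p w hw => ?_, fun w w' hw hw' hflow => ?_⟩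
  · rcases key p w hw with ⟨rfl, rfl⟩ | ⟨_, h2⟩
    · exact .refl
    · exact h.flow p w h2
  · rcases key p w hw with ⟨rfl, rfl⟩ | ⟨_, h2⟩
    · exact hb
    · exact h.bottom p w h2
  · rcases key p w hw with ⟨rfl, rfl⟩ | ⟨_, h2⟩
    · exact hw
    · have h3 := h.root p w h2
      rw [Function.update_of_ne fun he => ?_]
      · exact h3
      · rw [he, h0] at h3; omega
  · rcases key w w hw with ⟨rfl, -⟩ | ⟨_, h2⟩
    · rcases key w' w' hw' with ⟨rfl, -⟩ | ⟨_, h3⟩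
      · rfl
      · exact absurd (by omega) (hn w' hflow)
    · rcases key w' w' hw' with ⟨rfl, -⟩ | ⟨_, h3⟩
      · exact absurd (by omega) (hn w ((h.bottom w w h2).symm hG hflow))
      · exact h.inj w w' h2 h3 hflow

end Net

/-! ### Loops over the edges -/

/-- Occupy slot `v6` with the key in real variable `0`. -/
def putSlot : Prog := block [.setNat 7 (.var 6), treeUp]

lemma ok_putSlot {s : State} {M L e : ℕ} (hM : s.natVar 4 = M) (hL : M < 2 ^ L) (ht : TreeOk M s)
    (he : s.natVar 6 = e) (h1 : 1 ≤ e) (h2 : e < M) :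
    Ok putSlot s (200 * (L + 1) + 10) fun s' => TreeOk M s' ∧
      s'.pend M = Function.update (s.pend M) e (some (s.realVar 0)) := by
  refine Ok.cons (T₁ := 5) (T₂ := 200 * (L + 1) + 5) (R := fun s' => s'.natVar 7 = e)
    (Ok.straight rfl (by decide) ?_) ?_ (by omega)
  · simp [Prog.exec, NatExp.eval, he]
  intro s₁ h7 f₁
  have e1 := f₁.na 5 (by decide)
  have e2 := f₁.ra 5 (by decide)
  refine Ok.cons (ok_treeUp (s := s₁) (M := M) (L := L) (e := e) ((f₁.n 4 (by decide)).trans hM)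
    hL.le (ht.congr e1 e2) ((f₁.n 6 (by decide)).trans he) h1 h2 (.inr h7))
    (fun s' h f => Ok.nil (T := 1) le_rfl ?_) (by omega)
  rw [if_neg (by omega), State.pend_congr M e1 e2, f₁.r 0 (by decide)] at h
  exact h

/-- Run `c` for every edge, with the number of the edge in `v6`. -/
def forEdges (c : Prog) : Prog :=
  block [.setNat 5 (.const 0), .loop (.natLe (.add (.var 5) (.const 1)) (.var 3))
    (block [block [.setNat 5 (.add (.var 5) (.const 1)), .setNat 6 (.var 5)], c])]

lemma ok_forEdges {c : Prog} {s : State} {N T : ℕ} (I : State → ℕ → Prop) (h3 : s.natVar 3 = N)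
    (h0 : I (s.setN 5 0) 0)
    (hc : ∀ s i, s.natVar 3 = N → I s i → i < N →
      Ok c ((s.setN 5 (i + 1)).setN 6 (i + 1)) T fun s' => I s' (i + 1))
    (h5 : 5 ∉ c.wN) (h3' : 3 ∉ c.wN) :
    Ok (forEdges c) s ((T + 30) * (N + 1)) fun s' => I s' N := by
  refine Ok.cons (T₁ := 2) (T₂ := (T + 20) * N + 10) (R := fun s' => s' = s.setN 5 0)
    (Ok.straight rfl (by decide) rfl) ?_ (by ring_nf; omega)
  rintro s₁ rfl -
  refine Ok.cons (T₁ := (T + 20) * N + 8) (T₂ := 1) (R := fun s' => I s' N) ?_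
    (fun s' h _ => Ok.nil le_rfl h) (by omega)
  refine Ok.loop (T₁ := T + 14) (N := N)
    (fun s' μ => s'.natVar 3 = N ∧ s'.natVar 5 + μ = N ∧ I s' (s'.natVar 5)) ?_ ?_ ?_ ?_
  · intro s' μ ⟨e3, e5, hI⟩ hb
    simp only [Test.Holds, NatExp.eval] at hb
    refine Ok.cons (T₁ := 10) (T₂ := T + 1)
      (R := fun t => t = (s'.setN 5 (s'.natVar 5 + 1)).setN 6 (s'.natVar 5 + 1))
      (Ok.straight rfl (by decide) ?_) ?_ (by omega)
    · simp [block, Prog.exec, NatExp.eval]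
    rintro t rfl -
    refine Ok.cons (hc s' (s'.natVar 5) e3 hI (by omega)) (T₂ := 1) ?_ (by omega)
    intro t ht f
    have g5 : t.natVar 5 = s'.natVar 5 + 1 := (f.n 5 h5).trans (by simp)
    have g3 : t.natVar 3 = N := (f.n 3 h3').trans (by simp [e3])
    exact Ok.nil le_rfl ⟨μ - 1, by omega, g3, by omega, g5 ▸ ht⟩
  · exact ⟨by simp [h3], by simp, by simpa using h0⟩
  · intro s' μ ⟨e3, e5, hI⟩ hb
    simp only [Test.Holds, NatExp.eval] at hb
    have : s'.natVar 5 = N := by omega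
    exact this ▸ hI
  · simp only [Test.cost, NatExp.cost]
    ring_nf
    omega

/-! ### Computing the labels -/

/-- Occupy slot `v6` with the lowest elevation of the head of the edge. -/
def labelSeed : Prog := block [.setReal 0 (.get 2 (.get 3 (.var 6))), putSlot]

lemma ok_labelInit {G : Net} {s : State} {L : ℕ} (hL : G.N + 1 < 2 ^ L) (hst : G.Stored s)
    (ht : TreeOk (G.N + 1) s) :
    Ok (forEdges labelSeed) s ((200 * (L + 1) + 60) * (G.N + 1)) fun s' => G.Stored s' ∧
      TreeOk (G.N + 1) s' ∧ ∀ e, G.E e → s'.pend (G.N + 1) e = some (G.low (G.hd e)) := by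
  refine (ok_forEdges (T := 200 * (L + 1) + 30) (fun s' i => G.Stored s' ∧ TreeOk (G.N + 1) s' ∧
    ∀ e, 1 ≤ e → e ≤ i → s'.pend (G.N + 1) e = some (G.low (G.hd e))) hst.N ⟨?_, ?_, ?_⟩ ?_
    (by decide) (by decide)).mono (by ring_nf; omega) ?_
  · exact ⟨by simpa using hst.N, by simpa using hst.M, hst.hd, hst.tl, hst.nxt, hst.fst, hst.base,
      hst.low, hst.high, hst.a, hst.msl⟩
  · exact ht.congr rfl rfl
  · intro e h1 h2; omega
  · intro s' i h3 ⟨hst', ht', hp⟩ hi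
    refine Ok.cons (T₁ := 10) (T₂ := 200 * (L + 1) + 15)
      (R := fun t => t.realVar 0 = G.low (G.hd (i + 1)))
      (Ok.straight rfl (by decide) ?_) ?_ (by omega)
    · simp [Prog.exec, NatExp.eval, RealExp.eval, hst'.hd, hst'.low]
    intro t hr f
    have hst₀ : G.Stored ((s'.setN 5 (i + 1)).setN 6 (i + 1)) :=
      ⟨by simpa using hst'.N, by simpa using hst'.M, hst'.hd, hst'.tl, hst'.nxt, hst'.fst,
        hst'.base, hst'.low, hst'.high, hst'.a, hst'.msl⟩
    have hst₁ := hst₀.frame f (by decide)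
    have e1 : t.natArr 5 = s'.natArr 5 := f.na 5 (by decide)
    have e2 : t.realArr 5 = s'.realArr 5 := f.ra 5 (by decide)
    refine Ok.cons (ok_putSlot (e := i + 1) hst₁.M hL (ht'.congr e1 e2)
      ((f.n 6 (by decide)).trans (by simp)) (by omega) (by omega))
      (fun t' h f' => Ok.nil (T := 1) le_rfl ⟨hst₁.frame f' (by decide), h.1, fun e h1 h2 => ?_⟩)
      (by omega)
    rw [h.2, hr, State.pend_congr _ e1 e2]
    by_cases he : e = i + 1
    · rw [he, Function.update_self]
    · rw [Function.update_of_ne he]; exact hp e h1 (by omega)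
  · exact fun s' h => ⟨h.1, h.2.1, fun e he => h.2.2 e he.1 he.2⟩

/-- The head of edge `v6`. -/
def headOf : NatExp := .get 3 (.var 6)

/-- The tail of edge `v6`. -/
def tailOf : NatExp := .get 4 (.var 6)

/-- Edge `v6` is a steepest descent edge from an unlabelled node. -/
def mayLabel : Test :=
  .and (.natLe (.get 10 headOf) (.const 0))
    (.realLe (.get 9 headOf) (.mul (.get 4 (.var 6)) (.sub (.get 2 headOf) (.get 2 tailOf))))

/-- Scan edge `v9`: give it preference if its head gets the label of its tail. -/
def labelScan : Prog :=
  block [.setNat 6 (.var 9),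
    .cond mayLabel (block [block [.putNat 11 (.var 6) (.const 1),
      .setReal 0 (.sub (.var 4) .one)], putSlot]) .skip,
    .setNat 9 (.get 6 (.var 9))]

/-- Give a label to the head of edge `v6`. -/
def labelSet : Prog :=
  .cond (.natLe (.get 10 headOf) (.const 0))
    (block [.cond (.natLe (.const 1) (.get 11 (.var 6))) (.putNat 10 headOf (.get 10 tailOf))
      (.putNat 10 headOf (.add headOf (.const 1))), .setNat 9 (.get 7 headOf)]) .skip

/-- Take the next edge out of the tree. -/
def labelPop : Prog := block [.setReal 4 (.get 5 (.const 1)), takeRoot, labelSet]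

/-- Compute the labels of all nodes. -/
def labelLoop : Prog :=
  .loop (.natLe (.const 1) (.add (.var 9) (.get 5 (.const 1))))
    (.cond (.natLe (.const 1) (.var 9)) labelScan labelPop)

/-- The invariant of `labelLoop`. -/
structure LabInv (G : Net) (s : State) (μ : ℕ) : Prop where
  stored : G.Stored s
  tree : TreeOk (G.N + 1) s
  cur : s.natVar 9 = 0 ∨ G.E (s.natVar 9) ∧ s.natArr 10 (G.tl (s.natVar 9)) ≠ 0
  count : occupied (s.pend (G.N + 1)) (G.N + 1) +
    2 * G.unscanned (fun v => s.natArr 10 v ≠ 0) (s.natVar 9) ≤ μ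
  unl : ∀ e, G.E e → s.natArr 10 (G.hd e) = 0 → ∃ k, s.pend (G.N + 1) e = some k ∧
    (s.natArr 11 e = 0 → k = G.low (G.hd e))
  keyCur : 1 ≤ s.natVar 9 → ∀ e k, s.pend (G.N + 1) e = some k → s.natArr 11 e = 0 →
    s.realVar 4 ≤ k
  keyRlx : ∀ e f k k', s.pend (G.N + 1) e = some k → s.natArr 11 e ≠ 0 →
    s.pend (G.N + 1) f = some k' → s.natArr 11 f = 0 → k < k'
  closed : ∀ f, G.Steep f → G.Scanned (fun v => s.natArr 10 v ≠ 0) (s.natVar 9) f →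
    s.natArr 10 (G.hd f) = 0 → s.natArr 11 f ≠ 0
  rlxOk : ∀ f, G.E f → s.natArr 11 f ≠ 0 → G.Steep f ∧ s.natArr 10 (G.tl f) ≠ 0
  labels : G.Labelling (s.natArr 10)

/-- A scan may occupy one slot but uses up an unscanned edge, which counts twice in the measure. -/
lemma ok_labelScan {G : Net} {s : State} {μ L : ℕ} (hG : G.Good) (h : LabInv G s μ)
    (hL : G.N + 1 < 2 ^ L) (hc : 1 ≤ s.natVar 9) :
    Ok labelScan s (200 * (L + 1) + 100) fun s' => ∃ μ' < μ, LabInv G s' μ' := by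
  obtain ⟨c, hcv⟩ : ∃ c, s.natVar 9 = c := ⟨_, rfl⟩
  rw [hcv] at hc
  have hcur := h.cur
  rw [hcv] at hcur
  obtain ⟨hE, hmark⟩ : G.E c ∧ s.natArr 10 (G.tl c) ≠ 0 := hcur.resolve_left (by omega)
  have hcount := h.count
  have hclosed := h.closed
  have hkc := h.keyCur
  rw [hcv] at hcount hclosed hkc
  have hun := Net.unscanned_nxt hG (mark := fun v => s.natArr 10 v ≠ 0) hE hmark
  have hcur' : G.nxt c = 0 ∨ G.E (G.nxt c) ∧ s.natArr 10 (G.tl (G.nxt c)) ≠ 0 := by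
    rcases Nat.eq_zero_or_pos (G.nxt c) with h0 | h0
    · exact .inl h0
    · have h1 := hG.nxt_lt c hE
      have h2 := hE.2
      exact .inr ⟨⟨h0, by omega⟩, by rw [hG.nxt_tl c hE h0]; exact hmark⟩
  refine Ok.cons (T₁ := 5) (T₂ := 200 * (L + 1) + 95) (R := fun s' => s'.natVar 6 = c)
    (Ok.straight rfl (by decide) (by simp [Prog.exec, NatExp.eval, hcv])) ?_ (by omega)
  intro s₁ h6 f₁
  have st₁ := h.stored.frame f₁ (by decide)
  have e5 : s₁.natArr 5 = s.natArr 5 := f₁.na 5 (by decide)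
  have er5 : s₁.realArr 5 = s.realArr 5 := f₁.ra 5 (by decide)
  have e10 : s₁.natArr 10 = s.natArr 10 := f₁.na 10 (by decide)
  have e11 : s₁.natArr 11 = s.natArr 11 := f₁.na 11 (by decide)
  have er4 : s₁.realVar 4 = s.realVar 4 := f₁.r 4 (by decide)
  have htest : mayLabel.Holds s₁ ↔ s.natArr 10 (G.hd c) = 0 ∧ G.Steep c := by
    simp [mayLabel, Test.Holds, NatExp.eval, RealExp.eval, headOf, tailOf, h6, st₁.hd, st₁.tl,
      st₁.msl, st₁.low, st₁.a, e10, Net.Steep, Net.lowSlope, hE]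
  -- The key `s.realVar 4 - 1` is an artificial priority: real variable `4` is at most every
  -- ordinary key still in the tree, so a preferred edge comes out before all ordinary ones.
  have hmid : Ok (.cond mayLabel (block [block [.putNat 11 (.var 6) (.const 1),
      .setReal 0 (.sub (.var 4) .one)], putSlot]) .skip) s₁ (200 * (L + 1) + 70) fun s' =>
      TreeOk (G.N + 1) s' ∧ ((s.natArr 10 (G.hd c) = 0 ∧ G.Steep c ∧
        s'.natArr 11 = Function.update (s.natArr 11) c 1 ∧
        s'.pend (G.N + 1) = Function.update (s.pend (G.N + 1)) c (some (s.realVar 4 - 1))) ∨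
      (¬ (s.natArr 10 (G.hd c) = 0 ∧ G.Steep c) ∧ s'.natArr 11 = s.natArr 11 ∧
        s'.pend (G.N + 1) = s.pend (G.N + 1))) := by
    refine Ok.cond (T₁ := 200 * (L + 1) + 30) (fun ht => ?_) (fun ht => ?_)
      (by simp only [mayLabel, Test.cost, NatExp.cost, RealExp.cost, headOf, tailOf]; omega)
    · rw [htest] at ht
      refine Ok.cons (T₁ := 10) (T₂ := 200 * (L + 1) + 15)
        (R := fun s' => s'.natArr 11 = Function.update (s.natArr 11) c 1 ∧
          s'.realVar 0 = s.realVar 4 - 1)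
        (Ok.straight rfl (by decide) ?_) ?_ (by omega)
      · simp [block, Prog.exec, NatExp.eval, RealExp.eval, h6, e11, er4]
      intro s₂ ⟨g11, gr0⟩ f₂
      have d5 : s₂.natArr 5 = s.natArr 5 := (f₂.na 5 (by decide)).trans e5
      have dr5 : s₂.realArr 5 = s.realArr 5 := (f₂.ra 5 (by decide)).trans er5
      refine Ok.cons (ok_putSlot (e := c) (st₁.frame f₂ (by decide)).M hL (h.tree.congr d5 dr5)
        ((f₂.n 6 (by decide)).trans h6) hE.1 (by have := hE.2; omega))
        (fun t ht' f => Ok.nil (T := 1) le_rfl ⟨ht'.1, .inl ⟨ht.1, ht.2, ?_, ?_⟩⟩) (by omega)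
      · rw [f.na 11 (by decide), g11]
      · rw [ht'.2, gr0, State.pend_congr _ d5 dr5]
    · refine Ok.straight rfl (by simp only [Prog.bound]; omega) ⟨h.tree.congr e5 er5, .inr ⟨?_, e11,
        State.pend_congr _ e5 er5⟩⟩
      rwa [htest] at ht
  refine Ok.cons hmid (T₂ := 20) ?_ (by omega)
  intro s₂ ⟨t₂, hcase⟩ f₂
  have st₂ := st₁.frame f₂ (by decide)
  have g10 : s₂.natArr 10 = s.natArr 10 := (f₂.na 10 (by decide)).trans e10
  have gr4 : s₂.realVar 4 = s.realVar 4 := (f₂.r 4 (by decide)).trans er4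
  have g9 : s₂.natVar 9 = c := (f₂.n 9 (by decide)).trans ((f₁.n 9 (by decide)).trans hcv)
  refine Ok.cons (T₁ := 5) (T₂ := 1) (R := fun s' => s'.natVar 9 = G.nxt c)
    (Ok.straight rfl (by decide) (by simp [Prog.exec, NatExp.eval, g9, st₂.nxt])) ?_ (by omega)
  intro s₃ k9 f₃
  have k5 := f₃.na 5 (by decide)
  have kr5 := f₃.ra 5 (by decide)
  have k10 : s₃.natArr 10 = s.natArr 10 := (f₃.na 10 (by decide)).trans g10
  have k11 : s₃.natArr 11 = s₂.natArr 11 := f₃.na 11 (by decide)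
  have kr4 : s₃.realVar 4 = s.realVar 4 := (f₃.r 4 (by decide)).trans gr4
  have kp := State.pend_congr (G.N + 1) k5 kr5
  refine Ok.nil le_rfl ⟨μ - 1, by omega, st₂.frame f₃ (by decide), t₂.congr k5 kr5, ?_, ?_, ?_, ?_,
    ?_, ?_, ?_, ?_⟩
  · rw [k9, k10]; exact hcur'
  · rw [k9, k10, kp]
    rcases hcase with ⟨_, _, _, hp⟩ | ⟨_, _, hp⟩
    · rw [hp]
      have := occupied_update_le (s.pend (G.N + 1)) (G.N + 1) c (some (s.realVar 4 - 1))
      omega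
    · rw [hp]; omega
  · rw [k10, kp, k11]
    intro e he h0
    obtain ⟨k, hk, hkl⟩ := h.unl e he h0
    rcases hcase with ⟨_, _, h11, hp⟩ | ⟨_, h11, hp⟩
    · rw [hp, h11]
      by_cases hec : e = c
      · rw [hec]
        exact ⟨_, Function.update_self _ _ _, fun h => absurd h (by simp)⟩
      · rw [Function.update_of_ne hec, Function.update_of_ne hec]
        exact ⟨k, hk, hkl⟩
    · rw [hp, h11]; exact ⟨k, hk, hkl⟩
  · rw [kr4, kp, k11]
    intro _ e k hk h0
    rcases hcase with ⟨_, _, h11, hp⟩ | ⟨_, h11, hp⟩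
    · rw [hp] at hk
      rw [h11] at h0
      have hec : e ≠ c := fun hec => by rw [hec, Function.update_self] at h0; omega
      rw [Function.update_of_ne hec] at hk h0
      exact hkc hc e k hk h0
    · rw [hp] at hk
      rw [h11] at h0
      exact hkc hc e k hk h0
  · rw [kp, k11]
    intro e f k k' hk h1 hk' h0
    rcases hcase with ⟨_, _, h11, hp⟩ | ⟨_, h11, hp⟩
    · rw [hp] at hk hk'
      rw [h11] at h0 h1
      have hfc : f ≠ c := fun hfc => by rw [hfc, Function.update_self] at h0; omega
      rw [Function.update_of_ne hfc] at hk' h0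
      by_cases hec : e = c
      · rw [hec, Function.update_self, Option.some_inj] at hk
        have := hkc hc f k' hk' h0
        linarith
      · rw [Function.update_of_ne hec] at hk h1
        exact h.keyRlx e f k k' hk h1 hk' h0
    · rw [hp] at hk hk'
      rw [h11] at h0 h1
      exact h.keyRlx e f k k' hk h1 hk' h0
  · rw [k9, k10, k11]
    intro f hf hs h0
    rw [Net.scanned_nxt hG hE hmark hf.1] at hs
    rcases hcase with ⟨_, _, h11, _⟩ | ⟨hno, h11, _⟩
    · rw [h11]
      by_cases hfc : f = c
      · rw [hfc]; simp
      · rw [Function.update_of_ne hfc]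
        exact hclosed f hf (hs.resolve_right hfc) h0
    · rw [h11]
      rcases hs with hs | rfl
      · exact hclosed f hf hs h0
      · exact absurd ⟨h0, hf⟩ hno
  · rw [k10, k11]
    intro f hf h1
    rcases hcase with ⟨_, hst, h11, _⟩ | ⟨_, h11, _⟩
    · by_cases hfc : f = c
      · rw [hfc]; exact ⟨hst, hmark⟩
      · rw [h11, Function.update_of_ne hfc] at h1
        exact h.rlxOk f hf h1
    · rw [h11] at h1
      exact h.rlxOk f hf h1
  · rw [k10]; exact h.labels

/-- A preferred edge passes on the label of its tail. An ordinary edge with an unlabelled head comes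
out only when no preferred edge of an unlabelled node is left; its head is then a lowest unlabelled
node and may become a root. -/
lemma ok_labelPop {G : Net} {s : State} {μ L : ℕ} (hG : G.Good) (h : LabInv G s μ)
    (hL : G.N + 1 < 2 ^ L) (hc : s.natVar 9 = 0) (hr : 1 ≤ s.natArr 5 1) :
    Ok labelPop s (200 * (L + 1) + 100) fun s' => ∃ μ' < μ, LabInv G s' μ' := by
  obtain ⟨e, he⟩ : ∃ e, s.natArr 5 1 = e := ⟨_, rfl⟩
  have hpe := h.tree.root_pend (by omega) hr
  have hmin : ∀ f k, s.pend (G.N + 1) f = some k → s.realArr 5 1 ≤ k :=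
    fun f k hk => h.tree.root_le hk
  rw [he] at hpe
  obtain ⟨he1, he2⟩ := State.pend_slot hpe
  have hE : G.E e := ⟨he1, by omega⟩
  have hcnt := occupied_clear (P := s.pend (G.N + 1)) he2 (by rw [hpe]; exact Option.some_ne_none _)
  have hcount := h.count
  have hclosed := h.closed
  rw [hc] at hcount hclosed
  refine Ok.cons (T₁ := 5) (T₂ := 200 * (L + 1) + 95) (R := fun s' => s'.realVar 4 = s.realArr 5 1)
    (Ok.straight rfl (by decide) (by simp [Prog.exec, NatExp.eval, RealExp.eval])) ?_ (by omega)
  intro s₁ r4 f₁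
  have e5 : s₁.natArr 5 = s.natArr 5 := f₁.na 5 (by decide)
  have er5 : s₁.realArr 5 = s.realArr 5 := f₁.ra 5 (by decide)
  have hok := ok_takeRoot (h.stored.frame f₁ (by decide)).M hL (h.tree.congr e5 er5)
    (by rw [e5]; exact hr) (by omega)
  rw [e5, State.pend_congr _ e5 er5, he] at hok
  refine Ok.cons hok (T₂ := 70) ?_ (by omega)
  intro s₂ ⟨t₂, v6, p₂⟩ f₂
  have st₂ := (h.stored.frame f₁ (by decide)).frame f₂ (by decide)
  have g9 : s₂.natVar 9 = 0 := (f₂.n 9 (by decide)).trans ((f₁.n 9 (by decide)).trans hc)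
  have g10 : s₂.natArr 10 = s.natArr 10 := (f₂.na 10 (by decide)).trans (f₁.na 10 (by decide))
  have g11 : s₂.natArr 11 = s.natArr 11 := (f₂.na 11 (by decide)).trans (f₁.na 11 (by decide))
  have gr4 : s₂.realVar 4 = s.realArr 5 1 := (f₂.r 4 (by decide)).trans r4
  have hset : Ok labelSet s₂ 65 fun s' =>
      (s.natArr 10 (G.hd e) ≠ 0 ∧ s'.natVar 9 = 0 ∧ s'.natArr 10 = s.natArr 10) ∨
      (s.natArr 10 (G.hd e) = 0 ∧ s'.natVar 9 = G.fst (G.hd e) ∧ s'.natArr 10 =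
        Function.update (s.natArr 10) (G.hd e)
          (if 1 ≤ s.natArr 11 e then s.natArr 10 (G.tl e) else G.hd e + 1)) := by
    refine Ok.straight rfl (by decide) ?_
    by_cases h0 : s.natArr 10 (G.hd e) = 0
    · right
      by_cases h1 : 1 ≤ s.natArr 11 e
      · simp [labelSet, block, Prog.exec, NatExp.eval, Test.Holds, headOf, tailOf, v6, st₂.hd,
          st₂.tl, st₂.fst, g10, g11, h0, h1]
      · simp [labelSet, block, Prog.exec, NatExp.eval, Test.Holds, headOf, v6, st₂.hd,
          st₂.fst, g10, g11, h0, h1]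
    · left
      simp [labelSet, Prog.exec, NatExp.eval, Test.Holds, headOf, v6, st₂.hd, g10, h0, g9]
  refine Ok.cons hset (T₂ := 5) ?_ (by omega)
  intro s₃ hcase f₃
  have k5 := f₃.na 5 (by decide)
  have kr5 := f₃.ra 5 (by decide)
  have kp : s₃.pend (G.N + 1) = Function.update (s.pend (G.N + 1)) e none :=
    (State.pend_congr (G.N + 1) k5 kr5).trans p₂
  have k11 : s₃.natArr 11 = s.natArr 11 := (f₃.na 11 (by decide)).trans g11
  have kr4 : s₃.realVar 4 = s.realArr 5 1 := (f₃.r 4 (by decide)).trans gr4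
  have hpend : ∀ f k, s₃.pend (G.N + 1) f = some k → s.pend (G.N + 1) f = some k := by
    intro f k hk
    rw [kp] at hk
    by_cases hfe : f = e
    · simp [hfe] at hk
    · rwa [Function.update_of_ne hfe] at hk
  have hunl : ∀ f, G.E f → s.natArr 10 (G.hd f) = 0 → f ≠ e → ∃ k,
      s₃.pend (G.N + 1) f = some k ∧ (s₃.natArr 11 f = 0 → k = G.low (G.hd f)) := by
    intro f hf h0 hfe
    rw [kp, Function.update_of_ne hfe, k11]
    exact h.unl f hf h0
  have hkr : ∀ f g k k', s₃.pend (G.N + 1) f = some k → s₃.natArr 11 f ≠ 0 →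
      s₃.pend (G.N + 1) g = some k' → s₃.natArr 11 g = 0 → k < k' := by
    rw [k11]
    exact fun f g k k' hk h1 hk' h0 => h.keyRlx f g k k' (hpend f k hk) h1 (hpend g k' hk') h0
  refine Ok.nil (by omega) ⟨μ - 1, by omega, ?_⟩
  rcases hcase with ⟨h0, k9, k10⟩ | ⟨h0, k9, k10⟩
  · refine ⟨st₂.frame f₃ (by decide), t₂.congr k5 kr5, .inl k9, ?_, ?_, ?_, hkr, ?_, ?_, ?_⟩
    · rw [kp, k10, k9]; omega
    · rw [k10]
      exact fun f hf h1 => hunl f hf h1 fun hfe => h0 (hfe ▸ h1)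
    · rw [k9]; omega
    · rw [k9, k10, k11]; exact hclosed
    · rw [k10, k11]; exact h.rlxOk
    · rw [k10]; exact h.labels
  · have hne : (if 1 ≤ s.natArr 11 e then s.natArr 10 (G.tl e) else G.hd e + 1) ≠ 0 := by
      split_ifs with h1
      · exact (h.rlxOk e hE (by omega)).2
      · omega
    have hfst := Net.fst_pos hG hE
    -- Opening the head restarts the scan at its first edge, so the set of scanned edges is
    -- unchanged and the measure drops with the removed slot.
    have hsc : ∀ f, G.E f → (G.Scanned (fun v => s₃.natArr 10 v ≠ 0) (s₃.natVar 9) f ↔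
        G.Scanned (fun v => s.natArr 10 v ≠ 0) 0 f) := by
      intro f hf
      rw [k9]
      refine Net.scanned_open hG (not_not.2 h0) (fun v => ?_) hfst hf
      rw [k10]
      by_cases hv : v = G.hd e
      · subst hv; simp [hne]
      · simp [hv]
    have hlab0 : ∀ v, s₃.natArr 10 v = 0 → v ≠ G.hd e ∧ s.natArr 10 v = 0 := by
      intro v hv
      rw [k10] at hv
      have hve : v ≠ G.hd e := fun hve => by
        rw [hve, Function.update_self] at hv
        exact hne hv
      rw [Function.update_of_ne hve] at hv
      exact ⟨hve, hv⟩
    refine ⟨st₂.frame f₃ (by decide), t₂.congr k5 kr5, .inr ?_, ?_, ?_, ?_, hkr, ?_, ?_, ?_⟩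
    · have h1 := hG.fst_edge _ hfst
      rw [k9, h1.2, k10, Function.update_self]
      exact ⟨h1.1, hne⟩
    · rw [kp, Net.unscanned_congr hsc]; omega
    · intro f hf h1
      obtain ⟨h2, h3⟩ := hlab0 _ h1
      exact hunl f hf h3 fun hfe => h2 (hfe ▸ rfl)
    · rw [kr4]
      exact fun _ f k hk _ => hmin f k (hpend f k hk)
    · rw [k11]
      intro f hf hs h1
      rw [hsc f hf.1] at hs
      exact hclosed f hf hs (hlab0 _ h1).2
    · rw [k11]
      intro f hf h1
      obtain ⟨h2, h3⟩ := h.rlxOk f hf h1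
      exact ⟨h2, fun h4 => h3 (hlab0 _ h4).2⟩
    · rw [k10]
      split_ifs with h1
      · obtain ⟨h2, h3⟩ := h.rlxOk e hE (by omega)
        exact h.labels.extend h2 h0 h3
      · have hrlx : s.natArr 11 e = 0 := by omega
        -- A preferred edge with unlabelled head would still be in the tree, with a key below the
        -- minimum.
        have hno : ∀ f, G.E f → s.natArr 10 (G.hd f) = 0 → s.natArr 11 f = 0 := by
          intro f hf hf0
          by_contra hf1
          obtain ⟨k, hk, -⟩ := h.unl f hf hf0
          exact absurd (h.keyRlx f e k _ hk hf1 hpe hrlx) (not_lt.2 (hmin f k hk))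
        have hkey : s.realArr 5 1 = G.low (G.hd e) := by
          obtain ⟨k, hk, hkl⟩ := h.unl e hE h0
          rw [hpe, Option.some_inj] at hk
          rw [hk]; exact hkl hrlx
        refine h.labels.new_root hG h0 (fun f hf h2 h3 => ?_) (fun g hg h2 h3 => ?_)
        -- With no scan in progress, all edges with labelled tail have been scanned, so the labelled
        -- nodes are closed as `bottom_of_closed` demands.
        · exact hclosed f hf ⟨h2, fun h => by omega⟩ h3 (hno f hf.1 h3)
        · obtain ⟨k, hk, hkl⟩ := h.unl g hg h3
          have h4 := hmin g k hk
          rw [hkl (hno g hg h3), hkey] at h4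
          linarith

lemma ok_labelLoop {G : Net} {s : State} {μ L : ℕ} (hG : G.Good) (h : LabInv G s μ)
    (hL : G.N + 1 < 2 ^ L) :
    Ok labelLoop s ((200 * (L + 1) + 120) * (μ + 1)) fun s' => G.Stored s' ∧ TreeOk (G.N + 1) s' ∧
      (∀ e, s'.pend (G.N + 1) e = none) ∧ G.Labelling (s'.natArr 10) ∧ s'.natVar 9 = 0 ∧
      ∀ e, G.E e → s'.natArr 10 (G.hd e) ≠ 0 := by
  refine Ok.loop (T₁ := 200 * (L + 1) + 110) (LabInv G) (fun s' μ hI hb => ?_) h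
    (fun s' μ hI hb => ?_) ?_
  · simp only [Test.Holds, NatExp.eval] at hb
    refine Ok.cond (T₁ := 200 * (L + 1) + 100) (fun ht => ok_labelScan hG hI hL ht)
      (fun ht => ok_labelPop hG hI hL ?_ ?_) (by simp only [Test.cost, NatExp.cost]; omega)
    all_goals simp only [Test.Holds, NatExp.eval] at ht; omega
  · simp only [Test.Holds, NatExp.eval] at hb
    have hn : ∀ e, s'.pend (G.N + 1) e = none := hI.tree.root_zero (by omega)
    refine ⟨hI.stored, hI.tree, hn, hI.labels, by omega, fun e he h0 => ?_⟩
    obtain ⟨k, hk, -⟩ := hI.unl e he h0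
    rw [hn] at hk
    exact Option.some_ne_none _ hk.symm
  · simp only [Test.cost, NatExp.cost]
    ring_nf
    omega

/-! ### The second minimum -/

/-- Water in `p` at elevation `z` can reach another minimum than that of the label of `p`. -/
inductive Net.Other (G : Net) (lab : ℕ → ℕ) : ℕ → ℝ → Prop
  | cross {e : ℕ} {z : ℝ} : G.E e → lab (G.hd e) ≠ lab (G.tl e) →
      G.CanMove e (G.low (G.tl e)) z → Other G lab (G.hd e) z
  | step {e : ℕ} {z' z : ℝ} : G.E e → lab (G.hd e) = lab (G.tl e) → Other G lab (G.tl e) z' →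
      G.CanMove e z' z → Other G lab (G.hd e) z

/-- The memory holds the tables, the envelopes and the labels. -/
structure Ready (G : Net) (lab : ℕ → ℕ) (s : State) : Prop where
  stored : G.Stored s
  hulls : G.Hulls G.E s
  height : ∀ e, G.E e → s.natArr 9 (G.hd e) ≤ G.N + 1
  lab : s.natArr 10 = lab

lemma Net.Hulls.frame {G : Net} {D : ℕ → Prop} {c : Prog} {s s' : State} (h : G.Hulls D s)
    (f : Frame c s s') (h9 : 9 ∉ c.wNA) (hr : ∀ x ∈ [6, 7, 8], x ∉ c.wRA) : G.Hulls D s' := by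
  unfold Net.Hulls
  simp only [State.hull_eq, f.na 9 h9, f.ra 6 (hr 6 (by simp)), f.ra 7 (hr 7 (by simp)),
    f.ra 8 (hr 8 (by simp))]
  exact h

lemma Ready.frame {G : Net} {lab : ℕ → ℕ} {c : Prog} {s s' : State} (h : Ready G lab s)
    (f : Frame c s s') (hs : Net.Safe c) (hn : ∀ x ∈ [9, 10], x ∉ c.wNA)
    (hr : ∀ x ∈ [6, 7, 8], x ∉ c.wRA) : Ready G lab s' :=
  ⟨h.stored.frame f hs, h.hulls.frame f (hn 9 (by simp)) hr,
    by rw [f.na 9 (hn 9 (by simp))]; exact h.height, (f.na 10 (hn 10 (by simp))).trans h.lab⟩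

/-- Occupy slot `v6` with the lowest elevation from which water flows along the edge to elevation
`r5`, if there is one. -/
def tryEdge : Prog :=
  block [query, .cond (.and (.natLe (.const 1) (.var 14)) (.realLe (.var 3) (.get 3 headOf)))
    (block [.setReal 0 (.var 3), putSlot]) .skip]

lemma ok_tryEdge {G : Net} {lab : ℕ → ℕ} {s : State} {L e : ℕ} {z' : ℝ} (hG : G.Good)
    (h : Ready G lab s) (ht : TreeOk (G.N + 1) s) (hL : G.N + 1 < 2 ^ L) (h6 : s.natVar 6 = e)
    (he : G.E e) (h5 : s.realVar 5 = z') :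
    Ok tryEdge s (400 * (L + 1) + 150) fun s' => TreeOk (G.N + 1) s' ∧
      (((∀ z, ¬ G.CanMove e z' z) ∧ s'.pend (G.N + 1) = s.pend (G.N + 1)) ∨
        ∃ x, G.CanMove e z' x ∧ (∀ z, G.CanMove e z' z → x ≤ z) ∧
          s'.pend (G.N + 1) = Function.update (s.pend (G.N + 1)) e (some x)) := by
  refine Ok.cons (ok_query hG h.stored h.hulls h.height hL h6 he h5)
    (T₂ := 200 * (L + 1) + 70) ?_ (by omega)
  intro s₁ ⟨hq1, hq2⟩ f₁
  have st₁ := h.stored.frame f₁ (by decide)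
  have e5 : s₁.natArr 5 = s.natArr 5 := f₁.na 5 (by decide)
  have er5 : s₁.realArr 5 = s.realArr 5 := f₁.ra 5 (by decide)
  have e6 : s₁.natVar 6 = e := (f₁.n 6 (by decide)).trans h6
  refine Ok.cons (Ok.cond (T₁ := 200 * (L + 1) + 40) (T := 200 * (L + 1) + 60) (fun hb => ?_)
    (fun hb => ?_) (by simp only [Test.cost, NatExp.cost, RealExp.cost, headOf]; omega))
    (fun t ht _ => Ok.nil (T := 1) le_rfl ht) (by omega)
  all_goals simp only [Test.Holds, NatExp.eval, RealExp.eval, headOf, e6, st₁.hd, st₁.high] at hb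
  · refine Ok.cons (T₁ := 5) (T₂ := 200 * (L + 1) + 20)
      (R := fun s' => s'.realVar 0 = s₁.realVar 3)
      (Ok.straight rfl (by decide) (by simp [Prog.exec, RealExp.eval])) ?_ (by omega)
    intro s₂ r0 f₂
    have d5 : s₂.natArr 5 = s.natArr 5 := (f₂.na 5 (by decide)).trans e5
    have dr5 : s₂.realArr 5 = s.realArr 5 := (f₂.ra 5 (by decide)).trans er5
    refine Ok.cons (ok_putSlot (e := e) (st₁.frame f₂ (by decide)).M hL (ht.congr d5 dr5)
      ((f₂.n 6 (by decide)).trans e6) he.1 (by have := he.2; omega))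
      (fun t ht' f => Ok.nil (T := 1) le_rfl ⟨ht'.1, .inr ⟨_, hq1 hb.1 hb.2,
        fun z hz => (hq2 z hz).2, ?_⟩⟩) (by omega)
    rw [ht'.2, r0, State.pend_congr _ d5 dr5]
  · refine Ok.straight rfl (by simp only [Prog.bound]; omega) ⟨ht.congr e5 er5,
      .inl ⟨fun z hz => ?_,
      State.pend_congr _ e5 er5⟩⟩
    -- Any suitable elevation respects the upper bound of the head, and so would the first point
    -- below it.
    obtain ⟨h1, h2⟩ := hq2 z hz
    exact hb ⟨h1, h2.trans hz.2.1⟩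

/-- The labels of the ends of edge `v6` agree. -/
def sameLabel : Test :=
  .and (.natLe (.get 10 headOf) (.get 10 tailOf)) (.natLe (.get 10 tailOf) (.get 10 headOf))

/-- Occupy slot `v6` if the edge leads to another minimum. -/
def crossSeed : Prog :=
  .cond sameLabel .skip (block [.setReal 5 (.get 2 tailOf), tryEdge])

/-- The seeds of the last search: an edge between different labels needs its tail only at the lowest
elevation. -/
lemma ok_crossInit {G : Net} {lab : ℕ → ℕ} {s : State} {L : ℕ} (hG : G.Good) (h : Ready G lab s)
    (hL : G.N + 1 < 2 ^ L) (ht : TreeOk (G.N + 1) s) (hn : ∀ e, s.pend (G.N + 1) e = none) :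
    Ok (forEdges crossSeed) s ((400 * (L + 1) + 250) * (G.N + 1)) fun s' => Ready G lab s' ∧
      TreeOk (G.N + 1) s' ∧ (∀ e k, s'.pend (G.N + 1) e = some k → G.Other lab (G.hd e) k) ∧
      ∀ e z, G.E e → lab (G.hd e) ≠ lab (G.tl e) → G.CanMove e (G.low (G.tl e)) z →
        ∃ k ≤ z, s'.pend (G.N + 1) e = some k := by
  have hset : ∀ {s : State}, Ready G lab s → ∀ x v, x = 5 ∨ x = 6 → Ready G lab (s.setN x v) := by
    intro s h x v hx
    have h3 : ¬ 3 = x := by omega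
    have h4 : ¬ 4 = x := by omega
    exact ⟨⟨by simpa [h3] using h.stored.N, by simpa [h4] using h.stored.M, h.stored.hd,
      h.stored.tl, h.stored.nxt, h.stored.fst, h.stored.base, h.stored.low, h.stored.high,
      h.stored.a, h.stored.msl⟩, h.hulls, h.height, h.lab⟩
  refine (ok_forEdges (T := 400 * (L + 1) + 200) (fun s' i => Ready G lab s' ∧
    TreeOk (G.N + 1) s' ∧ (∀ e k, s'.pend (G.N + 1) e = some k → G.Other lab (G.hd e) k) ∧
      ∀ e z, 1 ≤ e → e ≤ i → lab (G.hd e) ≠ lab (G.tl e) → G.CanMove e (G.low (G.tl e)) z →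
        ∃ k ≤ z, s'.pend (G.N + 1) e = some k) h.stored.N ⟨hset h 5 0 (by simp), ?_, ?_, ?_⟩ ?_
    (by decide) (by decide)).mono (by ring_nf; omega) ?_
  · exact ht.congr rfl rfl
  · intro e k hk
    have hp0 : (s.setN 5 0).pend (G.N + 1) = s.pend (G.N + 1) := State.pend_congr _ rfl rfl
    rw [hp0, hn] at hk
    exact absurd hk.symm (Option.some_ne_none _)
  · intro e z h1 h2; omega
  · intro s' i h3 ⟨hr, ht', hp, hq⟩ hi
    have hr₀ := hset (hset hr 5 (i + 1) (by simp)) 6 (i + 1) (by simp)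
    have hE : G.E (i + 1) := ⟨by omega, by omega⟩
    set s₀ := (s'.setN 5 (i + 1)).setN 6 (i + 1) with hs₀
    have v6 : s₀.natVar 6 = i + 1 := by simp [hs₀]
    have p₀ : s₀.pend (G.N + 1) = s'.pend (G.N + 1) := State.pend_congr _ rfl rfl
    have t₀ : TreeOk (G.N + 1) s₀ := ht'.congr rfl rfl
    have htest : sameLabel.Holds s₀ ↔ lab (G.hd (i + 1)) = lab (G.tl (i + 1)) := by
      simp only [sameLabel, Test.Holds, NatExp.eval, headOf, tailOf, v6, hr₀.stored.hd,
        hr₀.stored.tl, hr₀.lab]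
      omega
    refine Ok.cond (T₁ := 400 * (L + 1) + 170) (fun hb => ?_) (fun hb => ?_)
      (by simp only [sameLabel, Test.cost, NatExp.cost, headOf, tailOf]; omega)
    · rw [htest] at hb
      refine Ok.straight rfl (by simp only [Prog.bound]; omega) ⟨hr₀, t₀, ?_, ?_⟩
      · simp only [Prog.exec, p₀]; exact hp
      · simp only [Prog.exec, p₀]
        intro e z h1 h2 hne hm
        by_cases hei : e = i + 1
        · exact absurd hb (hei ▸ hne)
        · exact hq e z h1 (by omega) hne hm
    · rw [htest] at hb
      refine Ok.cons (T₁ := 10) (T₂ := 400 * (L + 1) + 160)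
        (R := fun t => t.realVar 5 = G.low (G.tl (i + 1)))
        (Ok.straight rfl (by decide) ?_) ?_ (by omega)
      · simp [Prog.exec, NatExp.eval, RealExp.eval, tailOf, v6, hr₀.stored.tl, hr₀.stored.low]
      intro t r5 f
      have hr₁ := hr₀.frame f (by decide) (by decide) (by decide)
      have d5 : t.natArr 5 = s₀.natArr 5 := f.na 5 (by decide)
      have dr5 : t.realArr 5 = s₀.realArr 5 := f.ra 5 (by decide)
      refine Ok.cons (ok_tryEdge hG hr₁ (t₀.congr d5 dr5) hL ((f.n 6 (by decide)).trans v6) hE r5)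
        (fun t' h f' => Ok.nil (T := 1) le_rfl
          ⟨hr₁.frame f' (by decide) (by decide) (by decide), h.1, ?_⟩) (by omega)
      rw [State.pend_congr _ d5 dr5, p₀] at h
      rcases h.2 with ⟨hno, hpe⟩ | ⟨x, hx, hmin, hpe⟩
      · rw [hpe]
        refine ⟨hp, fun e z h1 h2 hne hm => ?_⟩
        by_cases hei : e = i + 1
        · exact absurd (hei ▸ hm) (hno z)
        · exact hq e z h1 (by omega) hne hm
      · rw [hpe]
        refine ⟨fun e k hk => ?_, fun e z h1 h2 hne hm => ?_⟩
        · by_cases hei : e = i + 1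
          · rw [hei, Function.update_self, Option.some_inj] at hk
            rw [hei, ← hk]
            exact .cross hE hb hx
          · rw [Function.update_of_ne hei] at hk
            exact hp e k hk
        · by_cases hei : e = i + 1
          · subst hei
            exact ⟨x, hmin z hm, Function.update_self _ _ _⟩
          · rw [Function.update_of_ne hei]
            exact hq e z h1 (by omega) hne hm
  · exact fun s' h => ⟨h.1, h.2.1, h.2.2.1, fun e z he => h.2.2.2 e z he.1 he.2⟩

/-- Scan edge `v9`. -/
def otherScan : Prog :=
  block [.setNat 6 (.var 9), .cond sameLabel (block [.setReal 5 (.get 10 tailOf), tryEdge]) .skip,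
    .setNat 9 (.get 6 (.var 9))]

/-- Report the head of edge `v6`, unless this has been done before. -/
def otherSet : Prog :=
  .cond (.natLe (.get 12 headOf) (.const 0))
    (block [.putNat 12 headOf (.const 1), .putReal 10 headOf (.var 4), .putNat 2 (.var 2) headOf,
      .setNat 2 (.add (.var 2) (.const 1)), .setNat 9 (.get 7 headOf)]) .skip

/-- Take the next edge out of the tree. -/
def otherPop : Prog := block [.setReal 4 (.get 5 (.const 1)), takeRoot, otherSet]

/-- Report all nodes that can reach another minimum than that of their label. -/
def otherLoop : Prog :=
  .loop (.natLe (.const 1) (.add (.var 9) (.get 5 (.const 1))))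
    (.cond (.natLe (.const 1) (.var 9)) otherScan otherPop)

/-- The list of the reported nodes. -/
def State.output (s : State) : List ℕ := (List.range (s.natVar 2)).map (s.natArr 2)

/-- The head of `e` has been reported with elevation at most `z`, or will be. -/
def Served (G : Net) (s : State) (e : ℕ) (z : ℝ) : Prop :=
  (s.natArr 12 (G.hd e) ≠ 0 ∧ s.realArr 10 (G.hd e) ≤ z) ∨
    ∃ k ≤ z, s.pend (G.N + 1) e = some k

/-- The invariant of `otherLoop`. -/
structure OtherInv (G : Net) (lab : ℕ → ℕ) (s : State) (μ : ℕ) : Prop where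
  ready : Ready G lab s
  tree : TreeOk (G.N + 1) s
  cur : s.natVar 9 = 0 ∨ G.E (s.natVar 9) ∧ s.natArr 12 (G.tl (s.natVar 9)) ≠ 0
  count : occupied (s.pend (G.N + 1)) (G.N + 1) +
    2 * G.unscanned (fun v => s.natArr 12 v ≠ 0) (s.natVar 9) ≤ μ
  soundP : ∀ e k, s.pend (G.N + 1) e = some k → G.Other lab (G.hd e) k
  soundD : ∀ u, s.natArr 12 u ≠ 0 → G.Other lab u (s.realArr 10 u)
  order : ∀ e k u, s.pend (G.N + 1) e = some k → s.natArr 12 u ≠ 0 → s.realArr 10 u ≤ k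
  orderCur : 1 ≤ s.natVar 9 → ∀ u, s.natArr 12 u ≠ 0 →
    s.realArr 10 u ≤ s.realArr 10 (G.tl (s.natVar 9))
  cross : ∀ e z, G.E e → lab (G.hd e) ≠ lab (G.tl e) → G.CanMove e (G.low (G.tl e)) z →
    Served G s e z
  step : ∀ e z, G.E e → lab (G.hd e) = lab (G.tl e) →
    G.Scanned (fun v => s.natArr 12 v ≠ 0) (s.natVar 9) e →
    G.CanMove e (s.realArr 10 (G.tl e)) z → Served G s e z
  nodup : s.output.Nodup
  mem_output : ∀ v, v ∈ s.output ↔ s.natArr 12 v ≠ 0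

/-- Relaxation of one edge from a node just reported. Edges between different labels keep their
seeds, so no slot serves both rules of `Other`. -/
lemma ok_otherScan {G : Net} {lab : ℕ → ℕ} {s : State} {μ L : ℕ} (hG : G.Good)
    (h : OtherInv G lab s μ) (hL : G.N + 1 < 2 ^ L) (hc : 1 ≤ s.natVar 9) :
    Ok otherScan s (400 * (L + 1) + 220) fun s' => ∃ μ' < μ, OtherInv G lab s' μ' := by
  obtain ⟨c, hcv⟩ : ∃ c, s.natVar 9 = c := ⟨_, rfl⟩
  rw [hcv] at hc
  have hcur := h.cur
  rw [hcv] at hcur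
  obtain ⟨hE, hmark⟩ : G.E c ∧ s.natArr 12 (G.tl c) ≠ 0 := hcur.resolve_left (by omega)
  have hcount := h.count
  have hstep := h.step
  have hkc := h.orderCur
  rw [hcv] at hcount hstep hkc
  have hun := Net.unscanned_nxt hG (mark := fun v => s.natArr 12 v ≠ 0) hE hmark
  refine Ok.cons (T₁ := 5) (T₂ := 400 * (L + 1) + 215) (R := fun s' => s'.natVar 6 = c)
    (Ok.straight rfl (by decide) (by simp [Prog.exec, NatExp.eval, hcv])) ?_ (by omega)
  intro s₁ h6 f₁
  have rd₁ := h.ready.frame f₁ (by decide) (by decide) (by decide)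
  have e5 : s₁.natArr 5 = s.natArr 5 := f₁.na 5 (by decide)
  have er5 : s₁.realArr 5 = s.realArr 5 := f₁.ra 5 (by decide)
  have er10 : s₁.realArr 10 = s.realArr 10 := f₁.ra 10 (by decide)
  have htest : sameLabel.Holds s₁ ↔ lab (G.hd c) = lab (G.tl c) := by
    simp only [sameLabel, Test.Holds, NatExp.eval, headOf, tailOf, h6, rd₁.stored.hd,
      rd₁.stored.tl, rd₁.lab]
    omega
  have hmid : Ok (.cond sameLabel (block [.setReal 5 (.get 10 tailOf), tryEdge]) .skip) s₁
      (400 * (L + 1) + 195) fun s' => TreeOk (G.N + 1) s' ∧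
      ((lab (G.hd c) = lab (G.tl c) ∧ ∃ x, G.CanMove c (s.realArr 10 (G.tl c)) x ∧
        (∀ z, G.CanMove c (s.realArr 10 (G.tl c)) z → x ≤ z) ∧
        s'.pend (G.N + 1) = Function.update (s.pend (G.N + 1)) c (some x)) ∨
      ((lab (G.hd c) = lab (G.tl c) → ∀ z, ¬ G.CanMove c (s.realArr 10 (G.tl c)) z) ∧
        s'.pend (G.N + 1) = s.pend (G.N + 1))) := by
    refine Ok.cond (T₁ := 400 * (L + 1) + 170) (fun hb => ?_) (fun hb => ?_)
      (by simp only [sameLabel, Test.cost, NatExp.cost, headOf, tailOf]; omega)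
    · rw [htest] at hb
      refine Ok.cons (T₁ := 10) (T₂ := 400 * (L + 1) + 160)
        (R := fun t => t.realVar 5 = s.realArr 10 (G.tl c))
        (Ok.straight rfl (by decide) ?_) ?_ (by omega)
      · simp [Prog.exec, NatExp.eval, RealExp.eval, tailOf, h6, rd₁.stored.tl, er10]
      intro t r5 f
      have d5 : t.natArr 5 = s.natArr 5 := (f.na 5 (by decide)).trans e5
      have dr5 : t.realArr 5 = s.realArr 5 := (f.ra 5 (by decide)).trans er5
      refine Ok.cons (ok_tryEdge hG (rd₁.frame f (by decide) (by decide) (by decide))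
        (h.tree.congr d5 dr5) hL ((f.n 6 (by decide)).trans h6) hE r5)
        (fun t' h' f' => Ok.nil (T := 1) le_rfl ⟨h'.1, ?_⟩) (by omega)
      rw [State.pend_congr _ d5 dr5] at h'
      rcases h'.2 with ⟨hno, hpe⟩ | ⟨x, hx, hmin, hpe⟩
      · exact .inr ⟨fun _ => hno, hpe⟩
      · exact .inl ⟨hb, x, hx, hmin, hpe⟩
    · rw [htest] at hb
      exact Ok.straight rfl (by simp only [Prog.bound]; omega) ⟨h.tree.congr e5 er5,
        .inr ⟨fun h => absurd h hb, State.pend_congr _ e5 er5⟩⟩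
  refine Ok.cons hmid (T₂ := 15) ?_ (by omega)
  intro s₂ ⟨t₂, hcase⟩ f₂
  have rd₂ := rd₁.frame f₂ (by decide) (by decide) (by decide)
  have g9 : s₂.natVar 9 = c := (f₂.n 9 (by decide)).trans ((f₁.n 9 (by decide)).trans hcv)
  refine Ok.cons (T₁ := 5) (T₂ := 1) (R := fun s' => s'.natVar 9 = G.nxt c)
    (Ok.straight rfl (by decide) (by simp [Prog.exec, NatExp.eval, g9, rd₂.stored.nxt])) ?_
    (by omega)
  intro s₃ k9 f₃
  have k5 := f₃.na 5 (by decide)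
  have kr5 := f₃.ra 5 (by decide)
  have k12 : s₃.natArr 12 = s.natArr 12 :=
    (f₃.na 12 (by decide)).trans ((f₂.na 12 (by decide)).trans (f₁.na 12 (by decide)))
  have kr10 : s₃.realArr 10 = s.realArr 10 :=
    (f₃.ra 10 (by decide)).trans ((f₂.ra 10 (by decide)).trans er10)
  have kout : s₃.output = s.output := by
    unfold State.output
    rw [(f₃.n 2 (by decide)).trans ((f₂.n 2 (by decide)).trans (f₁.n 2 (by decide))),
      (f₃.na 2 (by decide)).trans ((f₂.na 2 (by decide)).trans (f₁.na 2 (by decide)))]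
  have kp := State.pend_congr (G.N + 1) k5 kr5
  have hsame : ∀ e, e ≠ c → s₃.pend (G.N + 1) e = s.pend (G.N + 1) e := by
    intro e hec
    rcases hcase with ⟨_, x, _, _, hp⟩ | ⟨_, hp⟩
    · rw [kp, hp, Function.update_of_ne hec]
    · rw [kp, hp]
  have hserved : ∀ e z, e ≠ c → Served G s e z → Served G s₃ e z := by
    intro e z hec hs
    unfold Served at hs ⊢
    rwa [k12, kr10, hsame e hec]
  refine Ok.nil (by omega) ⟨μ - 1, by omega, rd₂.frame f₃ (by decide) (by decide) (by decide),
    t₂.congr k5 kr5, ?_, ?_, ?_, ?_, ?_, ?_, ?_, ?_, ?_, ?_⟩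
  · rw [k9, k12]
    rcases Nat.eq_zero_or_pos (G.nxt c) with h0 | h0
    · exact .inl h0
    · have h1 := hG.nxt_lt c hE
      have h2 := hE.2
      exact .inr ⟨⟨h0, by omega⟩, by rw [hG.nxt_tl c hE h0]; exact hmark⟩
  · rw [k9, k12, kp]
    rcases hcase with ⟨_, x, _, _, hp⟩ | ⟨_, hp⟩
    · rw [hp]
      have := occupied_update_le (s.pend (G.N + 1)) (G.N + 1) c (some x)
      omega
    · rw [hp]; omega
  · intro e k hk
    by_cases hec : e = c
    · rw [kp] at hk
      rcases hcase with ⟨hl, x, hx, _, hp⟩ | ⟨_, hp⟩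
      · rw [hp, hec, Function.update_self, Option.some_inj] at hk
        rw [hec, ← hk]
        exact .step hE hl (h.soundD _ hmark) hx
      · rw [hp] at hk
        exact h.soundP e k hk
    · rw [hsame e hec] at hk
      exact h.soundP e k hk
  · rw [k12, kr10]; exact h.soundD
  · rw [k12, kr10]
    intro e k u hk hu
    by_cases hec : e = c
    · rw [kp] at hk
      rcases hcase with ⟨hl, x, hx, _, hp⟩ | ⟨_, hp⟩
      · rw [hp, hec, Function.update_self, Option.some_inj] at hk
        rw [← hk]
        -- Dijkstra's monotonicity: a new key is at least the elevation of the tail, and that is the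
        -- greatest one reported so far.
        exact (hkc hc u hu).trans hx.2.2.1
      · rw [hp] at hk
        exact h.order e k u hk hu
    · rw [hsame e hec] at hk
      exact h.order e k u hk hu
  · rw [k12, kr10, k9]
    intro h0 u hu
    rw [hG.nxt_tl c hE h0]
    exact hkc hc u hu
  · intro e z he hne hm
    have hs := h.cross e z he hne hm
    by_cases hec : e = c
    · rcases hcase with ⟨hl, _⟩ | ⟨_, hp⟩
      · exact absurd hl (hec ▸ hne)
      · unfold Served at hs ⊢
        rwa [k12, kr10, kp, hp]
    · exact hserved e z hec hs
  · rw [k9, k12, kr10]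
    intro e z he hl hs hm
    rw [Net.scanned_nxt hG hE hmark he] at hs
    by_cases hec : e = c
    · subst hec
      rcases hcase with ⟨_, x, _, hmin, hp⟩ | ⟨hno, _⟩
      · refine .inr ⟨x, hmin z hm, ?_⟩
        rw [kp, hp, Function.update_self]
      · exact absurd hm (hno hl z)
    · exact hserved e z hec (hstep e z he hl (hs.resolve_right hec) hm)
  · rw [kout]; exact h.nodup
  · rw [kout, k12]; exact h.mem_output

/-- The first edge to come out for a node carries its least elevation; later ones are discarded
because the reported elevation is no greater. -/
lemma ok_otherPop {G : Net} {lab : ℕ → ℕ} {s : State} {μ L : ℕ} (hG : G.Good)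
    (h : OtherInv G lab s μ) (hL : G.N + 1 < 2 ^ L) (hc : s.natVar 9 = 0) (hr : 1 ≤ s.natArr 5 1) :
    Ok otherPop s (200 * (L + 1) + 150) fun s' => ∃ μ' < μ, OtherInv G lab s' μ' := by
  obtain ⟨e, he⟩ : ∃ e, s.natArr 5 1 = e := ⟨_, rfl⟩
  have hpe := h.tree.root_pend (by omega) hr
  have hmin : ∀ f k, s.pend (G.N + 1) f = some k → s.realArr 5 1 ≤ k :=
    fun f k hk => h.tree.root_le hk
  rw [he] at hpe
  obtain ⟨κ, hκ⟩ : ∃ κ, s.realArr 5 1 = κ := ⟨_, rfl⟩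
  rw [hκ] at hpe hmin
  obtain ⟨he1, he2⟩ := State.pend_slot hpe
  have hE : G.E e := ⟨he1, by omega⟩
  have hcnt := occupied_clear (P := s.pend (G.N + 1)) he2 (by rw [hpe]; exact Option.some_ne_none _)
  have hcount := h.count
  have hstep := h.step
  rw [hc] at hcount hstep
  refine Ok.cons (T₁ := 5) (T₂ := 200 * (L + 1) + 145) (R := fun s' => s'.realVar 4 = κ)
    (Ok.straight rfl (by decide) (by simp [Prog.exec, NatExp.eval, RealExp.eval, hκ])) ?_ (by omega)
  intro s₁ r4 f₁
  have e5 : s₁.natArr 5 = s.natArr 5 := f₁.na 5 (by decide)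
  have er5 : s₁.realArr 5 = s.realArr 5 := f₁.ra 5 (by decide)
  have rd₁ := h.ready.frame f₁ (by decide) (by decide) (by decide)
  have hok := ok_takeRoot rd₁.stored.M hL (h.tree.congr e5 er5) (by rw [e5]; exact hr) (by omega)
  rw [e5, State.pend_congr _ e5 er5, he] at hok
  refine Ok.cons hok (T₂ := 120) ?_ (by omega)
  intro s₂ ⟨t₂, v6, p₂⟩ f₂
  have rd₂ := rd₁.frame f₂ (by decide) (by decide) (by decide)
  have g9 : s₂.natVar 9 = 0 := (f₂.n 9 (by decide)).trans ((f₁.n 9 (by decide)).trans hc)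
  have g12 : s₂.natArr 12 = s.natArr 12 := (f₂.na 12 (by decide)).trans (f₁.na 12 (by decide))
  have g2 : s₂.natArr 2 = s.natArr 2 := (f₂.na 2 (by decide)).trans (f₁.na 2 (by decide))
  have gv2 : s₂.natVar 2 = s.natVar 2 := (f₂.n 2 (by decide)).trans (f₁.n 2 (by decide))
  have gr10 : s₂.realArr 10 = s.realArr 10 := (f₂.ra 10 (by decide)).trans (f₁.ra 10 (by decide))
  have gr4 : s₂.realVar 4 = κ := (f₂.r 4 (by decide)).trans r4
  have hset : Ok otherSet s₂ 110 fun s' =>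
      (s.natArr 12 (G.hd e) ≠ 0 ∧ s'.natVar 9 = 0 ∧ s'.natArr 12 = s.natArr 12 ∧
        s'.realArr 10 = s.realArr 10 ∧ s'.output = s.output) ∨
      (s.natArr 12 (G.hd e) = 0 ∧ s'.natVar 9 = G.fst (G.hd e) ∧
        s'.natArr 12 = Function.update (s.natArr 12) (G.hd e) 1 ∧
        s'.realArr 10 = Function.update (s.realArr 10) (G.hd e) κ ∧
        s'.output = s.output ++ [G.hd e]) := by
    refine Ok.straight rfl (by decide) ?_
    by_cases h0 : s.natArr 12 (G.hd e) = 0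
    · right
      have hout : ∀ (A : ℕ → ℕ) (k v : ℕ), (List.range (k + 1)).map (Function.update A k v) =
          (List.range k).map A ++ [v] := fun A k v => by
        rw [List.range_succ, List.map_append, List.map_singleton, Function.update_self]
        congr 1
        refine List.map_congr_left fun j hj => Function.update_of_ne ?_ _ _
        exact (List.mem_range.1 hj).ne
      simp [otherSet, block, Prog.exec, NatExp.eval, RealExp.eval, Test.Holds, headOf, v6,
        rd₂.stored.hd, rd₂.stored.fst, g12, gr10, gr4, g2, gv2, h0, State.output, hout]
    · left
      simp [otherSet, Prog.exec, NatExp.eval, Test.Holds, headOf, v6, rd₂.stored.hd, g12, h0, g9,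
        gr10, State.output, g2, gv2]
  refine Ok.cons hset (T₂ := 5) ?_ (by omega)
  intro s₃ hcase f₃
  have k5 := f₃.na 5 (by decide)
  have kr5 := f₃.ra 5 (by decide)
  have rd₃ := rd₂.frame f₃ (by decide) (by decide) (by decide)
  have kp : s₃.pend (G.N + 1) = Function.update (s.pend (G.N + 1)) e none :=
    (State.pend_congr (G.N + 1) k5 kr5).trans p₂
  have hpend : ∀ f k, s₃.pend (G.N + 1) f = some k → s.pend (G.N + 1) f = some k := by
    intro f k hk
    rw [kp] at hk
    by_cases hfe : f = e
    · simp [hfe] at hk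
    · rwa [Function.update_of_ne hfe] at hk
  have hsP : ∀ f k, s₃.pend (G.N + 1) f = some k → G.Other lab (G.hd f) k :=
    fun f k hk => h.soundP f k (hpend f k hk)
  refine Ok.nil (by omega) ⟨μ - 1, by omega, ?_⟩
  rcases hcase with ⟨h0, k9, k12, kr10, kout⟩ | ⟨h0, k9, k12, kr10, kout⟩
  · have hserved : ∀ f z, Served G s f z → Served G s₃ f z := by
      intro f z hs
      unfold Served at hs ⊢
      rw [k12, kr10]
      rcases hs with hs | ⟨k, hk, hpk⟩
      · exact .inl hs
      · by_cases hfe : f = e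
        · subst hfe
          exact .inl ⟨h0, (h.order f k _ hpk h0).trans hk⟩
        · exact .inr ⟨k, hk, by rw [kp, Function.update_of_ne hfe]; exact hpk⟩
    refine ⟨rd₃, t₂.congr k5 kr5, .inl k9, ?_, hsP, ?_, ?_, ?_, ?_, ?_, ?_, ?_⟩
    · rw [kp, k12, k9]; omega
    · rw [k12, kr10]; exact h.soundD
    · rw [k12, kr10]
      exact fun f k u hk hu => h.order f k u (hpend f k hk) hu
    · rw [k9]; omega
    · exact fun f z hf hne hm => hserved f z (h.cross f z hf hne hm)
    · rw [k9, k12, kr10]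
      exact fun f z hf hl hs hm => hserved f z (hstep f z hf hl hs hm)
    · rw [kout]; exact h.nodup
    · rw [kout, k12]; exact h.mem_output
  · have hfst := Net.fst_pos hG hE
    have hdone : ∀ v, s₃.natArr 12 v ≠ 0 ↔ s.natArr 12 v ≠ 0 ∨ v = G.hd e := by
      intro v
      rw [k12]
      by_cases hv : v = G.hd e
      · subst hv; simp
      · simp [hv]
    have hz : ∀ v, s.natArr 12 v ≠ 0 → s₃.realArr 10 v = s.realArr 10 v := by
      intro v hv
      rw [kr10, Function.update_of_ne fun hve : v = G.hd e => hv (by rw [hve]; exact h0)]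
    have hze : s₃.realArr 10 (G.hd e) = κ := by rw [kr10, Function.update_self]
    have hsc : ∀ f, G.E f → (G.Scanned (fun v => s₃.natArr 12 v ≠ 0) (s₃.natVar 9) f ↔
        G.Scanned (fun v => s.natArr 12 v ≠ 0) 0 f) := by
      intro f hf
      rw [k9]
      exact Net.scanned_open hG (not_not.2 h0) hdone hfst hf
    have hserved : ∀ f z, Served G s f z → Served G s₃ f z := by
      intro f z hs
      unfold Served at hs ⊢
      rcases hs with ⟨h1, h2⟩ | ⟨k, hk, hpk⟩
      · exact .inl ⟨(hdone _).2 (.inl h1), by rw [hz _ h1]; exact h2⟩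
      · by_cases hfe : f = e
        · subst hfe
          rw [hpe, Option.some_inj] at hpk
          exact .inl ⟨(hdone _).2 (.inr rfl), by rw [hze, hpk]; exact hk⟩
        · exact .inr ⟨k, hk, by rw [kp, Function.update_of_ne hfe]; exact hpk⟩
    refine ⟨rd₃, t₂.congr k5 kr5, .inr ?_, ?_, hsP, ?_, ?_, ?_, ?_, ?_, ?_, ?_⟩
    · have h1 := hG.fst_edge _ hfst
      rw [k9, h1.2]
      exact ⟨h1.1, (hdone _).2 (.inr rfl)⟩
    · rw [kp, Net.unscanned_congr hsc]; omega
    · intro u hu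
      rcases (hdone u).1 hu with h1 | rfl
      · rw [hz u h1]; exact h.soundD u h1
      · rw [hze]; exact h.soundP e κ hpe
    · intro f k u hk hu
      rcases (hdone u).1 hu with h1 | rfl
      · rw [hz u h1]; exact h.order f k u (hpend f k hk) h1
      · rw [hze]; exact hmin f k (hpend f k hk)
    · rw [k9, (hG.fst_edge _ hfst).2, hze]
      intro _ u hu
      rcases (hdone u).1 hu with h1 | rfl
      · rw [hz u h1]; exact h.order e κ u hpe h1
      · rw [hze]
    · exact fun f z hf hne hm => hserved f z (h.cross f z hf hne hm)
    · intro f z hf hl hs hm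
      rw [hsc f hf] at hs
      rw [hz _ hs.1] at hm
      exact hserved f z (hstep f z hf hl hs hm)
    · rw [kout, List.nodup_append]
      refine ⟨h.nodup, List.nodup_singleton _, fun a ha b hb hab => ?_⟩
      rw [List.mem_singleton] at hb
      rw [hab, hb, h.mem_output] at ha
      exact ha h0
    · intro v
      rw [kout, List.mem_append, List.mem_singleton, h.mem_output, hdone]

/-- At the end the tree is empty, so being served means having been reported. -/
lemma ok_otherLoop {G : Net} {lab : ℕ → ℕ} {s : State} {μ L : ℕ} (hG : G.Good)
    (h : OtherInv G lab s μ) (hL : G.N + 1 < 2 ^ L) :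
    Ok otherLoop s ((400 * (L + 1) + 250) * (μ + 1)) fun s' => s'.output.Nodup ∧
      ∀ v, v ∈ s'.output ↔ ∃ z, G.Other lab v z := by
  refine Ok.loop (T₁ := 400 * (L + 1) + 240) (OtherInv G lab) (fun s' μ hI hb => ?_) h
    (fun s' μ hI hb => ?_) ?_
  · simp only [Test.Holds, NatExp.eval] at hb
    refine Ok.cond (T₁ := 400 * (L + 1) + 220) (fun ht => ok_otherScan hG hI hL ht)
      (fun ht => (ok_otherPop hG hI hL ?_ ?_).mono (by omega) fun _ h => h)
      (by simp only [Test.cost, NatExp.cost]; omega)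
    all_goals simp only [Test.Holds, NatExp.eval] at ht; omega
  · simp only [Test.Holds, NatExp.eval] at hb
    have hn : ∀ e, s'.pend (G.N + 1) e = none := hI.tree.root_zero (by omega)
    have hc : s'.natVar 9 = 0 := by omega
    have hstep := hI.step
    rw [hc] at hstep
    have hserved : ∀ e z, Served G s' e z →
        s'.natArr 12 (G.hd e) ≠ 0 ∧ s'.realArr 10 (G.hd e) ≤ z := by
      rintro e z (hs | ⟨k, _, hk⟩)
      · exact hs
      · rw [hn] at hk
        exact absurd hk.symm (Option.some_ne_none _)
    refine ⟨hI.nodup, fun v => (hI.mem_output v).trans ⟨fun hv => ⟨_, hI.soundD v hv⟩, ?_⟩⟩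
    rintro ⟨z, hz⟩
    -- The elevation bound is needed for the induction: it lets the hypothesis on the tail be
    -- weakened to the reported elevation.
    suffices hh : s'.natArr 12 v ≠ 0 ∧ s'.realArr 10 v ≤ z from hh.1
    induction hz with
    | cross he hne hm => exact hserved _ _ (hI.cross _ _ he hne hm)
    | step he hl _ hm ih =>
      exact hserved _ _ (hstep _ _ he hl ⟨ih.1, fun h => by omega⟩ (hm.anti hG he ih.2))
  · simp only [Test.cost, NatExp.cost]
    ring_nf
    omega

/-! ### Building the tables -/

namespace State

variable (s : State)

/-- The head of a directed edge, according to the input. -/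
def inHead (e : ℕ) : ℕ :=
  if e ≤ s.natVar 1 then s.natArr 0 (e - 1) else s.natArr 1 (e - 1 - s.natVar 1)

/-- The tail of a directed edge, according to the input. -/
def inTail (e : ℕ) : ℕ :=
  if e ≤ s.natVar 1 then s.natArr 1 (e - 1) else s.natArr 0 (e - 1 - s.natVar 1)

/-- The reciprocal length of a directed edge, according to the input. -/
noncomputable def inInv (e : ℕ) : ℝ :=
  1 / Real.sqrt
    ((s.realArr 0 (s.inHead e) - s.realArr 0 (s.inTail e)) *
        (s.realArr 0 (s.inHead e) - s.realArr 0 (s.inTail e)) +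
      (s.realArr 1 (s.inHead e) - s.realArr 1 (s.inTail e)) *
        (s.realArr 1 (s.inHead e) - s.realArr 1 (s.inTail e)))

/-- The slope of a directed edge in the lowermost realization, according to the input. -/
noncomputable def inSlope (e : ℕ) : ℝ :=
  s.inInv e * (s.realArr 2 (s.inHead e) - s.realArr 2 (s.inTail e))

/-- The input is the same. -/
structure SameInput (s s' : State) : Prop where
  n : s'.natVar 1 = s.natVar 1
  fst : s'.natArr 0 = s.natArr 0
  snd : s'.natArr 1 = s.natArr 1
  x : s'.realArr 0 = s.realArr 0
  y : s'.realArr 1 = s.realArr 1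
  low : s'.realArr 2 = s.realArr 2

lemma SameInput.frame {c : Prog} {s s' s'' : State} (h : SameInput s s') (f : Frame c s' s'')
    (h1 : 1 ∉ c.wN) (h2 : ∀ x ∈ [0, 1], x ∉ c.wNA) (h3 : ∀ x ∈ [0, 1, 2], x ∉ c.wRA) :
    SameInput s s'' :=
  ⟨(f.n 1 h1).trans h.n, (f.na 0 (h2 0 (by simp))).trans h.fst,
    (f.na 1 (h2 1 (by simp))).trans h.snd, (f.ra 0 (h3 0 (by simp))).trans h.x,
    (f.ra 1 (h3 1 (by simp))).trans h.y, (f.ra 2 (h3 2 (by simp))).trans h.low⟩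

end State

/-- Load the head and the tail of edge `v6` into `v10` and `v16`. -/
def loadEnds : Prog :=
  .cond (.natLe (.var 6) (.var 1))
    (block [.setNat 10 (.get 0 (.sub (.var 6) (.const 1))),
      .setNat 16 (.get 1 (.sub (.var 6) (.const 1)))])
    (block [.setNat 10 (.get 1 (.sub (.sub (.var 6) (.const 1)) (.var 1))),
      .setNat 16 (.get 0 (.sub (.sub (.var 6) (.const 1)) (.var 1)))])

/-- Difference of a coordinate between nodes `v10` and `v16`. -/
def coordDiff (a : ℕ) : RealExp := .sub (.get a (.var 10)) (.get a (.var 16))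

/-- Compute the reciprocal length of the edge between `v10` and `v16`. -/
def loadInv : Prog :=
  .setReal 0 (.div .one (.sqrt (.add (.mul (coordDiff 0) (coordDiff 0))
    (.mul (coordDiff 1) (coordDiff 1)))))

/-- Enter edge `v6` into the tables. -/
def enterEdge : Prog :=
  block [.putNat 3 (.var 6) (.var 10), .putNat 4 (.var 6) (.var 16), .putReal 4 (.var 6) (.var 0),
    .putNat 6 (.var 6) (.get 7 (.var 16)), .putNat 7 (.var 16) (.var 6),
    .putNat 8 (.var 10) (.var 17), .putReal 8 (.var 17) (.get 2 (.var 10)),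
    .putNat 9 (.var 10) (.const 1), .setNat 17 (.add (.var 17) (.var 4))]

/-- Update the maximum slope of node `v10`. -/
def raiseSlope : Prog :=
  block [.setReal 1 (.mul (.var 0) (.sub (.get 2 (.var 10)) (.get 2 (.var 16)))),
    .cond (.realLe (.var 1) (.get 9 (.var 10))) .skip (.putReal 9 (.var 10) (.var 1))]

/-- Process edge `v6`. -/
def setupEdge : Prog := block [loadEnds, loadInv, enterEdge, raiseSlope, putSlot]

/-- Build the tables. -/
def setup : Prog :=
  block [block [.setNat 3 (.add (.var 1) (.var 1)), .setNat 4 (.add (.var 3) (.const 1))],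
    forEdges setupEdge]

/-- The tables have been built for the first `i` edges. -/
structure Built (s₀ : State) (N : ℕ) (s : State) (i : ℕ) : Prop where
  input : s₀.SameInput s
  count : s.natVar 3 = N
  slots : s.natVar 4 = N + 1
  next : s.natVar 17 = i * (N + 1)
  hd : ∀ e, 1 ≤ e → e ≤ i → s.natArr 3 e = s₀.inHead e
  tl : ∀ e, 1 ≤ e → e ≤ i → s.natArr 4 e = s₀.inTail e
  a : ∀ e, 1 ≤ e → e ≤ i → s.realArr 4 e = s₀.inInv e
  fst_le : ∀ u, s.natArr 7 u ≤ i
  fst_tl : ∀ u, 1 ≤ s.natArr 7 u → s₀.inTail (s.natArr 7 u) = u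
  le_fst : ∀ e, 1 ≤ e → e ≤ i → e ≤ s.natArr 7 (s₀.inTail e)
  nxt_lt : ∀ e, 1 ≤ e → e ≤ i → s.natArr 6 e < e
  nxt_tl : ∀ e, 1 ≤ e → e ≤ i → 1 ≤ s.natArr 6 e → s₀.inTail (s.natArr 6 e) = s₀.inTail e
  le_nxt : ∀ e, 1 ≤ e → e ≤ i → ∀ f, 1 ≤ f → s₀.inTail f = s₀.inTail e → f < e →
    f ≤ s.natArr 6 e
  base : ∀ e, 1 ≤ e → e ≤ i → ∃ j < i, s₀.inHead (j + 1) = s₀.inHead e ∧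
    s.natArr 8 (s₀.inHead e) = j * (N + 1)
  height : ∀ e, 1 ≤ e → e ≤ i → s.natArr 9 (s₀.inHead e) = 1
  start : ∀ e, 1 ≤ e → e ≤ i →
    s.realArr 8 (s.natArr 8 (s₀.inHead e)) = s₀.realArr 2 (s₀.inHead e)
  msl_nonneg : ∀ p, 0 ≤ s.realArr 9 p
  le_msl : ∀ e, 1 ≤ e → e ≤ i → s₀.inSlope e ≤ s.realArr 9 (s₀.inHead e)
  msl_attained : ∀ p, 0 < s.realArr 9 p → ∃ e, 1 ≤ e ∧ e ≤ i ∧ s₀.inHead e = p ∧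
    s₀.inSlope e = s.realArr 9 p
  tree : TreeOk (N + 1) s
  pend : ∀ e, 1 ≤ e → e ≤ i → s.pend (N + 1) e = some (s₀.inInv e)

lemma Built.step {s₀ s s' : State} {N i : ℕ} (h : Built s₀ N s i) (input : s₀.SameInput s')
    (v3 : s'.natVar 3 = N) (v4 : s'.natVar 4 = N + 1) (v17 : s'.natVar 17 = (i + 1) * (N + 1))
    (n3 : s'.natArr 3 = Function.update (s.natArr 3) (i + 1) (s₀.inHead (i + 1)))
    (n4 : s'.natArr 4 = Function.update (s.natArr 4) (i + 1) (s₀.inTail (i + 1)))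
    (r4 : s'.realArr 4 = Function.update (s.realArr 4) (i + 1) (s₀.inInv (i + 1)))
    (n6 : s'.natArr 6 = Function.update (s.natArr 6) (i + 1) (s.natArr 7 (s₀.inTail (i + 1))))
    (n7 : s'.natArr 7 = Function.update (s.natArr 7) (s₀.inTail (i + 1)) (i + 1))
    (n8 : s'.natArr 8 = Function.update (s.natArr 8) (s₀.inHead (i + 1)) (i * (N + 1)))
    (r8 : s'.realArr 8 = Function.update (s.realArr 8) (i * (N + 1))
      (s₀.realArr 2 (s₀.inHead (i + 1))))
    (n9 : s'.natArr 9 = Function.update (s.natArr 9) (s₀.inHead (i + 1)) 1)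
    (r9 : s'.realArr 9 = Function.update (s.realArr 9) (s₀.inHead (i + 1))
      (max (s.realArr 9 (s₀.inHead (i + 1))) (s₀.inSlope (i + 1))))
    (ht : TreeOk (N + 1) s') (hp : s'.pend (N + 1) =
      Function.update (s.pend (N + 1)) (i + 1) (some (s₀.inInv (i + 1)))) :
    Built s₀ N s' (i + 1) := by
  have hcase : ∀ e, e ≤ i + 1 → e ≤ i ∨ e = i + 1 := fun e he => by omega
  have hne : ∀ e, e ≤ i → e ≠ i + 1 := fun e he => by omega
  refine ⟨input, v3, v4, v17, ?_, ?_, ?_, ?_, ?_, ?_, ?_, ?_, ?_, ?_, ?_, ?_, ?_, ?_, ?_, ht, ?_⟩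
  · intro e h1 h2
    rcases hcase e h2 with h2 | rfl
    · rw [n3, Function.update_of_ne (hne e h2), h.hd e h1 h2]
    · rw [n3, Function.update_self]
  · intro e h1 h2
    rcases hcase e h2 with h2 | rfl
    · rw [n4, Function.update_of_ne (hne e h2), h.tl e h1 h2]
    · rw [n4, Function.update_self]
  · intro e h1 h2
    rcases hcase e h2 with h2 | rfl
    · rw [r4, Function.update_of_ne (hne e h2), h.a e h1 h2]
    · rw [r4, Function.update_self]
  · intro u
    have := h.fst_le u
    rw [n7, Function.update_apply]
    split_ifs <;> omega
  · intro u hu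
    rw [n7, Function.update_apply] at hu ⊢
    split_ifs at hu ⊢ with hc
    · exact hc.symm
    · exact h.fst_tl u hu
  · intro e h1 h2
    rw [n7, Function.update_apply]
    split_ifs with hc
    · exact h2
    · rcases hcase e h2 with h2 | rfl
      · exact h.le_fst e h1 h2
      · exact absurd rfl hc
  · intro e h1 h2
    rcases hcase e h2 with h2 | rfl
    · rw [n6, Function.update_of_ne (hne e h2)]; exact h.nxt_lt e h1 h2
    · rw [n6, Function.update_self]
      have := h.fst_le (s₀.inTail (i + 1))
      omega
  · intro e h1 h2
    rcases hcase e h2 with h2 | rfl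
    · rw [n6, Function.update_of_ne (hne e h2)]; exact h.nxt_tl e h1 h2
    · rw [n6, Function.update_self]; exact h.fst_tl _
  · intro e h1 h2 f hf1 hft hfe
    rcases hcase e h2 with h2 | rfl
    · rw [n6, Function.update_of_ne (hne e h2)]; exact h.le_nxt e h1 h2 f hf1 hft hfe
    · rw [n6, Function.update_self, ← hft]; exact h.le_fst f hf1 (by omega)
  · intro e h1 h2
    rw [n8, Function.update_apply]
    split_ifs with hc
    · exact ⟨i, by omega, hc.symm, rfl⟩
    · rcases hcase e h2 with h2 | rfl
      · obtain ⟨j, hj, h3⟩ := h.base e h1 h2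
        exact ⟨j, by omega, h3⟩
      · exact absurd rfl hc
  · intro e h1 h2
    rw [n9, Function.update_apply]
    split_ifs with hc
    · rfl
    · rcases hcase e h2 with h2 | rfl
      · exact h.height e h1 h2
      · exact absurd rfl hc
  · intro e h1 h2
    rw [n8, Function.update_apply]
    split_ifs with hc
    · rw [r8, Function.update_self, hc]
    · rcases hcase e h2 with h2 | rfl
      · obtain ⟨j, hj, -, h3⟩ := h.base e h1 h2
        rw [r8, Function.update_of_ne, h.start e h1 h2]
        rw [h3]
        -- Earlier blocks start at smaller multiples of `N + 1`, so the new start cell overwrites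
        -- none of them.
        exact fun h4 => hj.ne (Nat.eq_of_mul_eq_mul_right (Nat.succ_pos N) h4)
      · exact absurd rfl hc
  · intro p
    rw [r9, Function.update_apply]
    split_ifs
    · exact le_max_of_le_left (h.msl_nonneg _)
    · exact h.msl_nonneg p
  · intro e h1 h2
    rw [r9, Function.update_apply]
    split_ifs with hc
    · rcases hcase e h2 with h2 | rfl
      · exact le_max_of_le_left (hc ▸ h.le_msl e h1 h2)
      · exact le_max_right _ _
    · rcases hcase e h2 with h2 | rfl
      · exact h.le_msl e h1 h2
      · exact absurd rfl hc
  · intro p hp0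
    have hold : 0 < s.realArr 9 p → ∃ e, 1 ≤ e ∧ e ≤ i + 1 ∧ s₀.inHead e = p ∧
        s₀.inSlope e = s.realArr 9 p := fun h0 => by
      obtain ⟨e, h1, h2, h3⟩ := h.msl_attained p h0
      exact ⟨e, h1, by omega, h3⟩
    rw [r9, Function.update_apply] at hp0 ⊢
    split_ifs at hp0 ⊢ with hc
    · rcases max_choice (s.realArr 9 (s₀.inHead (i + 1))) (s₀.inSlope (i + 1)) with hm | hm
      · rw [hm] at hp0 ⊢
        rw [← hc] at hp0 ⊢
        exact hold hp0
      · rw [hm]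
        exact ⟨i + 1, by omega, le_rfl, hc.symm, rfl⟩
    · exact hold hp0
  · intro e h1 h2
    rcases hcase e h2 with h2 | rfl
    · rw [hp, Function.update_of_ne (hne e h2), h.pend e h1 h2]
    · rw [hp, Function.update_self]

lemma ok_setupEdge {s₀ s : State} {N i L : ℕ} (h : Built s₀ N s i) (hi : i < N)
    (hL : N + 1 < 2 ^ L) :
    Ok setupEdge ((s.setN 5 (i + 1)).setN 6 (i + 1)) (200 * (L + 1) + 150)
      fun s' => Built s₀ N s' (i + 1) := by
  set t := (s.setN 5 (i + 1)).setN 6 (i + 1) with ht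
  have hin : s₀.SameInput t := ⟨h.input.n, h.input.fst, h.input.snd, h.input.x, h.input.y,
    h.input.low⟩
  have t3 : t.natVar 3 = N := h.count
  have t4 : t.natVar 4 = N + 1 := h.slots
  have t6 : t.natVar 6 = i + 1 := by simp [ht]
  have t17 : t.natVar 17 = i * (N + 1) := h.next
  have na : t.natArr = s.natArr := rfl
  have ra : t.realArr = s.realArr := rfl
  clear_value t
  refine Ok.cons (T₁ := 30) (T₂ := 200 * (L + 1) + 120)
    (R := fun s' => s'.natVar 10 = s₀.inHead (i + 1) ∧ s'.natVar 16 = s₀.inTail (i + 1))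
    (Ok.straight rfl (by decide) ?_) ?_ (by omega)
  · simp only [loadEnds, Prog.exec, Test.Holds, NatExp.eval, t6, hin.n, State.inHead, State.inTail]
    split_ifs <;> simp [block, Prog.exec, NatExp.eval, hin.n, hin.fst, hin.snd, t6]
  intro s₁ ⟨v10, v16⟩ f₁
  have in₁ := hin.frame f₁ (by decide) (by decide) (by decide)
  refine Ok.cons (T₁ := 30) (T₂ := 200 * (L + 1) + 90)
    (R := fun s' => s'.realVar 0 = s₀.inInv (i + 1))
    (Ok.straight rfl (by decide) ?_) ?_ (by omega)
  · simp [loadInv, coordDiff, Prog.exec, RealExp.eval, NatExp.eval, v10, v16, in₁.x, in₁.y,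
      State.inInv]
  intro s₂ r0 f₂
  have in₂ := in₁.frame f₂ (by decide) (by decide) (by decide)
  have g10 : s₂.natVar 10 = s₀.inHead (i + 1) := (f₂.n 10 (by decide)).trans v10
  have g16 : s₂.natVar 16 = s₀.inTail (i + 1) := (f₂.n 16 (by decide)).trans v16
  have g3 : s₂.natVar 3 = N := (f₂.n 3 (by decide)).trans ((f₁.n 3 (by decide)).trans t3)
  have g4 : s₂.natVar 4 = N + 1 := (f₂.n 4 (by decide)).trans ((f₁.n 4 (by decide)).trans t4)
  have g6 : s₂.natVar 6 = i + 1 := (f₂.n 6 (by decide)).trans ((f₁.n 6 (by decide)).trans t6)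
  have g17 : s₂.natVar 17 = i * (N + 1) :=
    (f₂.n 17 (by decide)).trans ((f₁.n 17 (by decide)).trans t17)
  have gna : ∀ x, s₂.natArr x = s.natArr x := fun x => (f₂.na x (by simp [loadInv, Prog.wNA])).trans
    ((f₁.na x (by simp [loadEnds, block, Prog.wNA])).trans (congrFun na x))
  have gra : ∀ x, s₂.realArr x = s.realArr x := fun x =>
    (f₂.ra x (by simp [loadInv, Prog.wRA])).trans
      ((f₁.ra x (by simp [loadEnds, block, Prog.wRA])).trans (congrFun ra x))
  refine Ok.cons (T₁ := 40) (T₂ := 200 * (L + 1) + 50) (R := fun s' =>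
      s'.natVar 17 = (i + 1) * (N + 1) ∧
      s'.natArr 3 = Function.update (s.natArr 3) (i + 1) (s₀.inHead (i + 1)) ∧
      s'.natArr 4 = Function.update (s.natArr 4) (i + 1) (s₀.inTail (i + 1)) ∧
      s'.realArr 4 = Function.update (s.realArr 4) (i + 1) (s₀.inInv (i + 1)) ∧
      s'.natArr 6 = Function.update (s.natArr 6) (i + 1) (s.natArr 7 (s₀.inTail (i + 1))) ∧
      s'.natArr 7 = Function.update (s.natArr 7) (s₀.inTail (i + 1)) (i + 1) ∧
      s'.natArr 8 = Function.update (s.natArr 8) (s₀.inHead (i + 1)) (i * (N + 1)) ∧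
      s'.realArr 8 = Function.update (s.realArr 8) (i * (N + 1))
        (s₀.realArr 2 (s₀.inHead (i + 1))) ∧
      s'.natArr 9 = Function.update (s.natArr 9) (s₀.inHead (i + 1)) 1)
    (Ok.straight rfl (by decide) ?_) ?_ (by omega)
  · simp only [enterEdge, block, Prog.exec, NatExp.eval, RealExp.eval]
    simp [g10, g16, g4, g6, g17, gna, gra, r0, ← in₂.low, add_mul]
  intro s₃ ⟨v17, n3, n4, r4, n6, n7, n8, r8, n9⟩ f₃
  have in₃ := in₂.frame f₃ (by decide) (by decide) (by decide)
  have e9 : s₃.realArr 9 = s.realArr 9 := (f₃.ra 9 (by decide)).trans (gra 9)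
  refine Ok.cons (T₁ := 25) (T₂ := 200 * (L + 1) + 25) (R := fun s' =>
      s'.realArr 9 = Function.update (s.realArr 9) (s₀.inHead (i + 1))
        (max (s.realArr 9 (s₀.inHead (i + 1))) (s₀.inSlope (i + 1))))
    (Ok.straight rfl (by decide) ?_) ?_ (by omega)
  · have e10 := (f₃.n 10 (by decide)).trans g10
    have e16 := (f₃.n 16 (by decide)).trans g16
    have e0 := (f₃.r 0 (by decide)).trans r0
    have eS : s₀.inInv (i + 1) * (s₀.realArr 2 (s₀.inHead (i + 1)) -
      s₀.realArr 2 (s₀.inTail (i + 1))) = s₀.inSlope (i + 1) := rfl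
    by_cases hle : s₀.inSlope (i + 1) ≤ s.realArr 9 (s₀.inHead (i + 1))
    · simp [raiseSlope, block, Prog.exec, Test.Holds, RealExp.eval, NatExp.eval, e10, e16, e0,
        in₃.low, eS, e9, hle]
    · simp [raiseSlope, block, Prog.exec, Test.Holds, RealExp.eval, NatExp.eval, e10, e16, e0,
        in₃.low, eS, e9, hle, max_eq_right (not_le.1 hle).le]
  intro s₄ r9 f₄
  have in₄ := in₃.frame f₄ (by decide) (by decide) (by decide)
  have k5 : s₄.natArr 5 = s.natArr 5 :=
    (f₄.na 5 (by decide)).trans ((f₃.na 5 (by decide)).trans (gna 5))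
  have kr5 : s₄.realArr 5 = s.realArr 5 :=
    (f₄.ra 5 (by decide)).trans ((f₃.ra 5 (by decide)).trans (gra 5))
  have k4 : s₄.natVar 4 = N + 1 := (f₄.n 4 (by decide)).trans ((f₃.n 4 (by decide)).trans g4)
  refine Ok.cons (ok_putSlot (e := i + 1) k4 hL (h.tree.congr k5 kr5)
    ((f₄.n 6 (by decide)).trans ((f₃.n 6 (by decide)).trans g6)) (by omega) (by omega))
    (fun s₅ ⟨ht₅, hp₅⟩ f₅ => Ok.nil (T := 1) le_rfl ?_) (by omega)
  rw [State.pend_congr _ k5 kr5, (f₄.r 0 (by decide)).trans ((f₃.r 0 (by decide)).trans r0)] at hp₅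
  refine h.step (in₄.frame f₅ (by decide) (by decide) (by decide))
    ((f₅.n 3 (by decide)).trans ((f₄.n 3 (by decide)).trans ((f₃.n 3 (by decide)).trans g3)))
    ((f₅.n 4 (by decide)).trans k4)
    ((f₅.n 17 (by decide)).trans ((f₄.n 17 (by decide)).trans v17))
    ((f₅.na 3 (by decide)).trans ((f₄.na 3 (by decide)).trans n3))
    ((f₅.na 4 (by decide)).trans ((f₄.na 4 (by decide)).trans n4))
    ((f₅.ra 4 (by decide)).trans ((f₄.ra 4 (by decide)).trans r4))
    ((f₅.na 6 (by decide)).trans ((f₄.na 6 (by decide)).trans n6))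
    ((f₅.na 7 (by decide)).trans ((f₄.na 7 (by decide)).trans n7))
    ((f₅.na 8 (by decide)).trans ((f₄.na 8 (by decide)).trans n8))
    ((f₅.ra 8 (by decide)).trans ((f₄.ra 8 (by decide)).trans r8))
    ((f₅.na 9 (by decide)).trans ((f₄.na 9 (by decide)).trans n9))
    ((f₅.ra 9 (by decide)).trans r9) ht₅ hp₅

/-- All memory that does not hold the input is zero. -/
structure State.Blank (s : State) : Prop where
  n : ∀ x, 2 ≤ x → s.natVar x = 0
  na : ∀ x, 2 ≤ x → s.natArr x = 0
  ra : ∀ x, 4 ≤ x → s.realArr x = 0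

lemma State.Blank.treeOk {s : State} (h : s.Blank) (M : ℕ) : TreeOk M s :=
  ⟨fun i _ _ => by simp [State.node, winner, h.na 5, h.ra 5], fun e _ => .inl (by simp [h.na 5])⟩

lemma ok_setup {s : State} {L : ℕ} (hs : s.Blank) (hL : 2 * s.natVar 1 + 1 < 2 ^ L) :
    Ok setup s ((200 * (L + 1) + 200) * (2 * s.natVar 1 + 1)) fun s' =>
      Built s (2 * s.natVar 1) s' (2 * s.natVar 1) := by
  set N := 2 * s.natVar 1 with hN
  refine Ok.cons (T₁ := 10) (T₂ := (200 * (L + 1) + 180) * (N + 1) + 1)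
    (R := fun t => t.natVar 3 = N ∧ t.natVar 4 = N + 1)
    (Ok.straight rfl (by decide) ?_) ?_ (by ring_nf; omega)
  · simp [block, Prog.exec, NatExp.eval, hN]
    omega
  intro t ⟨v3, v4⟩ f
  have hna : ∀ x, t.natArr x = s.natArr x := fun x => f.na x (by simp [block, Prog.wNA])
  have hra : ∀ x, t.realArr x = s.realArr x := fun x => f.ra x (by simp [block, Prog.wRA])
  refine Ok.cons (ok_forEdges (T := 200 * (L + 1) + 150) (Built s N) v3 ?_ ?_ (by decide)
    (by decide)) (fun s' h _ => Ok.nil le_rfl h) le_rfl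
  -- The stored maximum slope starts at the default `0`. It thus becomes the maximum of `0` and all
  -- slopes, which builds the condition of non-negative slope into steepness.
  · have hr9 : ∀ p, t.realArr 9 p = 0 := fun p => by rw [hra, hs.ra 9 (by norm_num)]; rfl
    have hn7 : ∀ p, t.natArr 7 p = 0 := fun p => by rw [hna, hs.na 7 (by norm_num)]; rfl
    refine ⟨⟨f.n 1 (by decide), hna 0, hna 1, hra 0, hra 1, hra 2⟩, v3, v4, ?_, ?_, ?_, ?_, ?_,
      ?_, ?_, ?_, ?_, ?_, ?_, ?_, ?_, ?_, ?_, ?_, ?_, ?_⟩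
    · exact (f.n 17 (by decide)).trans ((hs.n 17 (by norm_num)).trans (Nat.zero_mul _).symm)
    all_goals try (intro e h1 h2; omega)
    · exact fun u => (hn7 u).le
    · intro u hu
      have := hn7 u
      rw [State.setN_natArr] at hu
      omega
    · exact fun p => (hr9 p).ge
    · exact fun p hp => absurd (hr9 p) hp.ne'
    · exact (hs.treeOk (N + 1)).congr (hna 5) (hra 5)
  · intro s' i _ hB hi
    exact ok_setupEdge hB hi hL

/-! ### The whole program -/

/-- The network whose tables are in memory. -/
def State.net (s : State) (N : ℕ) : Net where
  N := N
  hd := s.natArr 3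
  tl := s.natArr 4
  nxt := s.natArr 6
  fst := s.natArr 7
  base := s.natArr 8
  a := s.realArr 4
  low := s.realArr 2
  high := s.realArr 3
  msl := s.realArr 9

/-- Numbers up to the edge count stand for the listed orientations, and adding the count reverses an
edge; number `0` is left free to end the lists. -/
lemma State.inHead_opposite {s : State} {e : ℕ} (h1 : 1 ≤ e) (h2 : e ≤ 2 * s.natVar 1) :
    ∃ f, 1 ≤ f ∧ f ≤ 2 * s.natVar 1 ∧ s.inHead f = s.inTail e ∧ s.inTail f = s.inHead e := by
  by_cases h : e ≤ s.natVar 1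
  · refine ⟨e + s.natVar 1, by omega, by omega, ?_⟩
    simp only [inHead, inTail, if_pos h, if_neg (show ¬ e + s.natVar 1 ≤ s.natVar 1 by omega),
      show e + s.natVar 1 - 1 - s.natVar 1 = e - 1 by omega, and_self]
  · refine ⟨e - s.natVar 1, by omega, by omega, ?_⟩
    simp only [inHead, inTail, if_neg h, if_pos (show e - s.natVar 1 ≤ s.natVar 1 by omega),
      show e - s.natVar 1 - 1 = e - 1 - s.natVar 1 by omega, and_self]

namespace Built

variable {s₀ s : State} {N : ℕ}

lemma lowSlope (h : Built s₀ N s N) {e : ℕ} (he : (s.net N).E e) :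
    (s.net N).lowSlope e = s₀.inSlope e := by
  show s.realArr 4 e * (s.realArr 2 (s.natArr 3 e) - s.realArr 2 (s.natArr 4 e)) = _
  rw [h.a e he.1 he.2, h.hd e he.1 he.2, h.tl e he.1 he.2, h.input.low]
  rfl

lemma good (h : Built s₀ N s N) (hN : N = 2 * s₀.natVar 1)
    (ha : ∀ e, 1 ≤ e → e ≤ N → 0 < s₀.inInv e) : (s.net N).Good where
  symm := by
    intro e he
    obtain ⟨f, h1, h2, h3, h4⟩ := State.inHead_opposite (s := s₀) he.1 (hN ▸ he.2)
    rw [← hN] at h2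
    refine ⟨f, ⟨h1, h2⟩, ?_, ?_⟩
    · exact (h.hd f h1 h2).trans (h3.trans (h.tl e he.1 he.2).symm)
    · exact (h.tl f h1 h2).trans (h4.trans (h.hd e he.1 he.2).symm)
  a_pos e he := (ha e he.1 he.2).trans_eq (h.a e he.1 he.2).symm
  fst_edge u hu := ⟨⟨hu, h.fst_le u⟩, (h.tl _ hu (h.fst_le u)).trans (h.fst_tl u hu)⟩
  le_fst e he := by
    show e ≤ s.natArr 7 (s.natArr 4 e)
    rw [h.tl e he.1 he.2]
    exact h.le_fst e he.1 he.2
  nxt_lt e he := h.nxt_lt e he.1 he.2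
  nxt_tl e he h1 := by
    have h2 := h.nxt_lt e he.1 he.2
    have h3 := he.2
    exact (h.tl _ h1 (h2.le.trans h3)).trans
      ((h.nxt_tl e he.1 he.2 h1).trans (h.tl e he.1 he.2).symm)
  le_nxt e he f hf hft hfe := by
    refine h.le_nxt e he.1 he.2 f hf.1 ?_ hfe
    rw [← h.tl e he.1 he.2, ← h.tl f hf.1 hf.2]
    exact hft
  base_disj e f he hf hne := by
    change s.natArr 3 e ≠ s.natArr 3 f at hne
    show s.natArr 8 (s.natArr 3 e) + (N + 1) ≤ s.natArr 8 (s.natArr 3 f) ∨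
      s.natArr 8 (s.natArr 3 f) + (N + 1) ≤ s.natArr 8 (s.natArr 3 e)
    rw [h.hd e he.1 he.2, h.hd f hf.1 hf.2] at hne ⊢
    obtain ⟨j, -, hj1, hj2⟩ := h.base e he.1 he.2
    obtain ⟨k, -, hk1, hk2⟩ := h.base f hf.1 hf.2
    -- Block numbers determine the node, since block `j` is reserved by edge `j + 1`.
    rw [hj2, hk2, ← Nat.succ_mul, ← Nat.succ_mul]
    rcases lt_trichotomy j k with hjk | rfl | hjk
    · exact .inl (Nat.mul_le_mul_right _ hjk)
    · exact absurd (hj1.symm.trans hk1) hne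
    · exact .inr (Nat.mul_le_mul_right _ hjk)
  msl_nonneg := h.msl_nonneg
  le_msl e he := by
    rw [h.lowSlope he]
    show _ ≤ s.realArr 9 (s.natArr 3 e)
    rw [h.hd e he.1 he.2]
    exact h.le_msl e he.1 he.2
  msl_attained p hp := by
    obtain ⟨e, h1, h2, h3, h4⟩ := h.msl_attained p hp
    exact ⟨e, ⟨h1, h2⟩, (h.hd e h1 h2).trans h3, (h.lowSlope ⟨h1, h2⟩).trans h4⟩

lemma sortInv (h : Built s₀ N s N) (h6 : s.realArr 6 = 0) (h7 : s.realArr 7 = 0) :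
    SortInv (s.net N) s N where
  stored := ⟨h.count, h.slots, rfl, rfl, rfl, rfl, rfl, rfl, rfl, rfl, rfl⟩
  tree := h.tree
  count := by
    have hlt : occupied (s.pend (N + 1)) (N + 1) < N + 1 :=
      occupied_lt (by omega) (by simp [State.pend])
    exact Nat.le_of_lt_succ hlt
  key e k hk := by
    obtain ⟨h1, h2⟩ := State.pend_slot hk
    change e < N + 1 at h2
    rw [show (s.net N).N = N from rfl, h.pend e h1 (by omega)] at hk
    exact (Option.some.inj hk).symm.trans (h.a e h1 (by omega)).symm
  order e k r _ hr hn := by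
    rw [show (s.net N).N = N from rfl, h.pend r hr.1 hr.2] at hn
    exact absurd hn (Option.some_ne_none _)
  height e he := by
    show s.natArr 9 (s.natArr 3 e) + N ≤ N + 1
    rw [h.hd e he.1 he.2, h.height e he.1 he.2, add_comm]
  hulls e he := by
    show (s.net N).NodeHull _ (s.natArr 3 e) (s.natArr 9 (s.natArr 3 e))
      (s.hull 6 (s.natArr 8 (s.natArr 3 e))) (s.hull 7 (s.natArr 8 (s.natArr 3 e)))
      (s.hull 8 (s.natArr 8 (s.natArr 3 e)))
    rw [h.hd e he.1 he.2, h.height e he.1 he.2]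
    simp only [State.hull_eq, h6, h7]
    -- All edges are still in the tree, so the envelope is the zero line alone; its coefficients are
    -- the untouched zeros of the arrays `6` and `7`.
    refine ⟨⟨le_rfl, fun j hj => by omega, fun j hj => by omega, fun j hj => by omega⟩, ?_,
      fun z _ => ⟨0, one_pos, by simp⟩, fun z _ r hr _ => ?_, fun j _ => .inl ⟨rfl, rfl⟩⟩
    · rw [Nat.add_zero, h.start e he.1 he.2, ← h.input.low]
      rfl
    · have hn := hr.2
      rw [show (s.net N).N = N from rfl, h.pend r hr.1.1 hr.1.2] at hn
      exact absurd hn (Option.some_ne_none _)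

end Built

/-- Compute the nodes from which water can reach two minima. -/
def ridge : Prog :=
  block [setup, sortLoop, forEdges labelSeed, labelLoop, forEdges crossSeed, otherLoop]

lemma ok_ridge {s : State} {L : ℕ} (hs : s.Blank)
    (ha : ∀ e, 1 ≤ e → e ≤ 2 * s.natVar 1 → 0 < s.inInv e)
    (hL : 2 * s.natVar 1 + 1 < 2 ^ L) :
    Ok ridge s (6000 * (L + 1) * (2 * s.natVar 1 + 1)) fun s' => ∃ (G : Net) (lab : ℕ → ℕ),
      G.Good ∧ G.N = 2 * s.natVar 1 ∧ (∀ e, G.E e → G.hd e = s.inHead e) ∧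
      (∀ e, G.E e → G.tl e = s.inTail e) ∧ (∀ e, G.E e → G.a e = s.inInv e) ∧
      G.low = s.realArr 2 ∧ G.high = s.realArr 3 ∧ G.Labelling lab ∧
      (∀ e, G.E e → lab (G.hd e) ≠ 0) ∧ s'.output.Nodup ∧
      ∀ v, v ∈ s'.output ↔ ∃ z, G.Other lab v z := by
  obtain ⟨N, hN⟩ : ∃ N, 2 * s.natVar 1 = N := ⟨_, rfl⟩
  have hsetup := ok_setup hs hL
  rw [hN] at ha hL hsetup ⊢
  -- Each later bound `T₂` is what remains after subtracting the cost of the current phase; the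
  -- final `1` pays for the empty block.
  refine Ok.cons hsetup (T₂ := (3400 * (L + 1) + 2001) * (N + 1)) ?_ (by ring_nf; omega)
  intro s₁ hB f₁
  have hG := hB.good hN.symm ha
  have hsort := hB.sortInv ((f₁.ra 6 (by decide)).trans (hs.ra 6 (by norm_num)))
    ((f₁.ra 7 (by decide)).trans (hs.ra 7 (by norm_num)))
  obtain ⟨G, hGdef⟩ : ∃ G, s₁.net N = G := ⟨_, rfl⟩
  have hGN : G.N = N := by rw [← hGdef]; rfl
  have hhd : ∀ e, G.E e → G.hd e = s.inHead e := by
    rw [← hGdef]; exact fun e he => hB.hd e he.1 he.2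
  have htl : ∀ e, G.E e → G.tl e = s.inTail e := by
    rw [← hGdef]; exact fun e he => hB.tl e he.1 he.2
  have hinv : ∀ e, G.E e → G.a e = s.inInv e := by
    rw [← hGdef]; exact fun e he => hB.a e he.1 he.2
  have hlow : G.low = s.realArr 2 := by rw [← hGdef]; exact hB.input.low
  have hhigh : G.high = s.realArr 3 := by rw [← hGdef]; exact f₁.ra 3 (by decide)
  have z9 : s₁.natVar 9 = 0 := (f₁.n 9 (by decide)).trans (hs.n 9 (by norm_num))
  have z2 : s₁.natVar 2 = 0 := (f₁.n 2 (by decide)).trans (hs.n 2 (by norm_num))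
  have zn10 : s₁.natArr 10 = 0 := (f₁.na 10 (by decide)).trans (hs.na 10 (by norm_num))
  have zn11 : s₁.natArr 11 = 0 := (f₁.na 11 (by decide)).trans (hs.na 11 (by norm_num))
  have zn12 : s₁.natArr 12 = 0 := (f₁.na 12 (by decide)).trans (hs.na 12 (by norm_num))
  rw [hGdef] at hG hsort
  clear hB hsetup hGdef
  subst hGN
  refine Ok.cons (ok_sortLoop hG hsort hL)
    (T₂ := (3000 * (L + 1) + 1791) * (G.N + 1)) ?_ (by ring_nf; omega)
  intro s₂ ⟨st₂, t₂, _, hh₂, k₂⟩ f₂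
  refine Ok.cons (ok_labelInit hL st₂ t₂)
    (T₂ := (2800 * (L + 1) + 1731) * (G.N + 1)) ?_ (by ring_nf; omega)
  intro s₃ ⟨st₃, t₃, p₃⟩ f₃
  have y9 : s₃.natVar 9 = 0 := (f₃.n 9 (by decide)).trans ((f₂.n 9 (by decide)).trans z9)
  have y10 : s₃.natArr 10 = 0 := (f₃.na 10 (by decide)).trans ((f₂.na 10 (by decide)).trans zn10)
  have y11 : s₃.natArr 11 = 0 := (f₃.na 11 (by decide)).trans ((f₂.na 11 (by decide)).trans zn11)
  -- The measure counts at most `G.N + 1` slots and twice at most `G.N + 1` unscanned edges.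
  have hlab : LabInv G s₃ (3 * (G.N + 1)) := by
    have hz : ∀ v, s₃.natArr 10 v = 0 := fun v => congrFun y10 v
    have hz' : ∀ v, s₃.natArr 11 v = 0 := fun v => congrFun y11 v
    refine ⟨st₃, t₃, .inl y9, ?_, fun e he _ => ⟨_, p₃ e he, fun _ => rfl⟩, fun h => by omega,
      fun e f k k' _ h => absurd (hz' e) h, fun f _ h => absurd (hz _) h.1,
      fun f _ h => absurd (hz' f) h, ?_⟩
    · have h1 := occupied_le (s₃.pend (G.N + 1)) (G.N + 1)
      have h2 := G.unscanned_le (fun v => s₃.natArr 10 v ≠ 0) (s₃.natVar 9)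
      omega
    · refine ⟨fun p v h => ?_, fun p v h => ?_, fun p v h => ?_, fun v v' h => ?_⟩ <;>
      · rw [hz] at h; omega
  refine Ok.cons (ok_labelLoop hG hlab hL)
    (T₂ := (2000 * (L + 1) + 1251) * (G.N + 1)) ?_ (by ring_nf; omega)
  intro s₄ ⟨st₄, t₄, p₄, hL₄, x9, hne₄⟩ f₄
  obtain ⟨lab, hlabdef⟩ : ∃ lab, s₄.natArr 10 = lab := ⟨_, rfl⟩
  have hready : Ready G lab s₄ := by
    refine ⟨st₄, (hh₂.frame f₃ (by decide) (by decide)).frame f₄ (by decide) (by decide), ?_,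
      hlabdef⟩
    rw [f₄.na 9 (by decide), f₃.na 9 (by decide)]
    exact k₂
  rw [hlabdef] at hL₄ hne₄
  refine Ok.cons (ok_crossInit hG hready hL t₄ p₄)
    (T₂ := (1600 * (L + 1) + 1001) * (G.N + 1)) ?_ (by ring_nf; omega)
  intro s₅ ⟨hr₅, t₅, hs₅, hc₅⟩ f₅
  have w9 : s₅.natVar 9 = 0 := (f₅.n 9 (by decide)).trans x9
  have w2 : s₅.natVar 2 = 0 := (f₅.n 2 (by decide)).trans ((f₄.n 2 (by decide)).trans
    ((f₃.n 2 (by decide)).trans ((f₂.n 2 (by decide)).trans z2)))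
  have w12 : ∀ v, s₅.natArr 12 v = 0 := fun v => by
    rw [f₅.na 12 (by decide), f₄.na 12 (by decide), f₃.na 12 (by decide), f₂.na 12 (by decide),
      zn12]
    rfl
  have hother : OtherInv G lab s₅ (3 * (G.N + 1)) := by
    refine ⟨hr₅, t₅, .inl w9, ?_, hs₅, fun u h => absurd (w12 u) h,
      fun e k u _ h => absurd (w12 u) h, fun h => by omega,
      fun e z he hne hm => .inr (hc₅ e z he hne hm), fun e z _ _ h => absurd (w12 _) h.1, ?_,
      fun v => ?_⟩
    · have h1 := occupied_le (s₅.pend (G.N + 1)) (G.N + 1)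
      have h2 := G.unscanned_le (fun v => s₅.natArr 12 v ≠ 0) (s₅.natVar 9)
      omega
    · simp [State.output, w2]
    · simp [State.output, w2, w12]
  refine Ok.cons (ok_otherLoop hG hother hL) (T₂ := 1) ?_ (by ring_nf; omega)
  intro s₆ ⟨hnd, hmem⟩ _
  exact Ok.nil le_rfl ⟨G, lab, hG, rfl, hhd, htl, hinv, hlow, hhigh, hL₄, hne₄, hnd, hmem⟩

/-! ### From networks back to terrains, and the running time. -/

open ImpreciseTerrain

/-! ### Terrains as networks -/

/-- The tables of the network describe the terrain. -/
structure Net.Represents (G : Net) {m : ℕ} (T : ImpreciseTerrain (Fin m)) : Prop where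
  edge : ∀ e, G.E e → ∃ p q : Fin m, G.hd e = p ∧ G.tl e = q ∧ T.graph.Adj p q ∧
    G.a e = 1 / dist (T.pos p) (T.pos q)
  adj : ∀ p q : Fin m, T.graph.Adj p q → ∃ e, G.E e ∧ G.hd e = p ∧ G.tl e = q
  low : ∀ p : Fin m, G.low p = T.low p
  high : ∀ p : Fin m, G.high p = T.high p

namespace Net.Represents

variable {G : Net} {m : ℕ} {T : ImpreciseTerrain (Fin m)}

lemma edge_spec (h : G.Represents T) {e : ℕ} {p q : Fin m} (he : G.E e) (hp : G.hd e = p)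
    (hq : G.tl e = q) : T.graph.Adj p q ∧ G.a e = 1 / dist (T.pos p) (T.pos q) := by
  obtain ⟨p', q', hp', hq', h'⟩ := h.edge e he
  obtain rfl : p = p' := Fin.ext (hp.symm.trans hp')
  obtain rfl : q = q' := Fin.ext (hq.symm.trans hq')
  exact h'

lemma lowSlope (h : G.Represents T) {e : ℕ} {p q : Fin m} (he : G.E e) (hp : G.hd e = p)
    (hq : G.tl e = q) : G.lowSlope e = T.slope T.low p q := by
  rw [Net.lowSlope, hp, hq, h.low, h.low, (h.edge_spec he hp hq).2,
    ImpreciseTerrain.slope, one_div_mul_eq_div]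

/-- The stored maximum is `0` or attained. A non-negative slope below it would thus lose against an
actual edge. -/
lemma steep_iff (h : G.Represents T) (hG : G.Good) {e : ℕ} {p q : Fin m} (he : G.E e)
    (hp : G.hd e = p) (hq : G.tl e = q) : G.Steep e ↔ T.IsSteepestDescent T.low p q := by
  rw [IsSteepestDescent, ← h.lowSlope he hp hq]
  constructor
  · rintro ⟨-, hs⟩
    refine ⟨(h.edge_spec he hp hq).1, (hG.msl_nonneg _).trans hs, fun r hr => ?_⟩
    obtain ⟨f, hf, hfp, hfr⟩ := h.adj p r hr
    rw [← h.lowSlope hf hfp hfr]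
    refine (hG.le_msl f hf).trans ?_
    rw [hfp, ← hp]
    exact hs
  · rintro ⟨-, h0, hmax⟩
    refine ⟨he, ?_⟩
    by_contra hlt
    rw [not_le] at hlt
    obtain ⟨f, hf, hfp, hfs⟩ := hG.msl_attained _ (h0.trans_lt hlt)
    obtain ⟨p', r, hp', hr, hadj, -⟩ := h.edge f hf
    obtain rfl : p = p' := Fin.ext (hp.symm.trans (hfp.symm.trans hp'))
    have := hmax r hadj
    rw [← h.lowSlope hf hp' hr, hfs] at this
    exact absurd hlt (not_lt.2 this)

lemma lowStep_iff (h : G.Represents T) (hG : G.Good) {p q : Fin m} :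
    G.LowStep p q ↔ T.FlowStep T.low p q := by
  rw [flowStep_iff]
  constructor
  · rintro ⟨f, hf, hp, hq⟩
    exact (h.steep_iff hG hf.1 hp hq).1 hf
  · intro hs
    obtain ⟨e, he, hp, hq⟩ := h.adj p q hs.1
    exact ⟨e, (h.steep_iff hG he hp hq).2 hs, hp, hq⟩

lemma lowFlow_of_flowsTo (h : G.Represents T) (hG : G.Good) {p q : Fin m}
    (hf : T.FlowsTo T.low p q) : G.LowFlow p q :=
  hf.lift (fun x : Fin m => (x : ℕ)) fun _ _ hs => (h.lowStep_iff hG).2 hs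

lemma flowsTo_of_lowFlow (h : G.Represents T) (hG : G.Good) {p : Fin m} {v : ℕ}
    (hf : G.LowFlow p v) : ∃ q : Fin m, v = q ∧ T.FlowsTo T.low p q := by
  induction hf with
  | refl => exact ⟨p, rfl, .refl⟩
  | tail _ hs ih =>
    obtain ⟨b, rfl, hb⟩ := ih
    obtain ⟨f, hf, hfh, rfl⟩ := id hs
    obtain ⟨_, c, _, hc, _⟩ := h.edge f hf.1
    rw [hc] at hs
    exact ⟨c, hc, hb.tail ((h.lowStep_iff hG).1 hs)⟩

lemma canMove_iff (h : G.Represents T) {e : ℕ} {p q : Fin m} {z' z : ℝ} (he : G.E e)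
    (hp : G.hd e = p) (hq : G.tl e = q) : G.CanMove e z' z ↔ T.CanFlow p q z' z := by
  rw [CanMove, CanFlow, hp, h.low, h.high, (h.edge_spec he hp hq).2]
  refine and_congr_right fun _ => and_congr_right fun _ => and_congr_right fun _ => ⟨?_, ?_⟩
  · intro hc r hr
    obtain ⟨f, hf, hfp, hfr⟩ := h.adj p r hr
    have := hc f hf hfp
    rwa [hfr, h.high, (h.edge_spec hf hfp hfr).2, one_div_mul_eq_div, one_div_mul_eq_div] at this
  · intro hc f hf hfp
    obtain ⟨_, r, _, hr, _⟩ := h.edge f hf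
    have hs := h.edge_spec hf hfp hr
    rw [hr, h.high, hs.2, one_div_mul_eq_div, one_div_mul_eq_div]
    exact hc r hs.1

/-- The labels yield roots. -/
lemma exists_rooting (h : G.Represents T) (hG : G.Good) {lab : ℕ → ℕ} (hl : G.Labelling lab)
    (hne : ∀ e, G.E e → lab (G.hd e) ≠ 0) :
    ∃ rt : Fin m → Fin m, T.Rooting rt ∧ ∀ p : Fin m, lab p ≠ 0 → lab p = rt p + 1 := by
  -- Label `0` remains only at isolated nodes. They serve as their own roots: no other node flows to
  -- or from them.
  have hiso : ∀ p : Fin m, lab p = 0 → ∀ x, ¬ T.graph.Adj p x := fun p hp x hx => by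
    obtain ⟨e, he, hep, -⟩ := h.adj p x hx
    exact hne e he (by rw [hep, hp])
  have hout : ∀ p w : Fin m, lab p = 0 → T.FlowsTo T.low p w → w = p := fun p w hp hw => by
    rcases hw.cases_head with hw | ⟨b, hb, -⟩
    · exact hw.symm
    · exact absurd (T.flowStep_iff.1 hb).1 (hiso p hp b)
  have hin : ∀ p w : Fin m, lab p = 0 → T.FlowsTo T.low w p → p = w := fun p w hp hw => by
    rcases hw.cases_tail with hw | ⟨b, -, hb⟩
    · exact hw
    · exact absurd (T.flowStep_iff.1 hb).1.symm (hiso p hp b)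
  have hex : ∀ p : Fin m, ∃ r : Fin m, (lab p = 0 ∧ r = p) ∨
      (lab p = r + 1 ∧ T.FlowsTo T.low p r) := fun p => by
    rcases Nat.eq_zero_or_pos (lab p) with h0 | h0
    · exact ⟨p, .inl ⟨h0, rfl⟩⟩
    · obtain ⟨v, hv⟩ := Nat.exists_eq_succ_of_ne_zero h0.ne'
      obtain ⟨r, rfl, hr⟩ := h.flowsTo_of_lowFlow hG (hl.flow p v hv)
      exact ⟨r, .inr ⟨hv, hr⟩⟩
  choose rt hrt using hex
  refine ⟨rt, ⟨fun p => ?_, fun p w hw x hx => ?_, fun p q hpq => ?_⟩, fun p hp => ?_⟩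
  · rcases hrt p with ⟨-, he⟩ | ⟨-, hf⟩
    · rw [he]; exact .refl
    · exact hf
  · rcases hrt p with ⟨h0, he⟩ | ⟨hp, -⟩
    · rw [he] at hw
      rw [hout p w h0 hw] at hx
      exact absurd hx (hiso p h0 x)
    · obtain ⟨f, hf, hfw, hfx⟩ := h.adj w x hx
      have := hl.bottom p _ hp w (h.lowFlow_of_flowsTo hG hw) f hf hfw
      rwa [hfx, h.low, h.low] at this
  · rcases hrt p with ⟨h0, he⟩ | ⟨hp, -⟩
    · rw [he] at hpq ⊢
      exact (hout p _ h0 hpq).symm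
    · rcases hrt q with ⟨h0', he'⟩ | ⟨hq, -⟩
      · rw [he'] at hpq ⊢
        exact (hin q _ h0' hpq).symm
      · exact Fin.ext (hl.inj _ _ (hl.root p _ hp) (hl.root q _ hq) (h.lowFlow_of_flowsTo hG hpq))
  · rcases hrt p with ⟨h0, -⟩ | ⟨hp', -⟩
    · exact absurd h0 hp
    · exact hp'

/-- Both ends of an edge are labelled, so comparing labels is comparing roots; the two recursions
then match rule by rule. -/
lemma other_iff (h : G.Represents T) (hG : G.Good) {lab : ℕ → ℕ}
    (hne : ∀ e, G.E e → lab (G.hd e) ≠ 0) {rt : Fin m → Fin m}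
    (hrt : ∀ p : Fin m, lab p ≠ 0 → lab p = rt p + 1) {v : ℕ} {z : ℝ} :
    G.Other lab v z ↔ ∃ p : Fin m, (p : ℕ) = v ∧ T.ReachOther rt p z := by
  have hlab : ∀ e (p q : Fin m), G.E e → G.hd e = p → G.tl e = q →
      (lab (G.hd e) = lab (G.tl e) ↔ rt p = rt q) := fun e p q he hp hq => by
    obtain ⟨f, hf, hfq, -⟩ := hG.symm e he
    have h1 := hne e he
    have h2 := hne f hf
    rw [hp] at h1
    rw [hfq, hq] at h2
    rw [hp, hq, hrt p h1, hrt q h2, Nat.add_right_cancel_iff, Fin.val_inj]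
  constructor
  · intro ho
    induction ho with
    | @cross e z he hne hm =>
      obtain ⟨p, q, hp, hq, hadj, -⟩ := h.edge e he
      refine ⟨p, hp.symm, .cross hadj ((hlab e p q he hp hq).not.1 hne) ?_⟩
      rw [← h.low, ← hq]
      exact (h.canMove_iff he hp hq).1 hm
    | @step e z' z he hl _ hm ih =>
      obtain ⟨q, hq, ho⟩ := ih
      obtain ⟨p, _, hp, _⟩ := h.edge e he
      exact ⟨p, hp.symm, .step (h.edge_spec he hp hq.symm).1 ((hlab e p q he hp hq.symm).1 hl) ho
        ((h.canMove_iff he hp hq.symm).1 hm)⟩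
  · rintro ⟨p, rfl, ho⟩
    induction ho with
    | @cross p q z hadj hne hc =>
      obtain ⟨e, he, hp, hq⟩ := h.adj p q hadj
      rw [← hp]
      refine .cross he ((hlab e p q he hp hq).not.2 hne) ?_
      rw [hq, h.low]
      exact (h.canMove_iff he hp hq).2 hc
    | @step p q z' z hadj hl _ hc ih =>
      obtain ⟨e, he, hp, hq⟩ := h.adj p q hadj
      rw [← hp]
      refine .step he ((hlab e p q he hp hq).2 hl) ?_ ((h.canMove_iff he hp hq).2 hc)
      rw [hq]
      exact ih

end Net.Represents

/-! ### The input -/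

variable {m n : ℕ} {T : ImpreciseTerrain (Fin m)} {ends : Fin n → Fin m × Fin m}

lemma blank_inputState : (T.inputState ends).Blank where
  n x hx := by simp [inputState, show x ≠ 0 by omega, show x ≠ 1 by omega]
  na x hx := by
    funext k
    simp [inputState, show x ≠ 0 by omega, show x ≠ 1 by omega]
  ra x hx := by
    funext i
    simp [inputState, show x ≠ 0 by omega, show x ≠ 1 by omega, show x ≠ 2 by omega,
      show x ≠ 3 by omega]

lemma inputState_edge_count : (T.inputState ends).natVar 1 = n := rfl

lemma inputState_ends (k : Fin n) : (T.inputState ends).natArr 0 k = (ends k).1 ∧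
    (T.inputState ends).natArr 1 k = (ends k).2 := by
  simp [inputState]

lemma inputState_node (p : Fin m) : (T.inputState ends).realArr 0 p = T.pos p 0 ∧
    (T.inputState ends).realArr 1 p = T.pos p 1 ∧ (T.inputState ends).realArr 2 p = T.low p ∧
    (T.inputState ends).realArr 3 p = T.high p := by
  simp [inputState]

/-- The directed edges are the listed edges in both orientations. -/
lemma inputState_edge {e : ℕ} (h1 : 1 ≤ e) (h2 : e ≤ 2 * n) : ∃ (k : Fin n) (p q : Fin m),
    (ends k = (p, q) ∨ ends k = (q, p)) ∧ (T.inputState ends).inHead e = p ∧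
      (T.inputState ends).inTail e = q := by
  rw [State.inHead, State.inTail, inputState_edge_count]
  by_cases h : e ≤ n
  · rw [if_pos h, if_pos h]
    have hk := inputState_ends (T := T) (ends := ends) ⟨e - 1, by omega⟩
    exact ⟨_, _, _, .inl rfl, hk.1, hk.2⟩
  · rw [if_neg h, if_neg h]
    have hk := inputState_ends (T := T) (ends := ends) ⟨e - 1 - n, by omega⟩
    exact ⟨_, _, _, .inr rfl, hk.2, hk.1⟩

lemma inputState_both (k : Fin n) : ∃ e, 1 ≤ e ∧ e ≤ 2 * n ∧
    (T.inputState ends).inHead e = (ends k).1 ∧ (T.inputState ends).inTail e = (ends k).2 := by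
  refine ⟨k + 1, by omega, by omega, ?_⟩
  rw [State.inHead, State.inTail, inputState_edge_count, if_pos (by omega), if_pos (by omega),
    Nat.add_sub_cancel]
  exact inputState_ends k

lemma inputState_inv {e : ℕ} {p q : Fin m} (hp : (T.inputState ends).inHead e = p)
    (hq : (T.inputState ends).inTail e = q) :
    (T.inputState ends).inInv e = 1 / dist (T.pos p) (T.pos q) := by
  have h1 := inputState_node (T := T) (ends := ends) p
  have h2 := inputState_node (T := T) (ends := ends) q
  rw [State.inInv, hp, hq, h1.1, h1.2.1, h2.1, h2.2.1, EuclideanSpace.dist_eq, Fin.sum_univ_two,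
    Real.dist_eq, Real.dist_eq, sq_abs, sq_abs, sq, sq]

lemma inputState_adj (hT : T.IsEdgeList ends) {e : ℕ} (h1 : 1 ≤ e) (h2 : e ≤ 2 * n) :
    ∃ p q : Fin m, (T.inputState ends).inHead e = p ∧ (T.inputState ends).inTail e = q ∧
      T.graph.Adj p q := by
  obtain ⟨k, p, q, hk, hp, hq⟩ := inputState_edge (T := T) (ends := ends) h1 h2
  refine ⟨p, q, hp, hq, ?_⟩
  have := hT.1 k
  rcases hk with hk | hk
  · rwa [hk] at this
  · rw [hk] at this
    exact this.symm

lemma represents_inputState (hT : T.IsEdgeList ends) {G : Net} (hN : G.N = 2 * n)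
    (hhd : ∀ e, G.E e → G.hd e = (T.inputState ends).inHead e)
    (htl : ∀ e, G.E e → G.tl e = (T.inputState ends).inTail e)
    (ha : ∀ e, G.E e → G.a e = (T.inputState ends).inInv e)
    (hlow : G.low = (T.inputState ends).realArr 2)
    (hhigh : G.high = (T.inputState ends).realArr 3) (hG : G.Good) : G.Represents T where
  edge e he := by
    obtain ⟨p, q, hp, hq, hadj⟩ := inputState_adj hT he.1 (hN ▸ he.2)
    exact ⟨p, q, (hhd e he).trans hp, (htl e he).trans hq, hadj,
      (ha e he).trans (inputState_inv hp hq)⟩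
  adj p q hadj := by
    obtain ⟨k, hk, -⟩ := hT.2 s(p, q) hadj
    obtain ⟨e, h1, h2, h3, h4⟩ := inputState_both (T := T) (ends := ends) k
    have he : G.E e := ⟨h1, hN ▸ h2⟩
    rw [← hhd e he] at h3
    rw [← htl e he] at h4
    rcases Sym2.eq_iff.1 hk with ⟨e1, e2⟩ | ⟨e1, e2⟩
    · exact ⟨e, he, h3.trans (by rw [e1]), h4.trans (by rw [e2])⟩
    · obtain ⟨f, hf, hfh, hft⟩ := hG.symm e he
      exact ⟨f, hf, hfh.trans (h4.trans (by rw [e2])), hft.trans (h3.trans (by rw [e1]))⟩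
  low p := by rw [hlow]; exact (inputState_node p).2.2.1
  high p := by rw [hhigh]; exact (inputState_node p).2.2.2

/-! ### The running time -/

/-- A bound for the running time on terrains with `n` edges. -/
def ridgeTime (n : ℕ) : ℕ := 6000 * (Nat.log 2 (2 * n + 1) + 1 + 1) * (2 * n + 1)

lemma ridgeTime_isBigO :
    (fun n : ℕ => (ridgeTime n : ℝ)) =O[Filter.atTop] fun n : ℕ => (n : ℝ) * Real.log n := by
  -- The constant is `6000 * 10 * 3`: for `n ≥ 2` the logarithmic factor is at most `10 * Real.log
  -- n`, and `2 * n + 1 ≤ 3 * n`.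
  refine Asymptotics.IsBigO.of_bound 180000 ?_
  filter_upwards [Filter.eventually_ge_atTop 2] with n hn
  have hn' : (2 : ℝ) ≤ n := by exact_mod_cast hn
  have h2 : (0.69 : ℝ) < Real.log 2 := by linarith [Real.log_two_gt_d9]
  have hlog : Real.log 2 ≤ Real.log n := Real.log_le_log two_pos hn'
  have hlog3 : (Nat.log 2 (2 * n + 1) : ℝ) ≤ 5 * Real.log n := by
    have h3 : (Nat.log 2 (2 * n + 1) : ℝ) ≤ Real.logb 2 (2 * n + 1 : ℕ) := by
      exact_mod_cast Real.natLog_le_logb (2 * n + 1) 2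
    -- This rests on `2 * n + 1 ≤ n ^ 3`. Division by `Real.log 2 > 0.69` turns the factor `3` into
    -- less than `5`.
    have h4 : Real.log ((2 * n + 1 : ℕ) : ℝ) ≤ 3 * Real.log n := by
      rw [← Real.log_rpow (by linarith)]
      refine Real.log_le_log (by positivity) ?_
      push_cast
      norm_cast
      nlinarith [Nat.mul_le_mul hn hn, pow_succ n 2]
    refine h3.trans ?_
    rw [Real.logb, div_le_iff₀ (by linarith)]
    nlinarith
  rw [Real.norm_of_nonneg (by positivity), Real.norm_of_nonneg (by nlinarith), ridgeTime]
  push_cast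
  have h5 : (Nat.log 2 (2 * n + 1) : ℝ) + 1 + 1 ≤ 10 * Real.log n := by linarith
  have h6 : 2 * (n : ℝ) + 1 ≤ 3 * n := by linarith
  calc 6000 * ((Nat.log 2 (2 * n + 1) : ℝ) + 1 + 1) * (2 * n + 1)
      ≤ 6000 * (10 * Real.log n) * (3 * n) := by gcongr
    _ = 180000 * (n * Real.log n) := by ring

end RealRAM

/-! ### Assembly of the program, its time bound and its correctness. -/

theorem mainTheorem4 :
    ∃ (c : RealRAM.Prog) (time : ℕ → ℕ),
      ((fun n : ℕ => (time n : ℝ)) =O[Filter.atTop] fun n : ℕ => (n : ℝ) * Real.log n) ∧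
      ∀ (m n : ℕ) (T : ImpreciseTerrain (Fin m)) (ends : Fin n → Fin m × Fin m),
        T.IsRegular → T.IsEdgeList ends →
        ∃ (s : RealRAM.State) (t : ℕ),
          RealRAM.Runs c (T.inputState ends) s t ∧ t ≤ time n ∧ s.Outputs T.fuzzyRidge := by
  refine ⟨RealRAM.ridge, RealRAM.ridgeTime, RealRAM.ridgeTime_isBigO, fun m n T ends hreg hT => ?_⟩
  obtain ⟨s, t, hrun, ht, G, lab, hG, hN, hhd, htl, ha, hlow, hhigh, hl, hne, hnd, hmem⟩ :=
    RealRAM.ok_ridge (s := T.inputState ends) (L := Nat.log 2 (2 * n + 1) + 1)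
      RealRAM.blank_inputState
      -- Edge lengths are positive because distinct nodes are distinct points, so the reciprocals
      -- computed by the program are positive.
      (fun e h1 h2 => by
        obtain ⟨p, q, hp, hq, hadj⟩ := RealRAM.inputState_adj hT h1 h2
        rw [RealRAM.inputState_inv hp hq]
        exact one_div_pos.2 (T.dist_pos_of_adj hadj))
      (Nat.lt_pow_succ_log_self one_lt_two _)
  have hrep := RealRAM.represents_inputState hT hN hhd htl ha hlow hhigh hG
  obtain ⟨rt, hrt, hrt'⟩ := hrep.exists_rooting hG hl hne
  refine ⟨s, t, hrun, ht, hnd, fun v => ?_⟩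
  rw [hreg.fuzzyRidge_eq hrt]
  refine (hmem v).trans ?_
  simp only [hrep.other_iff hG hne hrt', Set.mem_ofPred_eq]
  constructor
  · rintro ⟨z, p, hp, h⟩
    exact ⟨p, ⟨z, h⟩, hp⟩
  · rintro ⟨p, ⟨z, h⟩, hp⟩
    exact ⟨z, p, hp, h⟩
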